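/- A \emph{voting program} consists of Boolean variables: a query variable $Q$, a finite set $U$ of "Up" variables and a finite set $D$ of "Down" variables (either may be empty), $n = 1+|U|+|D|$ variables in all; two real rule weights $w_U, w_D$ (for the rules $Q \leftarrow \mathrm{Up}(x)$ and $Q \leftarrow \mathrm{Down}(x)$; e.g. $w_U = w$, $w_D=-w$); a real weight $w_v$ for every variable $v$; and an arbitrary set of evidence variables, whose values are fixed. A possible world $I$ is an assignment of the remaining (free) variables, identified with the set of all variables, including evidence, that are true. For a semantics $g:\mathbb N\to\mathbb R$ the weight of $I$ is $$W(I)=\sum_{v\in I} w_v + w_U\,\sigma(I)\, g(|U\cap I|) + w_D\,\sigma(I)\, g(|D\cap I|),\qquad \sigma(I)=\begin{cases}1 & Q\in I\\ -1 & Q\notin I,\end{cases}$$ and $\pi(I)=Z^{-1}e^{W(I)}$. The semantics are: linear, $g(m)=m$; ratio, $g(m)=\log(1+m)$; logical, $g(m)=\mathbb 1_{m>0}$. Gibbs sampling picks at each step a free variable uniformly at random and resamples it from its conditional distribution under $\pi$ given all other variables (if there is no free variable it does nothing). Let $\mathbb P_k$ be the distribution after $k$ steps, and let $\|\mathbb P-\mathbb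 P'\|_{\mathrm{tv}}=\sup_A|\mathbb P(A)-\mathbb P'(A)|$. (1) Logical and ratio semantics. (a) For every $B$ there is $\tau(n)=O(n\log n)$ such that for every voting program with $n$ variables and all weights at most $B$ in absolute value, every initial distribution and every $\varepsilon>0$, $\|\mathbb P_k-\pi\|_{\mathrm{tv}}\le\varepsilon$ for all $k\ge \tau(n)\log(1+\varepsilon^{-1})$. (b) For every $B$ there is $c>0$ such that for every $\varepsilon\in(0,1)$ and all sufficiently large $n$ (depending on $B$ and $\varepsilon$), for every voting program with $n$ variables, no evidence and all weights at most $B$ in absolute value, there is an initial world from which $\|\mathbb P_k-\pi\|_{\mathrm{tv}}>\varepsilon$ for all $k< c\,n\log n$. (2) Linear semantics. (a) For every $B$ there is $\tau(n)=2^{O(n)}$ such that for every voting program with $n$ variables and all weights at most $B$ in absolute value, every initial distribution and every $\varepsilon>0$, $\|\mathbb P_k-\pi\|_{\mathrm{tv}}\le\varepsilon$ for all $k\ge\tau(n)\log(1+\varepsilon^{-1})$. (b) There are constants $B$ and $c>0$ and, for every $n\ge1$, a voting program with $n$ variables, no evidence and all weights at most $B$ in absolute value, such that for every $\varepsilon\in(0,1)$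 and all sufficiently large $n$ there is an initial world from which $\|\mathbb P_k-\pi\|_{\mathrm{tv}}>\varepsilon$ for all $k<2^{cn}$. -/

import Mathlib

open Filter Asymptotics
open scoped ENNReal

noncomputable section

namespace Voting

/-- The three semantics for counting the satisfied groundings of a rule. -/
inductive Semantics where
  | linear
  | ratio
  | logical

/-- The function `g` attached to a semantics. -/
def Semantics.g : Semantics → ℕ → ℝ
  | .linear, m => (m : ℝ)
  | .ratio, m => Real.log (1 + (m : ℝ))
  | .logical, m => if 0 < m then 1 else 0

/-- The Boolean variables of a voting program: the query variable `Q`, `a` "Up" variables and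
`b` "Down" variables. -/
inductive Var (a b : ℕ) where
  | query : Var a b
  | up (i : Fin a) : Var a b
  | down (j : Fin b) : Var a b
  deriving DecidableEq, Fintype

/-- A voting program: the rules `Q :- Up(x)` with weight `ruleUp` and `Q :- Down(x)` with weight
`ruleDown`, a weight for every single variable, and an arbitrary set of evidence variables
(`evidence v = some b` fixes `v` to the value `b`; `evidence v = none` leaves `v` free). -/
structure VotingProgram where
  numUp : ℕ
  numDown : ℕ
  ruleUp : ℝ
  ruleDown : ℝ
  unary : Var numUp numDown → ℝ
  evidence : Var numUp numDown → Option Bool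

namespace VotingProgram

variable (P : VotingProgram)

/-- The number `n` of variables. -/
def numVars : ℕ := 1 + P.numUp + P.numDown

/-- All weights of the program are at most `B` in absolute value. -/
def WeightsBoundedBy (B : ℝ) : Prop :=
  |P.ruleUp| ≤ B ∧ |P.ruleDown| ≤ B ∧ ∀ v, |P.unary v| ≤ B

/-- No variable is evidence. -/
def EvidenceFree : Prop := ∀ v, P.evidence v = none

/-- The non-evidence variables. -/
abbrev FreeVar : Type := {v : Var P.numUp P.numDown // P.evidence v = none}

/-- A possible world is an assignment of truth values to the non-evidence variables. -/
abbrev World : Type := P.FreeVar → Bool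

variable {P}

/-- The truth value of an arbitrary variable in a possible world. -/
def value (x : P.World) (v : Var P.numUp P.numDown) : Bool :=
  if h : P.evidence v = none then x ⟨v, h⟩ else (P.evidence v).getD false

/-- The sign of the rules: `1` if `Q` holds in the world and `-1` otherwise. -/
def sign (x : P.World) : ℝ := if value x .query then 1 else -1

/-- The number of "Up" variables that hold in the world. -/
def upCount (x : P.World) : ℕ := (Finset.univ.filter fun i => value x (.up i) = true).card

/-- The number of "Down" variables that hold in the world. -/
def downCount (x : P.World) : ℕ := (Finset.univ.filter fun j => value x (.down j) = true).card

/-- The total weight of a possible world. -/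
def weight (s : Semantics) (x : P.World) : ℝ :=
  (∑ v, if value x v then P.unary v else 0)
    + P.ruleUp * sign x * s.g (upCount x)
    + P.ruleDown * sign x * s.g (downCount x)

/-- The unnormalized probability of a possible world. -/
def boltzmann (s : Semantics) (x : P.World) : ℝ≥0∞ := ENNReal.ofReal (Real.exp (weight s x))

theorem tsum_boltzmann_comp_ne_zero {α : Type} [Nonempty α] (s : Semantics) (f : α → P.World) :
    ∑' a, boltzmann s (f a) ≠ 0 := by
  intro h
  have h1 := ENNReal.tsum_eq_zero.mp h (Classical.arbitrary α)
  simp only [boltzmann, ENNReal.ofReal_eq_zero] at h1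
  exact absurd h1 (not_le.mpr (Real.exp_pos _))

theorem tsum_boltzmann_comp_ne_top {α : Type} [Fintype α] (s : Semantics) (f : α → P.World) :
    ∑' a, boltzmann s (f a) ≠ ∞ := by
  rw [tsum_fintype]
  exact (ENNReal.sum_lt_top.mpr fun a _ => ENNReal.ofReal_lt_top).ne

variable (P)

/-- The distribution of the program: each world `x` has probability `Z⁻¹ exp (weight x)`. -/
def stationary (s : Semantics) : PMF P.World :=
  PMF.normalize (fun x => boltzmann s x) (tsum_boltzmann_comp_ne_zero s id)
    (tsum_boltzmann_comp_ne_top s id)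

variable {P}

/-- Resample the free variable `v` from its conditional distribution given all the others: the
new value is `b` with probability proportional to `exp (weight (x with v set to b))`. -/
def resample (s : Semantics) (x : P.World) (v : P.FreeVar) : PMF P.World :=
  (PMF.normalize (fun b : Bool => boltzmann s (Function.update x v b))
    (tsum_boltzmann_comp_ne_zero s fun b : Bool => Function.update x v b)
    (tsum_boltzmann_comp_ne_top s fun b : Bool => Function.update x v b)).map
      fun b => Function.update x v b

open Classical in
/-- One step of Gibbs sampling: choose a non-evidence variable uniformly at random and resample
it. If every variable is evidence, there is only one world, and the chain stays there. -/
def gibbsStep (s : Semantics) (x : P.World) : PMF P.World :=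
  if h : Nonempty P.FreeVar then
    (@PMF.uniformOfFintype P.FreeVar _ h).bind fun v => resample s x v
  else PMF.pure x

/-- The distribution after `k` steps of Gibbs sampling from the initial distribution `μ`. -/
def law (s : Semantics) (μ : PMF P.World) : ℕ → PMF P.World
  | 0 => μ
  | k + 1 => (law s μ k).bind (gibbsStep s)

end VotingProgram

/-- Total variation distance: the largest difference of the probabilities of an event. -/
def tvDist {Ω : Type} (p q : PMF Ω) : ℝ :=
  ⨆ A : Set Ω, |(p.toOuterMeasure A).toReal - (q.toOuterMeasure A).toReal|

end Voting

end

/-!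
Gibbs sampling is treated as a single-site dynamics `glauber p` on Boolean configurations, acting on
real functions. A contraction of the oscillation of functions over `m` steps bounds the distance to
stationarity from every initial distribution (`VotingProgram.tvDist_law_le`).

*Rapid mixing for logical and ratio semantics.* The function `g` satisfies
`|g m - g n| ≤ |m - n| / (1 + min m n)`, and its increments vary even less. So once a positive
fraction of a large group ("Up" or "Down") is true, its variables hardly influence each other, and
a number `d` of disagreements in the group shifts the log-odds of the query variable by `O(d / N)`
only. These properties are collected in `IsVotingDynamics`. Two copies are run under the coupling
that updates the same site in both by the maximal coupling, and a `potential` is shown to contract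
by a factor `1 - c / N` per step wherever it is below `1` (`coupled_potential_le`). While the query
variable agrees, the potential is one minus `exp (-∑ r_j d_j)`, a guess for the probability that the
copies coalesce without the query variable ever disagreeing again, plus the `deficit` of each group,
an exponential penalty for having few true sites. While the query variable disagrees, it is slightly
below `1` as long as the deficits are small, and an update of the query variable restores the
agreement with probability bounded below. Since distinct configurations have a potential of at least
`1 / (1 + N)`, the copies coalesce within `O(N log N)` steps with probability bounded below. A group
of bounded size needs no deficit, only a larger rate `r_j`; as the size from which a group counts as
large depends on the bound for the small ones, three choices of the thresholds are combined so as to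
cover every pair of group sizes (`exists_osc_contraction`).

*The lower bound for logical and ratio semantics.* In the larger group the true sites are counted,
centered as if the variables were independent with their own weights. From the all-true
configuration this `deviation` decays like `(1 - 1 / N) ^ k`, with a variance `O(N)`, and in
equilibrium its second moment is `O(N)` as well; the interaction enters only through the `bias`,
which is bounded in mean square because the deficit is small. After `N log N / 8` steps the mean is
still of order `N ^ (3 / 4)`, and Chebyshev's inequality separates the two distributions
(`le_tvDist_of_second_moments`).

*The linear semantics.* Every variable other than the query variable takes either value with
probability bounded below, and the query variable with probability at least `exp (-O(N))`. So `N`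
steps reach a fixed configuration with probability at least `exp (-O(N))`, and Doeblin's condition
gives the upper bound (`glauber_osc_contraction`). For the lower bound, in `bottleneckProgram`
either value of the query variable confirms itself through the rules: the stationary flow between
the worlds with a true and with a false query variable is exponentially small against the weight
of the former, and that weight is exponentially small in total. Hence from some world the query
variable stays true for exponentially many steps (`IsMarkov.exists_pow_indicator_ge`).
-/

noncomputable section

namespace Voting

set_option linter.unusedSectionVars false

/-! ### Markov operators and oscillation -/

/-- A Markov operator on real functions: linear, positive, and preserving constants. -/
structure IsMarkov {α : Type} (T : (α → ℝ) →ₗ[ℝ] (α → ℝ)) : Prop where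
  nonneg : ∀ f : α → ℝ, (∀ x, 0 ≤ f x) → ∀ x, 0 ≤ T f x
  one : T (fun _ => 1) = fun _ => 1

namespace IsMarkov

variable {α : Type} {T : (α → ℝ) →ₗ[ℝ] (α → ℝ)}

theorem mono (hT : IsMarkov T) {f g : α → ℝ} (h : ∀ x, f x ≤ g x) (x : α) : T f x ≤ T g x := by
  have := hT.nonneg (g - f) (fun x => sub_nonneg.mpr (h x)) x
  rw [map_sub] at this
  exact sub_nonneg.mp this

theorem const (hT : IsMarkov T) (c : ℝ) : T (fun _ => c) = fun _ => c := by
  have h : (fun _ : α => c) = c • (fun _ : α => (1 : ℝ)) := by ext; simp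
  rw [h, map_smul, hT.one]

theorem mul_add_const (hT : IsMarkov T) (a b : ℝ) (f : α → ℝ) (x : α) :
    T (fun y => a * f y + b) x = a * T f x + b := by
  have h : (fun y => a * f y + b) = a • f + fun _ => b := by ext; simp
  rw [h, map_add, map_smul, hT.const]
  simp

theorem pow (hT : IsMarkov T) (k : ℕ) : IsMarkov (T ^ k) := by
  induction k with
  | zero => exact ⟨fun f hf x => hf x, rfl⟩
  | succ k ih =>
    refine ⟨fun f hf x => ?_, ?_⟩
    · rw [pow_succ, Module.End.mul_apply]
      exact ih.nonneg _ (hT.nonneg f hf) x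
    · rw [pow_succ, Module.End.mul_apply, hT.one, ih.one]

/-- Iterating an affine drift inequality. -/
theorem pow_apply_le_of_drift (hT : IsMarkov T) {V : α → ℝ} {a b : ℝ} (ha : 0 ≤ a) (ha1 : a < 1)
    (hb : 0 ≤ b) (h : ∀ x, T V x ≤ a * V x + b) (k : ℕ) (x : α) :
    (T ^ k) V x ≤ a ^ k * V x + b / (1 - a) := by
  have ha' : 0 < 1 - a := by linarith
  induction k with
  | zero => simpa using div_nonneg hb ha'.le
  | succ k ih =>
    rw [pow_succ, Module.End.mul_apply]
    calc (T ^ k) (T V) x ≤ (T ^ k) (fun y => a * V y + b) x := (hT.pow k).mono h x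
      _ = a * (T ^ k) V x + b := (hT.pow k).mul_add_const a b V x
      _ ≤ a * (a ^ k * V x + b / (1 - a)) + b := by gcongr
      _ = a ^ (k + 1) * V x + b / (1 - a) := by field_simp; ring

end IsMarkov

/-- The oscillation of `f` is at most `ε`. -/
def OscLE {α : Type} (f : α → ℝ) (ε : ℝ) : Prop := ∀ x y, f x - f y ≤ ε

theorem OscLE.map {α : Type} [Finite α] {T : (α → ℝ) →ₗ[ℝ] (α → ℝ)} (hT : IsMarkov T)
    {f : α → ℝ} {ε : ℝ} (h : OscLE f ε) : OscLE (T f) ε := by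
  intro x y
  have : Nonempty α := ⟨x⟩
  obtain ⟨z, hz⟩ := Finite.exists_min f
  have h1 := hT.mono (f := f) (g := fun _ => f z + ε) (fun w => by have := h w z; linarith) x
  have h2 := hT.mono (f := fun _ => f z) (g := f) hz y
  rw [hT.const] at h1 h2
  linarith

theorem OscLE.pow_of_contraction {α : Type} {T : (α → ℝ) →ₗ[ℝ] (α → ℝ)} {ρ : ℝ}
    (hρ : 0 < ρ) (h : ∀ f : α → ℝ, OscLE f 1 → OscLE (T f) ρ) (j : ℕ) (f : α → ℝ)
    (hf : OscLE f 1) : OscLE ((T ^ j) f) (ρ ^ j) := by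
  induction j with
  | zero => simpa using hf
  | succ j ih =>
    have hpos : 0 < ρ ^ j := pow_pos hρ j
    have h1 : OscLE ((ρ ^ j)⁻¹ • (T ^ j) f) 1 := by
      intro x y
      have := ih x y
      simp only [Pi.smul_apply, smul_eq_mul, ← mul_sub]
      rw [inv_mul_le_iff₀ hpos]
      linarith
    intro x y
    have h2 := h _ h1 x y
    simp only [map_smul, Pi.smul_apply, smul_eq_mul, ← mul_sub] at h2
    rw [inv_mul_le_iff₀ hpos] at h2
    rw [pow_succ', Module.End.mul_apply, pow_succ]
    linarith

/-- If `m` steps contract the oscillation by the factor `1 - δ`, then a number of steps of order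
`(m / δ) log (1 + 1 / ε)` brings it below `ε`. -/
theorem OscLE.pow_of_time {α : Type} [Finite α] {T : (α → ℝ) →ₗ[ℝ] (α → ℝ)} (hT : IsMarkov T)
    {m : ℕ} (hm : 0 < m) {δ : ℝ} (hδ : 0 < δ) (hδ1 : δ < 1)
    (h : ∀ f : α → ℝ, OscLE f 1 → OscLE ((T ^ m) f) (1 - δ)) {ε : ℝ} (hε : 0 < ε) {k : ℕ}
    (hk : 3 * m / δ * Real.log (1 + 1 / ε) ≤ k) (f : α → ℝ) (hf : OscLE f 1) :
    OscLE ((T ^ k) f) ε := by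
  rcases le_or_gt 1 ε with h1 | h1
  · intro x y
    exact (hf.map (hT.pow k) x y).trans h1
  · have hsplit : (T ^ k) f = (T ^ (k % m)) (((T ^ m) ^ (k / m)) f) := by
      rw [← Module.End.mul_apply, ← pow_mul, ← pow_add, Nat.mod_add_div]
    rw [hsplit]
    apply OscLE.map (hT.pow _)
    intro x y
    refine (OscLE.pow_of_contraction (by linarith) h (k / m) f hf x y).trans ?_
    -- as `ε < 1`, the logarithm is at least `1 / 2`, and the incomplete last block of fewer than
    -- `m` steps costs only a constant factor
    set l := Real.log (1 + 1 / ε) with hl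
    have hmR : (0 : ℝ) < m := by exact_mod_cast hm
    have hl2 : 1 / 2 ≤ l := by
      have h2 : Real.log 2 ≤ l := Real.log_le_log (by norm_num) (by
        have : 1 ≤ 1 / ε := by rw [le_div_iff₀ hε]; linarith
        linarith)
      have := Real.log_two_gt_d9
      linarith
    have hj : (k : ℝ) / m - 1 ≤ ((k / m : ℕ) : ℝ) := by
      have h3 : k < m * (k / m + 1) := by
        have := Nat.lt_mul_div_succ k hm
        simpa using this
      have h4 : (k : ℝ) < m * (((k / m : ℕ) : ℝ) + 1) := by exact_mod_cast h3
      rw [sub_le_iff_le_add, div_le_iff₀ hmR]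
      linarith
    have hk2 : 3 / δ * l ≤ (k : ℝ) / m := by
      rw [le_div_iff₀ hmR]
      calc 3 / δ * l * m = 3 * m / δ * l := by ring
        _ ≤ k := hk
    have hδl : δ * (3 / δ * l) = 3 * l := by field_simp
    have h5 : l ≤ δ * ((k / m : ℕ) : ℝ) := by
      have h6 : δ * (3 / δ * l) ≤ δ * (((k / m : ℕ) : ℝ) + 1) :=
        mul_le_mul_of_nonneg_left (by linarith) hδ.le
      nlinarith
    calc (1 - δ) ^ (k / m) ≤ (Real.exp (-δ)) ^ (k / m) := by
          apply pow_le_pow_left₀ (by linarith)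
          have := Real.add_one_le_exp (-δ)
          linarith
      _ = Real.exp (-(δ * ((k / m : ℕ) : ℝ))) := by
          rw [← Real.exp_nat_mul]; ring_nf
      _ ≤ Real.exp (-l) := Real.exp_le_exp.mpr (by linarith)
      _ = (1 + 1 / ε)⁻¹ := by
          rw [Real.exp_neg, Real.exp_log (by positivity)]
      _ ≤ ε := by
          rw [inv_le_comm₀ (by positivity) hε]
          have : ε⁻¹ = 1 / ε := by simp
          linarith

/-! ### Single-site dynamics on Boolean configurations -/

section Glauber

variable {ι : Type} [Fintype ι] [DecidableEq ι]

/-- All numbers `p x v` are probabilities. -/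
def IsProb (p : (ι → Bool) → ι → ℝ) : Prop := ∀ x v, 0 ≤ p x v ∧ p x v ≤ 1

/-- The expectation of `f` after the site `v` of `x` has been set to `true` with probability
`p x v` and to `false` otherwise. -/
def siteUpdate (p : (ι → Bool) → ι → ℝ) (v : ι) (f : (ι → Bool) → ℝ) (x : ι → Bool) : ℝ :=
  p x v * f (Function.update x v true) + (1 - p x v) * f (Function.update x v false)

/-- The transition operator of the dynamics that resamples a uniformly random site. -/
def glauber (p : (ι → Bool) → ι → ℝ) : ((ι → Bool) → ℝ) →ₗ[ℝ] ((ι → Bool) → ℝ) where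
  toFun f x := (Fintype.card ι : ℝ)⁻¹ * ∑ v, siteUpdate p v f x
  map_add' f g := by
    ext x
    simp only [siteUpdate, Pi.add_apply]
    rw [← mul_add, ← Finset.sum_add_distrib]
    congr 1
    exact Finset.sum_congr rfl fun v _ => by ring
  map_smul' c f := by
    ext x
    simp only [siteUpdate, Pi.smul_apply, smul_eq_mul, RingHom.id_apply]
    rw [mul_left_comm, Finset.mul_sum (a := c)]
    congr 1
    exact Finset.sum_congr rfl fun v _ => by ring

theorem glauber_apply (p : (ι → Bool) → ι → ℝ) (f : (ι → Bool) → ℝ) (x : ι → Bool) :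
    glauber p f x = (Fintype.card ι : ℝ)⁻¹ * ∑ v, siteUpdate p v f x := rfl

theorem siteUpdate_nonneg {p : (ι → Bool) → ι → ℝ} (hp : IsProb p) {f : (ι → Bool) → ℝ}
    (hf : ∀ x, 0 ≤ f x) (v : ι) (x : ι → Bool) : 0 ≤ siteUpdate p v f x :=
  add_nonneg (mul_nonneg (hp x v).1 (hf _)) (mul_nonneg (by linarith [(hp x v).2]) (hf _))

theorem glauber_isMarkov [Nonempty ι] {p : (ι → Bool) → ι → ℝ} (hp : IsProb p) :
    IsMarkov (glauber p) where
  nonneg f hf x := mul_nonneg (by positivity)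
    (Finset.sum_nonneg fun v _ => siteUpdate_nonneg hp hf v x)
  one := by
    ext x
    simp [glauber_apply, siteUpdate]

/-- A bound on the increments of `f` under the updates of the single sites, summed over the sites,
bounds the drift of `f`. -/
theorem glauber_apply_le [Nonempty ι] {p : (ι → Bool) → ι → ℝ} {f : (ι → Bool) → ℝ}
    {x : ι → Bool} {D : ℝ} (h : ∑ v, (siteUpdate p v f x - f x) ≤ D) :
    glauber p f x ≤ f x + D / Fintype.card ι := by
  have hN : (0 : ℝ) < Fintype.card ι := by exact_mod_cast Fintype.card_pos
  rw [glauber_apply, ← div_eq_inv_mul, div_le_iff₀ hN, add_mul, div_mul_cancel₀ _ hN.ne']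
  rw [Finset.sum_sub_distrib, Finset.sum_const, Finset.card_univ, nsmul_eq_mul] at h
  linarith

/-- The expectation of `F` after the site `v` has been updated in both configurations of a pair
by the maximal coupling of the two updates. -/
def siteCouple (p : (ι → Bool) → ι → ℝ) (v : ι) (F : (ι → Bool) × (ι → Bool) → ℝ)
    (z : (ι → Bool) × (ι → Bool)) : ℝ :=
  min (p z.1 v) (p z.2 v) * F (Function.update z.1 v true, Function.update z.2 v true)
    + min (1 - p z.1 v) (1 - p z.2 v) *
        F (Function.update z.1 v false, Function.update z.2 v false)
    + max (p z.1 v - p z.2 v) 0 * F (Function.update z.1 v true, Function.update z.2 v false)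
    + max (p z.2 v - p z.1 v) 0 * F (Function.update z.1 v false, Function.update z.2 v true)

/-- The transition operator of the coupled dynamics: both configurations update the same site,
with the maximal coupling. -/
def coupled (p : (ι → Bool) → ι → ℝ) :
    ((ι → Bool) × (ι → Bool) → ℝ) →ₗ[ℝ] ((ι → Bool) × (ι → Bool) → ℝ) where
  toFun F z := (Fintype.card ι : ℝ)⁻¹ * ∑ v, siteCouple p v F z
  map_add' f g := by
    ext x
    simp only [siteCouple, Pi.add_apply]
    rw [← mul_add, ← Finset.sum_add_distrib]
    congr 1
    exact Finset.sum_congr rfl fun v _ => by ring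
  map_smul' c f := by
    ext x
    simp only [siteCouple, Pi.smul_apply, smul_eq_mul, RingHom.id_apply]
    rw [mul_left_comm, Finset.mul_sum (a := c)]
    congr 1
    exact Finset.sum_congr rfl fun v _ => by ring

theorem coupled_apply (p : (ι → Bool) → ι → ℝ) (F : (ι → Bool) × (ι → Bool) → ℝ)
    (z : (ι → Bool) × (ι → Bool)) :
    coupled p F z = (Fintype.card ι : ℝ)⁻¹ * ∑ v, siteCouple p v F z := rfl

/-- The four outcomes of the maximal coupling, with their marginals. -/
theorem coupling_weights (s t : ℝ) :
    min s t + max (s - t) 0 = s ∧ min s t + max (t - s) 0 = t ∧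
    min (1 - s) (1 - t) + max (t - s) 0 = 1 - s ∧ min (1 - s) (1 - t) + max (s - t) 0 = 1 - t ∧
    max (s - t) 0 + max (t - s) 0 = |s - t| ∧ min s t + min (1 - s) (1 - t) = 1 - |s - t| := by
  rcases le_total s t with h | h
  · rw [min_eq_left h, min_eq_right (by linarith : 1 - t ≤ 1 - s),
      max_eq_right (by linarith : s - t ≤ 0), max_eq_left (by linarith : 0 ≤ t - s),
      abs_of_nonpos (by linarith : s - t ≤ 0)]
    refine ⟨?_, ?_, ?_, ?_, ?_, ?_⟩ <;> ring
  · rw [min_eq_right h, min_eq_left (by linarith : 1 - s ≤ 1 - t),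
      max_eq_left (by linarith : 0 ≤ s - t), max_eq_right (by linarith : t - s ≤ 0),
      abs_of_nonneg (by linarith : 0 ≤ s - t)]
    refine ⟨?_, ?_, ?_, ?_, ?_, ?_⟩ <;> ring

theorem siteCouple_nonneg {p : (ι → Bool) → ι → ℝ} (hp : IsProb p)
    {F : (ι → Bool) × (ι → Bool) → ℝ} (hF : ∀ z, 0 ≤ F z) (v : ι)
    (z : (ι → Bool) × (ι → Bool)) : 0 ≤ siteCouple p v F z := by
  have h1 := hp z.1 v
  have h2 := hp z.2 v
  refine add_nonneg (add_nonneg (add_nonneg ?_ ?_) ?_) ?_ <;> refine mul_nonneg ?_ (hF _)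
  · exact le_min h1.1 h2.1
  · exact le_min (by linarith) (by linarith)
  · exact le_max_right _ _
  · exact le_max_right _ _

theorem siteCouple_const (p : (ι → Bool) → ι → ℝ) (v : ι) (c : ℝ)
    (z : (ι → Bool) × (ι → Bool)) : siteCouple p v (fun _ => c) z = c := by
  obtain ⟨-, -, -, -, h5, h6⟩ := coupling_weights (p z.1 v) (p z.2 v)
  simp only [siteCouple]
  linear_combination c * h5 + c * h6

theorem siteCouple_fst (p : (ι → Bool) → ι → ℝ) (v : ι) (f : (ι → Bool) → ℝ)
    (z : (ι → Bool) × (ι → Bool)) :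
    siteCouple p v (fun w => f w.1) z = siteUpdate p v f z.1 := by
  obtain ⟨h1, h2, h3, h4, -, -⟩ := coupling_weights (p z.1 v) (p z.2 v)
  simp only [siteCouple, siteUpdate]
  linear_combination f (Function.update z.1 v true) * h1 + f (Function.update z.1 v false) * h3

theorem siteCouple_snd (p : (ι → Bool) → ι → ℝ) (v : ι) (f : (ι → Bool) → ℝ)
    (z : (ι → Bool) × (ι → Bool)) :
    siteCouple p v (fun w => f w.2) z = siteUpdate p v f z.2 := by
  obtain ⟨h1, h2, h3, h4, -, -⟩ := coupling_weights (p z.1 v) (p z.2 v)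
  simp only [siteCouple, siteUpdate]
  linear_combination f (Function.update z.2 v true) * h2 + f (Function.update z.2 v false) * h4

theorem coupled_isMarkov [Nonempty ι] {p : (ι → Bool) → ι → ℝ} (hp : IsProb p) :
    IsMarkov (coupled p) where
  nonneg f hf x := mul_nonneg (by positivity)
    (Finset.sum_nonneg fun v _ => siteCouple_nonneg hp hf v x)
  one := by
    ext x
    simp [coupled_apply, siteCouple_const]

theorem coupled_fst (p : (ι → Bool) → ι → ℝ) (f : (ι → Bool) → ℝ) :
    coupled p (fun w => f w.1) = fun w => glauber p f w.1 := by
  ext z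
  simp [coupled_apply, glauber_apply, siteCouple_fst]

theorem coupled_snd (p : (ι → Bool) → ι → ℝ) (f : (ι → Bool) → ℝ) :
    coupled p (fun w => f w.2) = fun w => glauber p f w.2 := by
  ext z
  simp [coupled_apply, glauber_apply, siteCouple_snd]

theorem coupled_pow_fst (p : (ι → Bool) → ι → ℝ) (k : ℕ) (f : (ι → Bool) → ℝ) :
    (coupled p ^ k) (fun w => f w.1) = fun w => (glauber p ^ k) f w.1 := by
  induction k generalizing f with
  | zero => rfl
  | succ k ih => rw [pow_succ, pow_succ, Module.End.mul_apply, coupled_fst, ih]; rfl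

theorem coupled_pow_snd (p : (ι → Bool) → ι → ℝ) (k : ℕ) (f : (ι → Bool) → ℝ) :
    (coupled p ^ k) (fun w => f w.2) = fun w => (glauber p ^ k) f w.2 := by
  induction k generalizing f with
  | zero => rfl
  | succ k ih => rw [pow_succ, pow_succ, Module.End.mul_apply, coupled_snd, ih]; rfl

/-- The probability that the coupled dynamics has not coalesced bounds the oscillation. -/
theorem glauber_pow_sub_le [Nonempty ι] {p : (ι → Bool) → ι → ℝ} (hp : IsProb p)
    {f : (ι → Bool) → ℝ} (hf : OscLE f 1) (k : ℕ) (x y : ι → Bool) :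
    (glauber p ^ k) f x - (glauber p ^ k) f y ≤
      (coupled p ^ k) (fun w => if w.1 = w.2 then 0 else 1) (x, y) := by
  have h := ((coupled_isMarkov hp).pow k).mono
    (f := (fun w => f w.1) - fun w => f w.2) (g := fun w => if w.1 = w.2 then 0 else 1)
    (fun w => by
      simp only [Pi.sub_apply]
      split_ifs with h
      · rw [h]; simp
      · exact hf _ _) (x, y)
  rw [map_sub, coupled_pow_fst, coupled_pow_snd] at h
  exact h

/-- Upper bound for the drift of `F` under the coupled dynamics. -/
theorem coupled_apply_le [Nonempty ι] {p : (ι → Bool) → ι → ℝ}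
    {F : (ι → Bool) × (ι → Bool) → ℝ} {z : (ι → Bool) × (ι → Bool)} {r D : ℝ}
    (h : ∑ v, (siteCouple p v F z - r) ≤ D) :
    coupled p F z ≤ r + D / Fintype.card ι := by
  have hN : (0 : ℝ) < Fintype.card ι := by exact_mod_cast Fintype.card_pos
  rw [coupled_apply, ← div_eq_inv_mul, div_le_iff₀ hN, add_mul, div_mul_cancel₀ _ hN.ne']
  rw [Finset.sum_sub_distrib, Finset.sum_const, Finset.card_univ, nsmul_eq_mul] at h
  linarith

/-! ### A lower bound for hitting a configuration -/

/-- If `x` agrees with `y` outside `A`, then `|A|` steps lead from `x` to `y` at least when they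
update the sites of `A` in any order, each to its value in `y`. -/
theorem glauber_pow_indicator_ge [Nonempty ι] {p : (ι → Bool) → ι → ℝ} (hp : IsProb p)
    {lo : ι → ℝ} (hlo : ∀ v, 0 ≤ lo v) (hlo1 : ∀ x v, lo v ≤ p x v)
    (hlo2 : ∀ x v, lo v ≤ 1 - p x v) (y : ι → Bool) (A : Finset ι) (x : ι → Bool)
    (hx : ∀ v, v ∉ A → x v = y v) :
    (A.card.factorial : ℝ) / (Fintype.card ι : ℝ) ^ A.card * ∏ v ∈ A, lo v ≤
      (glauber p ^ A.card) (fun w => if w = y then 1 else 0) x := by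
  have hN : (0 : ℝ) < Fintype.card ι := by exact_mod_cast Fintype.card_pos
  induction hk : A.card generalizing A x with
  | zero =>
    rw [Finset.card_eq_zero] at hk
    subst hk
    have : x = y := funext fun v => hx v (by simp)
    simp [this]
  | succ k ih =>
    rw [pow_succ' (glauber p), Module.End.mul_apply, glauber_apply]
    set h := (glauber p ^ k) (fun w => if w = y then 1 else 0) with hh
    have h0 : ∀ w, 0 ≤ h w := ((glauber_isMarkov hp).pow k).nonneg _ fun w => by
      split_ifs <;> norm_num
    -- the first step updates each site `v` of `A` with the same probability, which leaves
    -- `A.erase v`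
    have key : ∀ v ∈ A, (k.factorial : ℝ) / (Fintype.card ι : ℝ) ^ k * ∏ w ∈ A, lo w ≤
        siteUpdate p v h x := by
      intro v hv
      have hcard : (A.erase v).card = k := by rw [Finset.card_erase_of_mem hv, hk]; rfl
      have h1 := ih (A.erase v) (Function.update x v (y v)) (by
        intro w hw
        by_cases hwv : w = v
        · subst hwv; simp
        · rw [Function.update_of_ne hwv]
          exact hx w fun hwA => hw (Finset.mem_erase.mpr ⟨hwv, hwA⟩)) hcard
      have h2 : lo v * h (Function.update x v (y v)) ≤ siteUpdate p v h x := by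
        unfold siteUpdate
        have e1 := mul_nonneg (hp x v).1 (h0 (Function.update x v true))
        have e2 := mul_nonneg (sub_nonneg.mpr (hp x v).2) (h0 (Function.update x v false))
        cases hy : y v
        · have := mul_le_mul_of_nonneg_right (hlo2 x v) (h0 (Function.update x v false))
          linarith
        · have := mul_le_mul_of_nonneg_right (hlo1 x v) (h0 (Function.update x v true))
          linarith
      refine le_trans ?_ h2
      rw [← Finset.mul_prod_erase A lo hv, mul_left_comm]
      exact mul_le_mul_of_nonneg_left h1 (hlo v)
    have h3 : (A.card : ℝ) * ((k.factorial : ℝ) / (Fintype.card ι : ℝ) ^ k * ∏ w ∈ A, lo w) ≤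
        ∑ v, siteUpdate p v h x := by
      rw [← nsmul_eq_mul, ← Finset.sum_const]
      exact (Finset.sum_le_sum key).trans
        (Finset.sum_le_univ_sum_of_nonneg fun v => siteUpdate_nonneg hp h0 v x)
    rw [hk] at h3
    rw [Nat.factorial_succ, ← div_eq_inv_mul, le_div_iff₀ hN]
    refine le_trans (le_of_eq ?_) h3
    push_cast
    field_simp
    ring

/-- Doeblin's condition: a configuration that is reached in `card ι` steps with probability at
least `δ` from everywhere makes the oscillation contract. -/
theorem glauber_osc_contraction [Nonempty ι] {p : (ι → Bool) → ι → ℝ} (hp : IsProb p)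
    {lo : ι → ℝ} (hlo : ∀ v, 0 ≤ lo v) (hlo1 : ∀ x v, lo v ≤ p x v)
    (hlo2 : ∀ x v, lo v ≤ 1 - p x v) {δ : ℝ}
    (hδ : δ ≤ Real.exp (-(Fintype.card ι : ℝ)) * ∏ v, lo v) (f : (ι → Bool) → ℝ)
    (hf : OscLE f 1) : OscLE ((glauber p ^ Fintype.card ι) f) (1 - δ) := by
  have hN : (0 : ℝ) < Fintype.card ι := by exact_mod_cast Fintype.card_pos
  set N := Fintype.card ι with hNdef
  set T := glauber p ^ N with hTdef
  have hT : IsMarkov T := (glauber_isMarkov hp).pow N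
  let z : ι → Bool := fun _ => true
  have hit : ∀ x, δ ≤ T (fun w => if w = z then 1 else 0) x := by
    intro x
    have h1 := glauber_pow_indicator_ge hp hlo hlo1 hlo2 z Finset.univ x (by simp)
    rw [Finset.card_univ, ← hNdef] at h1
    refine hδ.trans (le_trans ?_ h1)
    refine mul_le_mul_of_nonneg_right ?_ (Finset.prod_nonneg fun v _ => hlo v)
    -- `N! / N ^ N ≥ exp (-N)`, by a single term of the exponential series
    have h2 := Real.pow_div_factorial_le_exp (N : ℝ) (by positivity) N
    have h3 : (0 : ℝ) < (N : ℝ) ^ N / N.factorial := by positivity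
    rw [Real.exp_neg]
    calc (Real.exp (N : ℝ))⁻¹ ≤ ((N : ℝ) ^ N / N.factorial)⁻¹ := inv_anti₀ h3 h2
      _ = _ := inv_div _ _
  obtain ⟨a, ha⟩ := Finite.exists_min f
  obtain ⟨b, hb⟩ := Finite.exists_max f
  intro x y
  -- the mass `δ` at `z` pulls both values towards `f z`
  have hu : T f x ≤ f b - δ * (f b - f z) := by
    have h1 := hT.mono (f := f)
      (g := fun w => (-(f b - f z)) * (if w = z then 1 else 0) + f b) (fun w => by
        split_ifs with h
        · subst h; linarith
        · have := hb w; linarith) x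
    rw [hT.mul_add_const] at h1
    have h2 := mul_le_mul_of_nonneg_left (hit x) (sub_nonneg.mpr (hb z))
    linarith
  have hl : f a + δ * (f z - f a) ≤ T f y := by
    have h1 := hT.mono (g := f)
      (f := fun w => (f z - f a) * (if w = z then 1 else 0) + f a) (fun w => by
        split_ifs with h
        · subst h; linarith
        · have := ha w; linarith) y
    rw [hT.mul_add_const] at h1
    have h2 := mul_le_mul_of_nonneg_left (hit y) (sub_nonneg.mpr (ha z))
    linarith
  have hδ1 : δ ≤ 1 := by
    refine (hit x).trans ?_
    have h1 := hT.mono (f := fun w => if w = z then (1 : ℝ) else 0) (g := fun _ => 1)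
      (fun w => by split_ifs <;> norm_num) x
    rwa [hT.one] at h1
  have hfab := hf b a
  nlinarith

end Glauber

/-! ### Expectations and total variation distance -/

section Expect

variable {Ω : Type} [Fintype Ω]

/-- The expectation of a real function under a distribution on a finite type. -/
def expect (μ : PMF Ω) (f : Ω → ℝ) : ℝ := ∑ x, (μ x).toReal * f x

theorem sum_toReal_eq_one (μ : PMF Ω) : ∑ x, (μ x).toReal = 1 := by
  rw [← ENNReal.toReal_sum fun x _ => μ.apply_ne_top x, ← tsum_fintype (L := .unconditional _),
    μ.tsum_coe, ENNReal.toReal_one]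

theorem expect_const (μ : PMF Ω) (c : ℝ) : expect μ (fun _ => c) = c := by
  rw [expect, ← Finset.sum_mul, sum_toReal_eq_one, one_mul]

theorem expect_mono (μ : PMF Ω) {f g : Ω → ℝ} (h : ∀ x, f x ≤ g x) : expect μ f ≤ expect μ g :=
  Finset.sum_le_sum fun x _ => mul_le_mul_of_nonneg_left (h x) ENNReal.toReal_nonneg

theorem expect_mul_add_const (μ : PMF Ω) (a b : ℝ) (f : Ω → ℝ) :
    expect μ (fun x => a * f x + b) = a * expect μ f + b := by
  have h := expect_const μ b
  unfold expect at *
  rw [Finset.mul_sum, ← h, ← Finset.sum_add_distrib]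
  exact Finset.sum_congr rfl fun x _ => by rw [h]; ring

theorem expect_add (μ : PMF Ω) (f g : Ω → ℝ) :
    expect μ (fun x => f x + g x) = expect μ f + expect μ g := by
  unfold expect
  rw [← Finset.sum_add_distrib]
  exact Finset.sum_congr rfl fun x _ => by ring

theorem expect_pure [DecidableEq Ω] (x : Ω) (f : Ω → ℝ) : expect (PMF.pure x) f = f x := by
  unfold expect
  rw [Finset.sum_eq_single x]
  · simp
  · intro y _ hy
    simp [PMF.pure_apply, hy]
  · simp

theorem expect_bind {Ω' : Type} [Fintype Ω'] (μ : PMF Ω) (κ : Ω → PMF Ω') (f : Ω' → ℝ) :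
    expect (μ.bind κ) f = expect μ fun x => expect (κ x) f := by
  unfold expect
  simp_rw [PMF.bind_apply, tsum_fintype]
  have h : ∀ y, (∑ a, μ a * κ a y).toReal = ∑ a, (μ a).toReal * (κ a y).toReal := by
    intro y
    rw [ENNReal.toReal_sum fun a _ =>
      ENNReal.mul_ne_top (μ.apply_ne_top a) ((κ a).apply_ne_top y)]
    simp
  simp_rw [h, Finset.sum_mul, Finset.mul_sum]
  rw [Finset.sum_comm]
  exact Finset.sum_congr rfl fun x _ => Finset.sum_congr rfl fun y _ => by ring

theorem expect_map {Ω' : Type} [Fintype Ω'] [DecidableEq Ω'] (μ : PMF Ω) (k : Ω → Ω')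
    (f : Ω' → ℝ) : expect (μ.map k) f = expect μ fun x => f (k x) := by
  rw [PMF.map, expect_bind]
  simp [expect_pure]

theorem toReal_toOuterMeasure (μ : PMF Ω) (A : Set Ω) :
    (μ.toOuterMeasure A).toReal = expect μ (A.indicator 1) := by
  rw [PMF.toOuterMeasure_apply_fintype, ENNReal.toReal_sum]
  · refine Finset.sum_congr rfl fun x _ => ?_
    by_cases h : x ∈ A <;> simp [h]
  · intro x _
    by_cases h : x ∈ A <;> simp [h, μ.apply_ne_top]

theorem tvDist_le {μ ν : PMF Ω} {ε : ℝ}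
    (h : ∀ f : Ω → ℝ, OscLE f 1 → expect μ f - expect ν f ≤ ε) : tvDist μ ν ≤ ε := by
  refine ciSup_le fun A => ?_
  rw [toReal_toOuterMeasure, toReal_toOuterMeasure, abs_sub_le_iff]
  have hle : ∀ x, A.indicator (1 : Ω → ℝ) x ≤ 1 := fun x =>
    Set.indicator_le_self' (fun _ _ => zero_le_one) x
  have hge : ∀ x, 0 ≤ A.indicator (1 : Ω → ℝ) x := fun x =>
    Set.indicator_nonneg (fun _ _ => zero_le_one) x
  refine ⟨h _ fun x y => by linarith [hle x, hge y], ?_⟩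
  have h1 := h (fun x => (-1) * A.indicator 1 x + 0) fun x y => by linarith [hle y, hge x]
  rw [expect_mul_add_const, expect_mul_add_const] at h1
  linarith

theorem expect_sub_le_tvDist (μ ν : PMF Ω) (A : Set Ω) :
    expect μ (A.indicator 1) - expect ν (A.indicator 1) ≤ tvDist μ ν := by
  have hbdd : BddAbove (Set.range fun A : Set Ω =>
      |(μ.toOuterMeasure A).toReal - (ν.toOuterMeasure A).toReal|) :=
    Set.Finite.bddAbove (Set.finite_range _)
  refine le_trans ?_ (le_ciSup hbdd A)
  rw [toReal_toOuterMeasure, toReal_toOuterMeasure]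
  exact le_abs_self _

/-- If all values of `f` are within `ε` of each other, so are all its expectations. -/
theorem expect_sub_expect_le {μ ν : PMF Ω} {f : Ω → ℝ} {ε : ℝ} (h : OscLE f ε) :
    expect μ f - expect ν f ≤ ε := by
  have h1 : ∀ y, expect μ f ≤ f y + ε := fun y => by
    rw [← expect_const μ (f y + ε)]
    exact expect_mono μ fun x => by linarith [h x y]
  have h2 : expect μ f - ε ≤ expect ν f := by
    rw [← expect_const ν (expect μ f - ε)]
    exact expect_mono ν fun y => by linarith [h1 y]
  linarith

end Expect

/-! ### Gibbs sampling as a single-site dynamics -/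

namespace VotingProgram

variable {P : VotingProgram}

/-- The conditional probability that the free variable `v` is true, given all other variables. -/
def prob (s : Semantics) (x : P.World) (v : P.FreeVar) : ℝ :=
  Real.sigmoid (weight s (Function.update x v true) - weight s (Function.update x v false))

theorem prob_isProb (s : Semantics) : IsProb (prob (P := P) s) := fun _ _ =>
  ⟨Real.sigmoid_nonneg _, Real.sigmoid_le_one _⟩

theorem expect_normalize_boltzmann {α : Type} [Fintype α] [Nonempty α] (s : Semantics)
    (k : α → P.World) (f : α → ℝ) :
    expect (PMF.normalize (fun a => boltzmann s (k a)) (tsum_boltzmann_comp_ne_zero s k)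
      (tsum_boltzmann_comp_ne_top s k)) f =
      (∑ a, Real.exp (weight s (k a)) * f a) / ∑ a, Real.exp (weight s (k a)) := by
  unfold expect
  simp_rw [PMF.normalize_apply, tsum_fintype, ENNReal.toReal_mul, ENNReal.toReal_inv]
  have h : (∑ a, boltzmann s (k a)).toReal = ∑ a, Real.exp (weight s (k a)) := by
    rw [ENNReal.toReal_sum (f := fun a => boltzmann s (k a)) fun a _ => ENNReal.ofReal_ne_top]
    exact Finset.sum_congr rfl fun a _ => ENNReal.toReal_ofReal (Real.exp_pos _).le
  rw [h, Finset.sum_div]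
  refine Finset.sum_congr rfl fun a _ => ?_
  rw [boltzmann, ENNReal.toReal_ofReal (Real.exp_pos _).le]
  ring

theorem sigmoid_sub (s t : ℝ) :
    Real.sigmoid (s - t) = Real.exp s / (Real.exp s + Real.exp t) := by
  rw [Real.sigmoid_def, neg_sub, Real.exp_sub]
  have := Real.exp_pos s
  have := Real.exp_pos t
  field_simp

theorem expect_resample (s : Semantics) (x : P.World) (v : P.FreeVar) (f : P.World → ℝ) :
    expect (resample s x v) f = siteUpdate (prob s) v f x := by
  rw [resample, expect_map, expect_normalize_boltzmann, Fintype.sum_bool, Fintype.sum_bool,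
    siteUpdate, prob, sigmoid_sub]
  have := Real.exp_pos (weight s (Function.update x v true))
  have := Real.exp_pos (weight s (Function.update x v false))
  field_simp
  ring

theorem expect_gibbsStep [h : Nonempty P.FreeVar] (s : Semantics) (x : P.World)
    (f : P.World → ℝ) : expect (gibbsStep s x) f = glauber (prob s) f x := by
  rw [gibbsStep, dif_pos h, expect_bind, glauber_apply, Finset.mul_sum]
  unfold expect
  refine Finset.sum_congr rfl fun v _ => ?_
  rw [← expect_resample, PMF.uniformOfFintype_apply]
  simp [expect]

theorem expect_law [Nonempty P.FreeVar] (s : Semantics) (μ : PMF P.World) (k : ℕ)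
    (f : P.World → ℝ) : expect (law s μ k) f = expect μ ((glauber (prob s) ^ k) f) := by
  induction k generalizing f with
  | zero => rfl
  | succ k ih =>
    rw [law, expect_bind, pow_succ, Module.End.mul_apply, ← ih]
    simp_rw [expect_gibbsStep]

theorem expect_stationary (s : Semantics) (f : P.World → ℝ) :
    expect (P.stationary s) f =
      (∑ x : P.World, Real.exp (weight s x) * f x) / ∑ x : P.World, Real.exp (weight s x) :=
  expect_normalize_boltzmann s id f

/-- Summing over all configurations, one may first symmetrize over the value of one site. -/
theorem sum_update_true_add_update_false {ι : Type} [Fintype ι] [DecidableEq ι] (v : ι)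
    (F : (ι → Bool) → ℝ) :
    ∑ x : ι → Bool, (F (Function.update x v true) + F (Function.update x v false)) =
      2 * ∑ x : ι → Bool, F x := by
  have hinv : Function.Involutive fun x : ι → Bool => Function.update x v (!(x v)) := by
    intro x
    simp
  have h1 : ∑ x : ι → Bool, F (Function.update x v (!(x v))) = ∑ x : ι → Bool, F x :=
    Equiv.sum_comp (hinv.toPerm _) F
  rw [two_mul]
  nth_rewrite 2 [← h1]
  rw [← Finset.sum_add_distrib]
  refine Finset.sum_congr rfl fun x _ => ?_
  cases h : x v
  · rw [Bool.not_false, add_comm]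
    congr 2
    rw [← h, Function.update_eq_self]
  · rw [Bool.not_true]
    congr 2
    rw [← h, Function.update_eq_self]

theorem sum_exp_mul_siteUpdate (s : Semantics) (v : P.FreeVar) (f : P.World → ℝ) :
    ∑ x : P.World, Real.exp (weight s x) * siteUpdate (prob s) v f x =
      ∑ x : P.World, Real.exp (weight s x) * f x := by
  have h2 : (2 : ℝ) ≠ 0 := two_ne_zero
  apply mul_left_cancel₀ h2
  rw [← sum_update_true_add_update_false v, ← sum_update_true_add_update_false v]
  refine Finset.sum_congr rfl fun x _ => ?_
  simp only [siteUpdate, prob, Function.update_idem, sigmoid_sub]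
  have := Real.exp_pos (weight s (Function.update x v true))
  have := Real.exp_pos (weight s (Function.update x v false))
  field_simp
  ring

theorem sum_exp_mul_glauber [Nonempty P.FreeVar] (s : Semantics) (f : P.World → ℝ) :
    ∑ x : P.World, Real.exp (weight s x) * glauber (prob s) f x =
      ∑ x : P.World, Real.exp (weight s x) * f x := by
  have hN : (Fintype.card P.FreeVar : ℝ) ≠ 0 := by exact_mod_cast Fintype.card_ne_zero
  simp_rw [glauber_apply, mul_left_comm _ (Fintype.card P.FreeVar : ℝ)⁻¹, Finset.mul_sum]
  rw [Finset.sum_comm]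
  simp_rw [← Finset.mul_sum, sum_exp_mul_siteUpdate]
  rw [Finset.sum_const, Finset.card_univ, nsmul_eq_mul, ← mul_assoc, inv_mul_cancel₀ hN, one_mul]

/-- The distribution of the program is stationary for Gibbs sampling. -/
theorem expect_stationary_glauber [Nonempty P.FreeVar] (s : Semantics) (f : P.World → ℝ) :
    expect (P.stationary s) (glauber (prob s) f) = expect (P.stationary s) f := by
  rw [expect_stationary, expect_stationary, sum_exp_mul_glauber]

theorem expect_stationary_glauber_pow [Nonempty P.FreeVar] (s : Semantics) (k : ℕ)
    (f : P.World → ℝ) :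
    expect (P.stationary s) ((glauber (prob s) ^ k) f) = expect (P.stationary s) f := by
  induction k with
  | zero => rfl
  | succ k ih => rw [pow_succ', Module.End.mul_apply, expect_stationary_glauber, ih]

/-- Contraction of the oscillation under Gibbs sampling bounds the distance to stationarity, from
every initial distribution. Without free variables there is only one world. -/
theorem tvDist_law_le {s : Semantics} {m : ℕ} (hm : 0 < m) {δ : ℝ} (hδ : 0 < δ) (hδ1 : δ < 1)
    (h : Nonempty P.FreeVar → ∀ f : P.World → ℝ, OscLE f 1 →
      OscLE ((glauber (prob s) ^ m) f) (1 - δ))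
    (μ : PMF P.World) {ε : ℝ} (hε : 0 < ε) {k : ℕ}
    (hk : 3 * m / δ * Real.log (1 + 1 / ε) ≤ k) :
    tvDist (law s μ k) (P.stationary s) ≤ ε := by
  refine tvDist_le fun f hf => ?_
  rcases isEmpty_or_nonempty P.FreeVar with he | hne
  · refine expect_sub_expect_le fun x y => ?_
    rw [Subsingleton.elim x y]
    linarith
  · rw [expect_law, ← expect_stationary_glauber_pow s k]
    exact expect_sub_expect_le
      (OscLE.pow_of_time (glauber_isMarkov (prob_isProb s)) hm hδ hδ1 (h hne) hε hk f hf)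

end VotingProgram

/-! ### Counting true sites and disagreements in the groups of a partition -/

section Count

variable {ι : Type} [Fintype ι] [DecidableEq ι] (κ : ι → Option Bool)

/-- The number of sites of the group `j`. -/
def size (j : Bool) : ℕ := (Finset.univ.filter fun v => κ v = some j).card

/-- The number of sites of the group `j` that are true in `x`. -/
def cnt (j : Bool) (x : ι → Bool) : ℕ :=
  (Finset.univ.filter fun v => κ v = some j ∧ x v = true).card

/-- The number of sites of the group `j` at which `x` and `y` differ. -/
def dis (j : Bool) (x y : ι → Bool) : ℕ :=
  (Finset.univ.filter fun v => κ v = some j ∧ x v ≠ y v).card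

/-- The configurations `x` and `y` agree at the sites that belong to no group. -/
def AgreeQ (x y : ι → Bool) : Prop := ∀ v, κ v = none → x v = y v

theorem sum_update_add {β M : Type} [AddCommMonoid M] (φ : ι → β → M) (z : ι → β) (v : ι)
    (b : β) :
    ∑ w, φ w (Function.update z v b w) + φ v (z v) = ∑ w, φ w (z w) + φ v b := by
  rw [← Finset.add_sum_erase _ _ (Finset.mem_univ v),
    ← Finset.add_sum_erase _ (fun w => φ w (z w)) (Finset.mem_univ v), Function.update_self,
    Finset.sum_congr rfl fun w hw => by rw [Function.update_of_ne (Finset.ne_of_mem_erase hw)]]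
  abel

variable {κ}

theorem cnt_update_of_ne {v : ι} {j : Bool} (h : κ v ≠ some j) (x : ι → Bool) (b : Bool) :
    cnt κ j (Function.update x v b) = cnt κ j x := by
  have := sum_update_add (fun w b => if κ w = some j ∧ b = true then 1 else 0) x v b
  simp only [h, false_and, if_false, add_zero] at this
  simpa only [cnt, Finset.card_filter] using this

theorem cnt_update {v : ι} {j : Bool} (h : κ v = some j) (x : ι → Bool) (b : Bool) :
    cnt κ j (Function.update x v b) + (if x v = true then 1 else 0) =
      cnt κ j x + if b = true then 1 else 0 := by
  have := sum_update_add (fun w b => if κ w = some j ∧ b = true then 1 else 0) x v b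
  simp only [h, true_and] at this
  simpa only [cnt, Finset.card_filter] using this

theorem dis_update_of_ne {v : ι} {j : Bool} (h : κ v ≠ some j) (x y : ι → Bool) (b c : Bool) :
    dis κ j (Function.update x v b) (Function.update y v c) = dis κ j x y := by
  unfold dis
  congr 1
  ext w
  by_cases hw : w = v
  · subst hw; simp [h]
  · simp [hw]

theorem dis_update {v : ι} {j : Bool} (h : κ v = some j) (x y : ι → Bool) (b c : Bool) :
    dis κ j (Function.update x v b) (Function.update y v c) + (if x v ≠ y v then 1 else 0) =
      dis κ j x y + if b ≠ c then 1 else 0 := by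
  have := sum_update_add (fun w (z : Bool × Bool) => if κ w = some j ∧ z.1 ≠ z.2 then 1 else 0)
    (fun w => (x w, y w)) v (b, c)
  simp only [h, true_and] at this
  simp only [dis, Finset.card_filter]
  convert this using 4 with w
  by_cases hw : w = v
  · subst hw; simp
  · simp [hw]

theorem cnt_le_size (j : Bool) (x : ι → Bool) : cnt κ j x ≤ size κ j :=
  Finset.card_le_card fun v hv => by
    simp only [Finset.mem_filter, Finset.mem_univ, true_and] at hv ⊢
    exact hv.1

theorem dis_le_size (j : Bool) (x y : ι → Bool) : dis κ j x y ≤ size κ j :=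
  Finset.card_le_card fun v hv => by
    simp only [Finset.mem_filter, Finset.mem_univ, true_and] at hv ⊢
    exact hv.1

theorem size_le_card (j : Bool) : size κ j ≤ Fintype.card ι := Finset.card_le_univ _

theorem dis_comm (j : Bool) (x y : ι → Bool) : dis κ j x y = dis κ j y x := by
  simp only [dis, ne_comm]

theorem cnt_le_cnt_add_dis (j : Bool) (x y : ι → Bool) :
    cnt κ j x ≤ cnt κ j y + dis κ j x y := by
  refine le_trans (Finset.card_le_card fun v hv => ?_) (Finset.card_union_le _ _)
  simp only [Finset.mem_filter, Finset.mem_univ, true_and, Finset.mem_union] at hv ⊢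
  by_cases hy : y v = true
  · exact Or.inl ⟨hv.1, hy⟩
  · exact Or.inr ⟨hv.1, by rw [hv.2]; exact fun h => hy h.symm⟩

theorem abs_cnt_sub_cnt_le (j : Bool) (x y : ι → Bool) :
    |(cnt κ j x : ℝ) - cnt κ j y| ≤ dis κ j x y := by
  have h1 : (cnt κ j x : ℝ) ≤ cnt κ j y + dis κ j x y := by
    exact_mod_cast cnt_le_cnt_add_dis j x y
  have h2 : (cnt κ j y : ℝ) ≤ cnt κ j x + dis κ j x y := by
    rw [dis_comm]; exact_mod_cast cnt_le_cnt_add_dis j y x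
  rw [abs_sub_le_iff]
  constructor <;> linarith

/-- A sum over all sites splits into the sites without a group and the two groups. -/
theorem sum_eq_sum_groups (f : ι → ℝ) :
    ∑ v, f v = ∑ v with κ v = none, f v + ∑ j, ∑ v with κ v = some j, f v := by
  rw [Fintype.sum_bool, ← add_assoc]
  simp only [Finset.sum_filter]
  rw [← Finset.sum_add_distrib, ← Finset.sum_add_distrib]
  refine Finset.sum_congr rfl fun v _ => ?_
  rcases hv : κ v with _ | (_ | _) <;> simp

end Count

/-- What the mixing argument needs to know about Gibbs sampling on a voting program with logical
or ratio semantics. The sites without a group (at most one) stand for the query variable. The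
probabilities of the grouped sites are bounded away from `0` and `1`; while the query variable
agrees, they depend only on the group itself, and the less the more of its sites are true. The
conditional distributions of the query variable in two configurations overlap by an amount
controlled by the relative number of disagreements. -/
structure IsVotingDynamics {ι : Type} [Fintype ι] [DecidableEq ι] (κ : ι → Option Bool)
    (p : (ι → Bool) → ι → ℝ) (p₀ C : ℝ) : Prop where
  isProb : IsProb p
  query_unique : ∀ v w, κ v = none → κ w = none → v = w
  le_prob : ∀ x v, κ v ≠ none → p₀ ≤ p x v
  prob_le : ∀ x v, κ v ≠ none → p x v ≤ 1 - p₀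
  site_lipschitz : ∀ x y v j, κ v = some j → AgreeQ κ x y →
    |p x v - p y v| * (cnt κ j x * cnt κ j y) ≤ C * dis κ j x y
  site_eq : ∀ x y v j, κ v = some j → AgreeQ κ x y → dis κ j x y = 0 → p x v = p y v
  query_overlap : ∀ x y v, κ v = none →
    Real.exp (-(C * ∑ j, (dis κ j x y : ℝ) / (1 + min (cnt κ j x : ℝ) (cnt κ j y)))) ≤
      1 - |p x v - p y v|

/-! ### The logistic function and the semantics -/

/-- The overlap of two Bernoulli distributions in terms of the difference of their log-odds. In
contrast to a bound by a Lipschitz constant, it is positive at any distance. -/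
theorem exp_neg_abs_le_sigmoid_overlap (s t : ℝ) :
    Real.exp (-|s - t|) ≤ 1 - |Real.sigmoid s - Real.sigmoid t| := by
  wlog h : t ≤ s generalizing s t
  · rw [abs_sub_comm s t, abs_sub_comm (Real.sigmoid s)]
    exact this t s (le_of_not_ge h)
  rw [abs_of_nonneg (sub_nonneg.mpr h),
    abs_of_nonneg (sub_nonneg.mpr (Real.sigmoid_le h)), Real.sigmoid_def, Real.sigmoid_def]
  have hab : Real.exp (-s) ≤ Real.exp (-t) := Real.exp_le_exp.mpr (by linarith)
  have he : Real.exp (-(s - t)) = Real.exp (-s) / Real.exp (-t) := by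
    rw [← Real.exp_sub]; ring_nf
  rw [he]
  have ha := Real.exp_pos (-s)
  have hb := Real.exp_pos (-t)
  generalize Real.exp (-s) = a at *
  generalize Real.exp (-t) = b at *
  have h1 : 1 - ((1 + a)⁻¹ - (1 + b)⁻¹) = a / (1 + a) + 1 / (1 + b) := by field_simp; ring
  have h2 : a / (1 + b) ≤ a / (1 + a) := by gcongr
  have h3 : a / b ≤ (a + 1) / (1 + b) := by
    rw [div_le_div_iff₀ hb (by linarith)]; nlinarith
  rw [h1]
  rw [add_div] at h3
  linarith

theorem abs_sigmoid_sub_le (s t : ℝ) : |Real.sigmoid s - Real.sigmoid t| ≤ |s - t| := by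
  have h1 := exp_neg_abs_le_sigmoid_overlap s t
  have h2 := Real.add_one_le_exp (-|s - t|)
  linarith

namespace Semantics

theorem g_increment_mem (s : Semantics) (m : ℕ) : 0 ≤ s.g (m + 1) - s.g m ∧
    s.g (m + 1) - s.g m ≤ 1 := by
  cases s
  · simp [g]
  · simp only [g]
    have h0 : (0 : ℝ) < 1 + m := by positivity
    push_cast
    rw [← Real.log_div (by positivity) h0.ne']
    have h1 : (1 : ℝ) ≤ (1 + (m + 1)) / (1 + m) := by rw [le_div_iff₀ h0]; linarith
    refine ⟨Real.log_nonneg h1, ?_⟩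
    refine (Real.log_le_sub_one_of_pos (by positivity)).trans ?_
    rw [sub_le_iff_le_add, div_le_iff₀ h0]
    linarith
  · simp only [g]
    rcases Nat.eq_zero_or_pos m with h | h
    · subst h; simp
    · simp [h]

theorem g_increment_le {s : Semantics} (hs : s = .logical ∨ s = .ratio) (m : ℕ) :
    s.g (m + 1) - s.g m ≤ 1 / (1 + (m : ℝ)) := by
  have h0 : (0 : ℝ) < 1 + m := by positivity
  rcases hs with rfl | rfl
  · simp only [g]
    rcases Nat.eq_zero_or_pos m with h | h
    · subst h; simp
    · simp [h]; positivity
  · simp only [g]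
    push_cast
    rw [← Real.log_div (by positivity) h0.ne']
    refine (Real.log_le_sub_one_of_pos (by positivity)).trans (le_of_eq ?_)
    field_simp
    ring

/-- With logical or ratio semantics, `g` varies slowly at large arguments. -/
theorem abs_g_sub_g_le {s : Semantics} (hs : s = .logical ∨ s = .ratio) (m n : ℕ) :
    |s.g m - s.g n| ≤ |(m : ℝ) - n| / (1 + min (m : ℝ) n) := by
  wlog h : n ≤ m generalizing m n
  · rw [abs_sub_comm, abs_sub_comm (m : ℝ), min_comm]
    exact this n m (le_of_not_ge h)
  have hR : (n : ℝ) ≤ m := by exact_mod_cast h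
  have h0 : (0 : ℝ) < 1 + n := by positivity
  rw [min_eq_right hR, abs_of_nonneg (sub_nonneg.mpr hR), le_div_iff₀ h0]
  rcases hs with rfl | rfl
  · simp only [g]
    rcases Nat.eq_zero_or_pos n with hn | hn
    · subst hn
      rcases Nat.eq_zero_or_pos m with hm | hm
      · subst hm; simp
      · have : (1 : ℝ) ≤ m := by exact_mod_cast hm
        simpa [hm] using this
    · simp [hn, hn.trans_le h, hR]
  · simp only [g]
    rw [← Real.log_div (by positivity) h0.ne', abs_of_nonneg (Real.log_nonneg (by
      rw [le_div_iff₀ h0]; linarith)), ← le_div_iff₀ h0]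
    refine (Real.log_le_sub_one_of_pos (by positivity)).trans (le_of_eq ?_)
    field_simp
    ring

/-- With logical or ratio semantics, the increments of `g` vary even more slowly. -/
theorem abs_increment_sub_increment_le {s : Semantics} (hs : s = .logical ∨ s = .ratio)
    (m n : ℕ) : |(s.g (m + 1) - s.g m) - (s.g (n + 1) - s.g n)| * ((1 + (m : ℝ)) * (1 + n)) ≤
      2 * |(m : ℝ) - n| := by
  wlog h : n ≤ m generalizing m n
  · rw [abs_sub_comm, abs_sub_comm (m : ℝ), mul_comm (1 + (m : ℝ))]
    exact this n m (le_of_not_ge h)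
  have hR : (n : ℝ) ≤ m := by exact_mod_cast h
  rw [abs_of_nonneg (sub_nonneg.mpr hR)]
  rcases hs with rfl | rfl
  · simp only [g]
    rcases Nat.eq_zero_or_pos n with hn | hn
    · subst hn
      rcases Nat.eq_zero_or_pos m with hm | hm
      · subst hm; simp
      · have : (1 : ℝ) ≤ m := by exact_mod_cast hm
        simp [hm]
        linarith
    · simp [hn, hn.trans_le h, hR]
  · simp only [g]
    have hm0 : (0 : ℝ) < 1 + m := by positivity
    have hn0 : (0 : ℝ) < 1 + n := by positivity
    push_cast
    have e : Real.log (1 + ((m : ℝ) + 1)) - Real.log (1 + (m : ℝ)) -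
        (Real.log (1 + ((n : ℝ) + 1)) - Real.log (1 + (n : ℝ))) =
        -Real.log (((2 + (n : ℝ)) * (1 + m)) / ((1 + n) * (2 + m))) := by
      rw [Real.log_div (by positivity) (by positivity), Real.log_mul (by positivity)
        (by positivity), Real.log_mul (by positivity) (by positivity)]
      ring_nf
    have h1 : (1 : ℝ) ≤ ((2 + (n : ℝ)) * (1 + m)) / ((1 + n) * (2 + m)) := by
      rw [le_div_iff₀ (by positivity)]; nlinarith
    rw [e, abs_neg, abs_of_nonneg (Real.log_nonneg h1)]
    have h2 := Real.log_le_sub_one_of_pos (x := ((2 + (n : ℝ)) * (1 + m)) / ((1 + n) * (2 + m)))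
      (by positivity)
    have h3 : ((2 + (n : ℝ)) * (1 + m)) / ((1 + n) * (2 + m)) - 1 =
        ((m : ℝ) - n) / ((1 + n) * (2 + m)) := by field_simp; ring
    rw [h3] at h2
    calc _ ≤ ((m : ℝ) - n) / ((1 + n) * (2 + m)) * ((1 + (m : ℝ)) * (1 + n)) := by gcongr
      _ = ((m : ℝ) - n) * ((1 + m) / (2 + m)) := by field_simp
      _ ≤ ((m : ℝ) - n) * 2 := by
        refine mul_le_mul_of_nonneg_left ?_ (by linarith)
        rw [div_le_iff₀ (by positivity)]; linarith
      _ = 2 * ((m : ℝ) - n) := by ring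

end Semantics

/-! ### The conditional distributions of a voting program -/

/-- The variables as the query variable together with two indexed families. -/
def Var.equivSum (a b : ℕ) : Var a b ≃ (Unit ⊕ Fin a) ⊕ Fin b where
  toFun v := match v with
    | .query => .inl (.inl ())
    | .up i => .inl (.inr i)
    | .down j => .inr j
  invFun v := match v with
    | .inl (.inl _) => .query
    | .inl (.inr i) => .up i
    | .inr j => .down j
  left_inv v := by cases v <;> rfl
  right_inv v := by rcases v with (_ | _) | _ <;> rfl

namespace VotingProgram

variable {P : VotingProgram}

/-- The group of a free variable: none for the query variable, `true` for the "Up" variables and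
`false` for the "Down" variables. -/
def group (v : P.FreeVar) : Option Bool :=
  match v.1 with
  | .query => none
  | .up _ => some true
  | .down _ => some false

variable (P) in
/-- The weight of the rule in which the variables of a group occur. -/
def ruleWeight (j : Bool) : ℝ := if j then P.ruleUp else P.ruleDown

variable (P) in
/-- The number of variables of a group that are true by evidence. -/
def evidenceCount (j : Bool) : ℕ :=
  if j then (Finset.univ.filter fun i => P.evidence (.up i) = some true).card
  else (Finset.univ.filter fun i => P.evidence (.down i) = some true).card

theorem value_eq_true_iff (x : P.World) (w : Var P.numUp P.numDown) :
    value x w = true ↔ (∃ h : P.evidence w = none, x ⟨w, h⟩ = true) ∨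
      P.evidence w = some true := by
  unfold value
  by_cases h : P.evidence w = none
  · simp [h]
  · obtain ⟨b, hb⟩ := Option.ne_none_iff_exists'.mp h
    simp [hb]

theorem card_value_eq {α : Type} [Fintype α] [DecidableEq α] (k : α → Var P.numUp P.numDown)
    (hk : Function.Injective k) (j : Bool)
    (hj : ∀ v : P.FreeVar, group v = some j ↔ ∃ i, k i = v.1) (x : P.World) :
    (Finset.univ.filter fun i => value x (k i) = true).card =
      (Finset.univ.filter fun i => P.evidence (k i) = some true).card + cnt group j x := by
  rw [← Finset.card_filter_add_card_filter_not (s := Finset.univ.filter fun i =>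
    value x (k i) = true) (fun i => P.evidence (k i) = some true)]
  congr 1
  · congr 1
    ext i
    simp only [Finset.mem_filter, Finset.mem_univ, true_and, value_eq_true_iff]
    tauto
  · refine Finset.card_bij (fun i hi => ⟨k i, ?_⟩) ?_ ?_ ?_
    · simp only [Finset.mem_filter, Finset.mem_univ, true_and, value_eq_true_iff] at hi
      rcases hi.1 with ⟨h, -⟩ | h
      · exact h
      · exact absurd h hi.2
    · intro i hi
      simp only [Finset.mem_filter, Finset.mem_univ, true_and, value_eq_true_iff] at hi ⊢
      refine ⟨(hj _).mpr ⟨i, rfl⟩, ?_⟩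
      rcases hi.1 with ⟨h, h'⟩ | h
      · exact h'
      · exact absurd h hi.2
    · intro i _ i' _ h
      exact hk (Subtype.mk.inj h)
    · intro v hv
      simp only [Finset.mem_filter, Finset.mem_univ, true_and] at hv
      obtain ⟨i, hi⟩ := (hj v).mp hv.1
      refine ⟨i, ?_, Subtype.ext hi⟩
      simp only [Finset.mem_filter, Finset.mem_univ, true_and, value_eq_true_iff, hi, v.2]
      exact ⟨Or.inl ⟨trivial, hv.2⟩, by simp⟩

theorem upCount_eq (x : P.World) : upCount x = P.evidenceCount true + cnt group true x := by
  refine card_value_eq _ (fun i i' h => by injection h) true (fun v => ?_) x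
  obtain ⟨v, hv⟩ := v
  cases v <;> simp [group]

theorem downCount_eq (x : P.World) : downCount x = P.evidenceCount false + cnt group false x := by
  refine card_value_eq _ (fun i i' h => by injection h) false (fun v => ?_) x
  obtain ⟨v, hv⟩ := v
  cases v <;> simp [group]

theorem weight_eq (s : Semantics) (x : P.World) :
    weight s x = (∑ w, if value x w then P.unary w else 0) +
      sign x * ∑ j, P.ruleWeight j * s.g (P.evidenceCount j + cnt group j x) := by
  rw [weight, Fintype.sum_bool, upCount_eq, downCount_eq]
  simp only [ruleWeight, if_true, Bool.false_eq_true, if_false]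
  ring

theorem value_update (x : P.World) (v : P.FreeVar) (b : Bool) (w : Var P.numUp P.numDown) :
    value (Function.update x v b) w = if w = v.1 then b else value x w := by
  unfold value
  by_cases h : P.evidence w = none
  · by_cases hw : w = v.1
    · subst hw; simp [h]
    · have : (⟨w, h⟩ : P.FreeVar) ≠ v := fun h' => hw (congrArg Subtype.val h')
      simp [h, hw, Function.update_of_ne this]
  · have hw : w ≠ v.1 := fun h' => h (h' ▸ v.2)
    simp [h, hw]

theorem sum_unary_update_sub (x : P.World) (v : P.FreeVar) :
    (∑ w, if value (Function.update x v true) w then P.unary w else 0) -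
      (∑ w, if value (Function.update x v false) w then P.unary w else 0) = P.unary v.1 := by
  rw [← Finset.sum_sub_distrib]
  simp_rw [value_update]
  rw [Finset.sum_eq_single v.1]
  · simp
  · intro w _ hw; simp [hw]
  · simp

theorem group_eq_none_iff (v : P.FreeVar) : group v = none ↔ v.1 = .query := by
  obtain ⟨v, hv⟩ := v
  cases v <;> simp [group]

theorem sign_update_of_group {v : P.FreeVar} (h : group v ≠ none) (x : P.World) (b : Bool) :
    sign (Function.update x v b) = sign x := by
  rw [Ne, group_eq_none_iff] at h
  rw [sign, sign, value_update, if_neg (Ne.symm h)]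

/-- The log-odds of an "Up" or "Down" variable given all others. -/
theorem logit_of_group (s : Semantics) (x : P.World) {v : P.FreeVar} {j : Bool}
    (h : group v = some j) :
    weight s (Function.update x v true) - weight s (Function.update x v false) =
      P.unary v.1 + P.ruleWeight j * sign x *
        (s.g (P.evidenceCount j + cnt group j (Function.update x v false) + 1) -
          s.g (P.evidenceCount j + cnt group j (Function.update x v false))) := by
  have hn : group v ≠ none := by rw [h]; simp
  rw [weight_eq, weight_eq, sign_update_of_group hn, sign_update_of_group hn]
  have h1 := cnt_update h (Function.update x v false) true
  simp only [Function.update_idem, Function.update_self] at h1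
  have h1' : cnt group j (Function.update x v true) =
      cnt group j (Function.update x v false) + 1 := by simpa using h1
  have h2 : ∀ b, cnt group (!j) (Function.update x v b) = cnt group (!j) x := fun b =>
    cnt_update_of_ne (by rw [h]; cases j <;> simp) x b
  have h3 : ∀ F : Bool → ℝ, ∑ i, F i = F j + F (!j) := fun F => by
    rw [Fintype.sum_bool]; cases j <;> simp [add_comm]
  rw [h3, h3, h1', h2, h2, ← add_assoc]
  have h4 := sum_unary_update_sub x v
  linear_combination h4

/-- The log-odds of the query variable given all others. -/
theorem logit_of_query (s : Semantics) (x : P.World) {v : P.FreeVar} (h : group v = none) :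
    weight s (Function.update x v true) - weight s (Function.update x v false) =
      P.unary v.1 + 2 * ∑ j, P.ruleWeight j * s.g (P.evidenceCount j + cnt group j x) := by
  have hs : ∀ b, sign (Function.update x v b) = if b then (1 : ℝ) else -1 := fun b => by
    rw [sign, value_update, if_pos ((group_eq_none_iff v).mp h).symm]
  have h2 : ∀ i b, cnt group i (Function.update x v b) = cnt group i x := fun i b =>
    cnt_update_of_ne (by rw [h]; simp) x b
  rw [weight_eq, weight_eq, hs, hs]
  simp_rw [h2]
  have h4 := sum_unary_update_sub x v
  simp only [if_true, Bool.false_eq_true, if_false]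
  linear_combination h4

theorem abs_ruleWeight_le {B : ℝ} (hB : P.WeightsBoundedBy B) (j : Bool) :
    |P.ruleWeight j| ≤ B := by
  unfold ruleWeight
  cases j
  · simpa using hB.2.1
  · simpa using hB.1

theorem abs_sign (x : P.World) : |sign x| = 1 := by
  unfold sign; split_ifs <;> simp

theorem abs_logit_of_group_le (s : Semantics) (x : P.World) {v : P.FreeVar} (h : group v ≠ none)
    {B : ℝ} (hB : P.WeightsBoundedBy B) :
    |weight s (Function.update x v true) - weight s (Function.update x v false)| ≤ 2 * B := by
  obtain ⟨j, hj⟩ := Option.ne_none_iff_exists'.mp h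
  rw [logit_of_group s x hj]
  refine (abs_add_le _ _).trans ?_
  obtain ⟨h0, h1⟩ := s.g_increment_mem
    (P.evidenceCount j + cnt group j (Function.update x v false))
  rw [abs_mul, abs_mul, abs_sign, mul_one, abs_of_nonneg h0]
  have h2 := abs_ruleWeight_le hB j
  have h3 := hB.2.2 v.1
  have h4 : |P.ruleWeight j| * (s.g (P.evidenceCount j +
      cnt group j (Function.update x v false) + 1) -
      s.g (P.evidenceCount j + cnt group j (Function.update x v false))) ≤ B * 1 :=
    mul_le_mul h2 h1 h0 ((abs_nonneg _).trans h2)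
  linarith

theorem sigmoid_le_prob (s : Semantics) (x : P.World) {v : P.FreeVar} (h : group v ≠ none)
    {B : ℝ} (hB : P.WeightsBoundedBy B) : Real.sigmoid (-(2 * B)) ≤ prob s x v :=
  Real.sigmoid_le (abs_le.mp (abs_logit_of_group_le s x h hB)).1

theorem prob_le_one_sub_sigmoid (s : Semantics) (x : P.World) {v : P.FreeVar}
    (h : group v ≠ none) {B : ℝ} (hB : P.WeightsBoundedBy B) :
    prob s x v ≤ 1 - Real.sigmoid (-(2 * B)) := by
  rw [Real.sigmoid_neg, sub_sub_cancel]
  exact Real.sigmoid_le (abs_le.mp (abs_logit_of_group_le s x h hB)).2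

theorem sign_eq_of_agreeQ {x y : P.World} (h : AgreeQ group x y) : sign x = sign y := by
  unfold sign value
  by_cases hq : P.evidence .query = none
  · simp only [hq, dif_pos]
    rw [h ⟨.query, hq⟩ rfl]
  · simp [hq]

/-- Gibbs sampling on a voting program with logical or ratio semantics. -/
theorem isVotingDynamics {s : Semantics} (hs : s = .logical ∨ s = .ratio) {B : ℝ}
    (hB : P.WeightsBoundedBy B) :
    IsVotingDynamics (group (P := P)) (prob s) (Real.sigmoid (-(2 * B))) (2 * B) where
  isProb := prob_isProb s
  query_unique v w hv hw :=
    Subtype.ext (((group_eq_none_iff v).mp hv).trans ((group_eq_none_iff w).mp hw).symm)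
  le_prob x v h := sigmoid_le_prob s x h hB
  prob_le x v h := prob_le_one_sub_sigmoid s x h hB
  site_lipschitz x y v j hv hQ := by
    have hB0 : 0 ≤ B := (abs_nonneg _).trans hB.1
    have h1 : |prob s x v - prob s y v| ≤ B *
        |(s.g (P.evidenceCount j + cnt group j (Function.update x v false) + 1) -
          s.g (P.evidenceCount j + cnt group j (Function.update x v false))) -
          (s.g (P.evidenceCount j + cnt group j (Function.update y v false) + 1) -
          s.g (P.evidenceCount j + cnt group j (Function.update y v false)))| := by
      refine (abs_sigmoid_sub_le _ _).trans ?_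
      rw [logit_of_group s x hv, logit_of_group s y hv, sign_eq_of_agreeQ hQ,
        add_sub_add_left_eq_sub, ← mul_sub, abs_mul, abs_mul, abs_sign, mul_one]
      exact mul_le_mul_of_nonneg_right (abs_ruleWeight_le hB j) (abs_nonneg _)
    have h2 := Semantics.abs_increment_sub_increment_le hs
      (P.evidenceCount j + cnt group j (Function.update x v false))
      (P.evidenceCount j + cnt group j (Function.update y v false))
    -- the log-odds of `v` involve the count without `v` itself, which is off by at most one
    have hle : ∀ z : P.World, (cnt group j z : ℝ) ≤
        1 + ((P.evidenceCount j + cnt group j (Function.update z v false) : ℕ) : ℝ) := fun z => by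
      have := cnt_update hv z false
      have h' : cnt group j z ≤
          1 + (P.evidenceCount j + cnt group j (Function.update z v false)) := by
        split_ifs at this <;> omega
      exact_mod_cast h'
    have hd : |((P.evidenceCount j + cnt group j (Function.update x v false) : ℕ) : ℝ) -
        ((P.evidenceCount j + cnt group j (Function.update y v false) : ℕ) : ℝ)| ≤
        dis group j x y := by
      push_cast
      rw [add_sub_add_left_eq_sub]
      refine (abs_cnt_sub_cnt_le j _ _).trans ?_
      have := dis_update hv x y false false
      simp only [ne_eq, not_true_eq_false, if_false, add_zero] at this
      exact_mod_cast (Nat.le_add_right _ _).trans this.le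
    have hc := mul_le_mul (hle x) (hle y) (Nat.cast_nonneg _) (by positivity)
    calc |prob s x v - prob s y v| * (cnt group j x * cnt group j y)
        ≤ _ := mul_le_mul h1 hc (by positivity) (by positivity)
      _ ≤ B * (2 * dis group j x y) := by
        rw [mul_assoc]
        exact mul_le_mul_of_nonneg_left (h2.trans (by linarith)) hB0
      _ = 2 * B * dis group j x y := by ring
  site_eq x y v j hv hQ h0 := by
    have hd : dis group j (Function.update x v false) (Function.update y v false) = 0 := by
      have := dis_update hv x y false false
      simp only [ne_eq, not_true_eq_false, if_false, add_zero, h0] at this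
      omega
    have hc : cnt group j (Function.update x v false) =
        cnt group j (Function.update y v false) := by
      have h1 := cnt_le_cnt_add_dis (κ := group) j (Function.update x v false)
        (Function.update y v false)
      have h2 := cnt_le_cnt_add_dis (κ := group) j (Function.update y v false)
        (Function.update x v false)
      rw [dis_comm] at h2
      omega
    rw [prob, prob, logit_of_group s x hv, logit_of_group s y hv, hc, sign_eq_of_agreeQ hQ]
  query_overlap x y v hv := by
    have hB0 : 0 ≤ B := (abs_nonneg _).trans hB.1
    refine le_trans (Real.exp_le_exp.mpr ?_) (exp_neg_abs_le_sigmoid_overlap _ _)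
    rw [logit_of_query s x hv, logit_of_query s y hv, neg_le_neg_iff, add_sub_add_left_eq_sub,
      ← mul_sub, ← Finset.sum_sub_distrib, abs_mul, abs_two, mul_assoc]
    refine mul_le_mul_of_nonneg_left ?_ two_pos.le
    rw [Finset.mul_sum]
    refine (Finset.abs_sum_le_sum_abs _ _).trans (Finset.sum_le_sum fun j _ => ?_)
    rw [← mul_sub, abs_mul]
    refine mul_le_mul (abs_ruleWeight_le hB j) ?_ (abs_nonneg _) hB0
    refine (Semantics.abs_g_sub_g_le hs _ _).trans ?_
    push_cast
    rw [add_sub_add_left_eq_sub, min_add_add_left]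
    refine div_le_div₀ (by positivity) (abs_cnt_sub_cnt_le j x y) (by positivity) ?_
    have : (0 : ℝ) ≤ P.evidenceCount j := by positivity
    linarith

theorem card_var (P : VotingProgram) : Fintype.card (Var P.numUp P.numDown) = P.numVars := by
  rw [Fintype.card_congr (Var.equivSum _ _)]
  simp [numVars]

theorem card_freeVar_le (P : VotingProgram) : Fintype.card P.FreeVar ≤ P.numVars := by
  rw [← card_var]
  exact Fintype.card_subtype_le _

end VotingProgram

/-! ### The number of true sites of a group is of the order of the group -/

section Deficit

variable {ι : Type} [Fintype ι] [DecidableEq ι] {κ : ι → Option Bool}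

variable (κ) in
/-- An exponential penalty for having few true sites in the group `j`: it is at least `1` exactly
if at most `c * size κ j` sites of the group are true. -/
def deficit (c : ℝ) (j : Bool) (x : ι → Bool) : ℝ := Real.exp (c * size κ j - cnt κ j x)

theorem deficit_pos (c : ℝ) (j : Bool) (x : ι → Bool) : 0 < deficit κ c j x := Real.exp_pos _

theorem lt_cnt_of_deficit_lt_one {c : ℝ} {j : Bool} {x : ι → Bool} (h : deficit κ c j x < 1) :
    c * size κ j < cnt κ j x := by
  rw [deficit, Real.exp_lt_one_iff] at h
  linarith

theorem deficit_update_of_ne {v : ι} {j : Bool} (h : κ v ≠ some j) (c : ℝ) (x : ι → Bool)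
    (b : Bool) : deficit κ c j (Function.update x v b) = deficit κ c j x := by
  rw [deficit, deficit, cnt_update_of_ne h]

/-- The drift of the deficit. If few sites of the group are true, the false sites dominate, each of
which turns true with probability at least `p₀`; otherwise the deficit is exponentially small. -/
theorem sum_siteUpdate_deficit_sub_le {p : (ι → Bool) → ι → ℝ} {p₀ : ℝ} (hp₀ : 0 < p₀)
    (hp₀' : p₀ ≤ 1 / 2) (hp : IsProb p) {j : Bool} (hj : ∀ x v, κ v = some j → p₀ ≤ p x v)
    (x : ι → Bool) :
    ∑ v, (siteUpdate p v (deficit κ (p₀ / 32) j) x - deficit κ (p₀ / 32) j x) ≤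
      -(p₀ / 4 * size κ j) * deficit κ (p₀ / 32) j x +
        3 * size κ j * Real.exp (-(p₀ / 32 * size κ j)) := by
  set V := deficit κ (p₀ / 32) j with hV
  have hV0 : 0 < V x := deficit_pos _ _ _
  have he : 2 ≤ Real.exp 1 := by have := Real.add_one_le_exp 1; linarith
  have he3 : Real.exp 1 ≤ 3 := by have := Real.exp_one_lt_d9; linarith
  -- turning a site true divides the deficit by `exp 1`, turning it false multiplies it by `exp 1`
  have hstep : ∀ v, siteUpdate p v V x - V x ≤
      V x * ((if κ v = some j ∧ x v = true then 2 + p₀ / 2 else 0) -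
        if κ v = some j then p₀ / 2 else 0) := by
    intro v
    by_cases h : κ v = some j
    · have h1 := cnt_update h x true
      have h0 := cnt_update h x false
      simp only [if_true, Bool.false_eq_true, if_false, add_zero] at h1 h0
      have hpv := hj x v h
      have hpv' := (hp x v).2
      cases hx : x v
      · simp only [hx, Bool.false_eq_true, if_false, add_zero] at h1 h0
        have e1 : V (Function.update x v true) = V x * (Real.exp 1)⁻¹ := by
          rw [hV, deficit, deficit, h1, ← Real.exp_neg, ← Real.exp_add]
          push_cast
          congr 1
          ring
        have e0 : V (Function.update x v false) = V x := by rw [hV, deficit, deficit, h0]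
        have hi : (Real.exp 1)⁻¹ ≤ 1 / 2 := by
          rw [inv_le_comm₀ (Real.exp_pos 1) (by norm_num)]; norm_num; exact he
        rw [siteUpdate, e1, e0]
        simp only [h, Bool.false_eq_true, and_false, if_false, if_true]
        have : p x v * (1 - (Real.exp 1)⁻¹) ≥ p₀ * (1 / 2) :=
          mul_le_mul hpv (by linarith) (by norm_num) (by linarith)
        nlinarith
      · simp only [hx, if_true] at h1 h0
        have e1 : V (Function.update x v true) = V x := by
          rw [hV, deficit, deficit, Nat.add_right_cancel h1]
        have e0 : V (Function.update x v false) = V x * Real.exp 1 := by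
          have h0' : (cnt κ j x : ℝ) = cnt κ j (Function.update x v false) + 1 := by
            exact_mod_cast h0.symm
          rw [hV, deficit, deficit, h0', ← Real.exp_add]
          congr 1
          ring
        rw [siteUpdate, e1, e0]
        simp only [h, and_self, if_true]
        have h2 : (1 - p x v) * (Real.exp 1 - 1) ≤ 1 * 2 :=
          mul_le_mul (by linarith) (by linarith) (by linarith) (by norm_num)
        nlinarith
    · have e : ∀ b, V (Function.update x v b) = V x := fun b => deficit_update_of_ne h _ _ _
      rw [siteUpdate, e, e]
      simp only [h, false_and, if_false]
      linarith
  have hsum : ∑ v, V x * ((if κ v = some j ∧ x v = true then 2 + p₀ / 2 else 0) -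
      if κ v = some j then p₀ / 2 else 0) =
      V x * ((2 + p₀ / 2) * cnt κ j x - p₀ / 2 * size κ j) := by
    rw [← Finset.mul_sum, Finset.sum_sub_distrib, ← Finset.sum_filter, ← Finset.sum_filter,
      Finset.sum_const, Finset.sum_const, nsmul_eq_mul, nsmul_eq_mul, cnt, size]
    ring
  refine (Finset.sum_le_sum fun v _ => hstep v).trans ?_
  rw [hsum]
  have hn : (0 : ℝ) ≤ size κ j := Nat.cast_nonneg _
  have hc : (cnt κ j x : ℝ) ≤ size κ j := by exact_mod_cast cnt_le_size j x
  have hc0 : (0 : ℝ) ≤ cnt κ j x := Nat.cast_nonneg _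
  set n : ℝ := (size κ j : ℝ)
  set u : ℝ := (cnt κ j x : ℝ) with hu
  -- `p₀ / 16` lies above the rate `p₀ / 32` of the deficit and is small enough for the drift
  rcases le_or_gt u (p₀ / 16 * n) with h | h
  · have h1 : (2 + p₀ / 2) * u - p₀ / 2 * n ≤ -(p₀ / 4 * n) := by nlinarith
    have h2 : V x * ((2 + p₀ / 2) * u - p₀ / 2 * n) ≤ V x * -(p₀ / 4 * n) :=
      mul_le_mul_of_nonneg_left h1 hV0.le
    have h3 : 0 ≤ 3 * n * Real.exp (-(p₀ / 32 * n)) := by positivity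
    linarith
  · have h1 : V x ≤ Real.exp (-(p₀ / 32 * n)) := by
      rw [hV, deficit]
      exact Real.exp_le_exp.mpr (by linarith)
    have h2 : (2 + p₀ / 2) * u - p₀ / 2 * n + p₀ / 4 * n ≤ 3 * n := by nlinarith
    have h3 : V x * ((2 + p₀ / 2) * u - p₀ / 2 * n + p₀ / 4 * n) ≤ V x * (3 * n) :=
      mul_le_mul_of_nonneg_left h2 hV0.le
    have h4 : V x * (3 * n) ≤ Real.exp (-(p₀ / 32 * n)) * (3 * n) :=
      mul_le_mul_of_nonneg_right h1 (by positivity)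
    linarith

/-- After any number of steps, the expected deficit is what is left of its initial value plus an
exponentially small term. -/
theorem glauber_pow_deficit_le [Nonempty ι] {p : (ι → Bool) → ι → ℝ} {p₀ : ℝ} (hp₀ : 0 < p₀)
    (hp₀' : p₀ ≤ 1 / 2) (hp : IsProb p) {j : Bool} (hj : ∀ x v, κ v = some j → p₀ ≤ p x v)
    (hn : 0 < size κ j) (k : ℕ) (x : ι → Bool) :
    (glauber p ^ k) (deficit κ (p₀ / 32) j) x ≤
      (1 - p₀ / 4 * size κ j / Fintype.card ι) ^ k * deficit κ (p₀ / 32) j x +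
        12 / p₀ * Real.exp (-(p₀ / 32 * size κ j)) := by
  have hN : (0 : ℝ) < Fintype.card ι := by exact_mod_cast Fintype.card_pos
  have hnR : (0 : ℝ) < size κ j := by exact_mod_cast hn
  have hnN : (size κ j : ℝ) ≤ Fintype.card ι := by exact_mod_cast size_le_card j
  have hq : p₀ / 4 * size κ j / Fintype.card ι ≤ 1 := by
    rw [div_le_one hN]; nlinarith
  have hq0 : 0 < p₀ / 4 * size κ j / Fintype.card ι := by positivity
  refine ((glauber_isMarkov hp).pow_apply_le_of_drift (V := deficit κ (p₀ / 32) j)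
    (a := 1 - p₀ / 4 * size κ j / Fintype.card ι)
    (b := 3 * size κ j * Real.exp (-(p₀ / 32 * size κ j)) / Fintype.card ι)
    (by linarith) (by linarith) (by positivity) (fun y => ?_) k x).trans (le_of_eq ?_)
  · refine (glauber_apply_le (sum_siteUpdate_deficit_sub_le hp₀ hp₀' hp hj y)).trans
      (le_of_eq ?_)
    field_simp
    ring
  · congr 1
    field_simp
    ring

/-- After `card ι` steps, even the largest initial deficit has become exponentially small. -/
theorem glauber_pow_deficit_le_of_card_le [Nonempty ι] {p : (ι → Bool) → ι → ℝ} {p₀ : ℝ}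
    (hp₀ : 0 < p₀) (hp₀' : p₀ ≤ 1 / 2) (hp : IsProb p) {j : Bool}
    (hj : ∀ x v, κ v = some j → p₀ ≤ p x v) (hn : 0 < size κ j) {k : ℕ}
    (hk : Fintype.card ι ≤ k) (x : ι → Bool) :
    (glauber p ^ k) (deficit κ (p₀ / 32) j) x ≤
      (1 + 12 / p₀) * Real.exp (-(p₀ / 32 * size κ j)) := by
  refine (glauber_pow_deficit_le hp₀ hp₀' hp hj hn k x).trans ?_
  rw [add_mul, one_mul]
  refine add_le_add ?_ le_rfl
  have hN : (0 : ℝ) < Fintype.card ι := by exact_mod_cast Fintype.card_pos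
  have hnR : (0 : ℝ) < size κ j := by exact_mod_cast hn
  have hnN : (size κ j : ℝ) ≤ Fintype.card ι := by exact_mod_cast size_le_card j
  have hkR : (Fintype.card ι : ℝ) ≤ k := by exact_mod_cast hk
  set q := p₀ / 4 * size κ j / Fintype.card ι with hq
  have hq1 : q ≤ 1 := by rw [hq, div_le_one hN]; nlinarith
  have h1 : (1 - q) ^ k ≤ Real.exp (-(p₀ / 4 * size κ j)) := by
    calc (1 - q) ^ k ≤ Real.exp (-q) ^ k := by
          refine pow_le_pow_left₀ (by linarith) ?_ k
          have := Real.add_one_le_exp (-q)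
          linarith
      _ = Real.exp (-(q * k)) := by rw [← Real.exp_nat_mul]; ring_nf
      _ ≤ Real.exp (-(p₀ / 4 * size κ j)) := by
          apply Real.exp_le_exp.mpr
          have h2 : q * Fintype.card ι = p₀ / 4 * size κ j := div_mul_cancel₀ _ hN.ne'
          have h3 : q * Fintype.card ι ≤ q * k :=
            mul_le_mul_of_nonneg_left hkR (by positivity)
          linarith
  calc (1 - q) ^ k * deficit κ (p₀ / 32) j x
      ≤ Real.exp (-(p₀ / 4 * size κ j)) * Real.exp (p₀ / 32 * size κ j - cnt κ j x) :=
        mul_le_mul_of_nonneg_right h1 (Real.exp_pos _).le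
    _ = Real.exp (-(p₀ / 4 * size κ j) + (p₀ / 32 * size κ j - cnt κ j x)) := by
        rw [Real.exp_add]
    _ ≤ Real.exp (-(p₀ / 32 * size κ j)) := by
        apply Real.exp_le_exp.mpr
        have : (0 : ℝ) ≤ cnt κ j x := Nat.cast_nonneg _
        nlinarith [mul_pos hp₀ hnR]

end Deficit

/-! ### Coalescence of the coupled dynamics -/

section Coalescence

variable {ι : Type} [Fintype ι] [DecidableEq ι] {κ : ι → Option Bool}
  {p : (ι → Bool) → ι → ℝ} {p₀ C : ℝ}

/-- What the coalescence potential needs to know about a group `j`: the rate `r` at which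
disagreements in the group are penalized, and a penalty `W` for configurations in which the
disagreements might grow. The total penalty of the disagreements of a group is at most `L`, the
potential lives on the scale `γ` of order `Real.exp (-(2 * L))`, and `Real.exp (-(2 * R))` bounds
the overlap of the conditional distributions of the query variable from below. By `gain`, as long
as the query variable agrees and the penalty is small, the relative growth of the probability of
success under updates in the group exceeds the influence of the group on the query variable. By
`burn_in`, the penalty is small on average after `card ι` steps from everywhere. -/
structure GroupControl (κ : ι → Option Bool) (p : (ι → Bool) → ι → ℝ) (p₀ C γ L R : ℝ) (j : Bool)
    (r : ℝ) (W : (ι → Bool) → ℝ) : Prop where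
  one_le_rate : 1 ≤ r * Fintype.card ι
  rate_mul_size_le : r * size κ j ≤ L
  penalty_nonneg : ∀ x, 0 ≤ W x
  penalty_update : ∀ v, κ v ≠ some j → ∀ x b, W (Function.update x v b) = W x
  penalty_drift : ∃ s : ℝ, 4 * s ≤ γ * p₀ * r ∧ 8 * s ≤ Real.exp (-(2 * R)) * γ ∧
    ∀ x, ∑ v, (siteUpdate p v W x - W x) ≤ -(p₀ / 4) * W x + s
  overlap : ∀ x y, W x + W y < 1 →
    C * ((dis κ j x y : ℝ) / (1 + min (cnt κ j x : ℝ) (cnt κ j y))) ≤ R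
  gain : ∀ x y, AgreeQ κ x y → dis κ j x y ≠ 0 → W x + W y < 1 →
    C * ((dis κ j x y : ℝ) / (1 + min (cnt κ j x : ℝ) (cnt κ j y))) + p₀ / 2 * (r * dis κ j x y) ≤
      ∑ v with κ v = some j, (Real.exp (r * if x v ≠ y v then 1 else 0) *
        (1 - |p x v - p y v| + |p x v - p y v| * Real.exp (-r)) - 1)
  burn_in : ∀ k, Fintype.card ι ≤ k → ∀ x, (glauber p ^ k) W x ≤ γ / 8

variable (κ) in
/-- The probability of successful coalescence that the potential assigns to two configurations
that agree at the query variable. -/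
def merit (r : Bool → ℝ) (z : (ι → Bool) × (ι → Bool)) : ℝ :=
  Real.exp (-∑ j, r j * dis κ j z.1 z.2)

variable (κ) in
/-- The penalty of a group counts only as long as the group has disagreements. -/
def livePenalty (W : Bool → (ι → Bool) → ℝ) (j : Bool) (z : (ι → Bool) × (ι → Bool)) : ℝ :=
  if dis κ j z.1 z.2 = 0 then 0 else W j z.1 + W j z.2

open Classical in
variable (κ) in
/-- The coalescence potential: an upper bound, up to a factor, for the probability that the
coupled dynamics does not coalesce. It is meaningful only where it is below `1`. -/
def potential (γ : ℝ) (r : Bool → ℝ) (W : Bool → (ι → Bool) → ℝ)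
    (z : (ι → Bool) × (ι → Bool)) : ℝ :=
  if AgreeQ κ z.1 z.2 then 1 - merit κ r z + ∑ j, livePenalty κ W j z
  else 1 - γ + ∑ j, (W j z.1 + W j z.2)

theorem siteCouple_mono (hp : IsProb p) {F H : (ι → Bool) × (ι → Bool) → ℝ} (v : ι)
    (z : (ι → Bool) × (ι → Bool))
    (h : ∀ b c, F (Function.update z.1 v b, Function.update z.2 v c) ≤
      H (Function.update z.1 v b, Function.update z.2 v c)) :
    siteCouple p v F z ≤ siteCouple p v H z := by
  have h1 := hp z.1 v
  have h2 := hp z.2 v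
  unfold siteCouple
  gcongr
  · exact le_min h1.1 h2.1
  · exact h _ _
  · exact le_min (by linarith) (by linarith)
  · exact h _ _
  · exact h _ _
  · exact h _ _

theorem siteCouple_add (p : (ι → Bool) → ι → ℝ) (v : ι) (F H : (ι → Bool) × (ι → Bool) → ℝ)
    (z : (ι → Bool) × (ι → Bool)) :
    siteCouple p v (fun w => F w + H w) z = siteCouple p v F z + siteCouple p v H z := by
  unfold siteCouple; ring

theorem siteCouple_sub (p : (ι → Bool) → ι → ℝ) (v : ι) (F H : (ι → Bool) × (ι → Bool) → ℝ)
    (z : (ι → Bool) × (ι → Bool)) :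
    siteCouple p v (fun w => F w - H w) z = siteCouple p v F z - siteCouple p v H z := by
  unfold siteCouple; ring

/-- If `F` depends only on whether the two updates have the same result, then only the overlap of
the two distributions matters. -/
theorem siteCouple_eq_of_agree_disagree {F : (ι → Bool) × (ι → Bool) → ℝ} {v : ι}
    {z : (ι → Bool) × (ι → Bool)} {α β : ℝ}
    (h : ∀ b c, F (Function.update z.1 v b, Function.update z.2 v c) = if b = c then α else β) :
    siteCouple p v F z = (1 - |p z.1 v - p z.2 v|) * α + |p z.1 v - p z.2 v| * β := by
  obtain ⟨-, -, -, -, h5, h6⟩ := coupling_weights (p z.1 v) (p z.2 v)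
  unfold siteCouple
  rw [h, h, h, h]
  simp only [if_true, Bool.true_eq_false, Bool.false_eq_true, if_false]
  linear_combination α * h6 + β * h5

theorem agreeQ_update_iff_of_ne {v : ι} (h : κ v ≠ none) (x y : ι → Bool) (b c : Bool) :
    AgreeQ κ (Function.update x v b) (Function.update y v c) ↔ AgreeQ κ x y := by
  refine forall_congr' fun w => forall_congr' fun hw => ?_
  have : w ≠ v := fun e => h (e ▸ hw)
  simp [this]

theorem sum_bool_eq (j : Bool) (f : Bool → ℝ) : ∑ i, f i = f j + f (!j) := by
  rw [Fintype.sum_bool]; cases j <;> simp [add_comm]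

theorem merit_update_of_none {v : ι} (h : κ v = none) (r : Bool → ℝ)
    (z : (ι → Bool) × (ι → Bool)) (b c : Bool) :
    merit κ r (Function.update z.1 v b, Function.update z.2 v c) = merit κ r z := by
  have hd : ∀ j, dis κ j (Function.update z.1 v b) (Function.update z.2 v c) =
      dis κ j z.1 z.2 := fun j => dis_update_of_ne (by rw [h]; simp) _ _ _ _
  simp only [merit, hd]

theorem merit_update {v : ι} {j : Bool} (h : κ v = some j) (r : Bool → ℝ)
    (z : (ι → Bool) × (ι → Bool)) (b c : Bool) :
    merit κ r (Function.update z.1 v b, Function.update z.2 v c) =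
      if b = c then merit κ r z * Real.exp (r j * if z.1 v ≠ z.2 v then 1 else 0)
      else merit κ r z * Real.exp (r j * if z.1 v ≠ z.2 v then 1 else 0) * Real.exp (-r j) := by
  have h1 : (dis κ j (Function.update z.1 v b) (Function.update z.2 v c) : ℝ) +
      (if z.1 v ≠ z.2 v then 1 else 0) = dis κ j z.1 z.2 + if b ≠ c then 1 else 0 := by
    have := dis_update h z.1 z.2 b c
    exact_mod_cast this
  have h2 : dis κ (!j) (Function.update z.1 v b) (Function.update z.2 v c) =
      dis κ (!j) z.1 z.2 := dis_update_of_ne (by rw [h]; cases j <;> simp) _ _ _ _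
  simp only [merit, sum_bool_eq j, h2]
  rw [eq_sub_of_add_eq h1]
  by_cases hbc : b = c
  · simp only [hbc, if_true, ← Real.exp_add]
    congr 1
    simp only [ne_eq, not_true_eq_false, if_false]
    ring
  · simp only [hbc, if_false, ← Real.exp_add]
    congr 1
    rw [if_pos (h := inferInstance) hbc]
    ring

theorem livePenalty_le {W : Bool → (ι → Bool) → ℝ} {j : Bool} (hW : ∀ x, 0 ≤ W j x)
    (z : (ι → Bool) × (ι → Bool)) : livePenalty κ W j z ≤ W j z.1 + W j z.2 := by
  unfold livePenalty
  split_ifs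
  · exact add_nonneg (hW _) (hW _)
  · exact le_rfl

theorem livePenalty_nonneg {W : Bool → (ι → Bool) → ℝ} {j : Bool} (hW : ∀ x, 0 ≤ W j x)
    (z : (ι → Bool) × (ι → Bool)) : 0 ≤ livePenalty κ W j z := by
  unfold livePenalty
  split_ifs
  · exact le_rfl
  · exact add_nonneg (hW _) (hW _)

theorem livePenalty_update_of_ne {W : Bool → (ι → Bool) → ℝ} {v : ι} {j : Bool}
    (h : κ v ≠ some j) (hW : ∀ x b, W j (Function.update x v b) = W j x)
    (z : (ι → Bool) × (ι → Bool)) (b c : Bool) :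
    livePenalty κ W j (Function.update z.1 v b, Function.update z.2 v c) =
      livePenalty κ W j z := by
  unfold livePenalty
  simp only [dis_update_of_ne h, hW]

/-- The sites of a group without disagreements are updated alike while the query variable
agrees, so that the group stays without disagreements. -/
theorem siteCouple_livePenalty_of_dis_eq_zero (hD : IsVotingDynamics κ p p₀ C)
    {W : Bool → (ι → Bool) → ℝ} {v : ι} {j : Bool} (h : κ v = some j)
    {z : (ι → Bool) × (ι → Bool)} (hQ : AgreeQ κ z.1 z.2) (h0 : dis κ j z.1 z.2 = 0) :
    siteCouple p v (livePenalty κ W j) z = 0 := by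
  have hp := hD.site_eq z.1 z.2 v j h hQ h0
  have hb : ∀ b, livePenalty κ W j (Function.update z.1 v b, Function.update z.2 v b) = 0 := by
    intro b
    have := dis_update h z.1 z.2 b b
    simp only [ne_eq, not_true_eq_false, if_false, h0] at this
    rw [livePenalty, if_pos (by simp only; omega)]
  unfold siteCouple
  rw [hb, hb, hp]
  simp

theorem siteCouple_livePenalty_le (hp : IsProb p) {W : Bool → (ι → Bool) → ℝ} {j : Bool}
    (hW : ∀ x, 0 ≤ W j x) (v : ι) (z : (ι → Bool) × (ι → Bool)) :
    siteCouple p v (livePenalty κ W j) z ≤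
      siteUpdate p v (W j) z.1 + siteUpdate p v (W j) z.2 := by
  rw [← siteCouple_fst p v (W j) z, ← siteCouple_snd p v (W j) z, ← siteCouple_add]
  exact siteCouple_mono hp v z fun b c => livePenalty_le hW _

/-- Summing over a group, the increments of a function that depends only on the group. -/
theorem sum_group_siteUpdate_sub {W : (ι → Bool) → ℝ} {j : Bool}
    (hW : ∀ v, κ v ≠ some j → ∀ x b, W (Function.update x v b) = W x) (x : ι → Bool) :
    ∑ v with κ v = some j, (siteUpdate p v W x - W x) = ∑ v, (siteUpdate p v W x - W x) := by
  refine Finset.sum_subset (Finset.filter_subset _ _) fun v _ hv => ?_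
  have h : κ v ≠ some j := fun h => hv (by simp [h])
  rw [siteUpdate, hW v h, hW v h]
  ring

theorem merit_ge {L : ℝ} {r : Bool → ℝ} (hr : ∀ j, 0 ≤ r j) (hL : ∀ j, r j * size κ j ≤ L)
    (z : (ι → Bool) × (ι → Bool)) : Real.exp (-(2 * L)) ≤ merit κ r z := by
  have h : ∀ j, r j * dis κ j z.1 z.2 ≤ L := fun j => by
    have : (dis κ j z.1 z.2 : ℝ) ≤ size κ j := by exact_mod_cast dis_le_size j z.1 z.2
    exact (mul_le_mul_of_nonneg_left this (hr j)).trans (hL j)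
  apply Real.exp_le_exp.mpr
  rw [Fintype.sum_bool]
  linarith [h true, h false]

end Coalescence

section Coalescence

variable {ι : Type} [Fintype ι] [DecidableEq ι] {κ : ι → Option Bool}
  {p : (ι → Bool) → ι → ℝ} {p₀ C γ L R : ℝ} {r : Bool → ℝ} {W : Bool → (ι → Bool) → ℝ}

/-- At most one site belongs to no group. -/
theorem sum_none_le (hD : IsVotingDynamics κ p p₀ C) {f : ι → ℝ} {q : ℝ} (hq : 0 ≤ q)
    (h : ∀ v, κ v = none → f v ≤ q) : ∑ v with κ v = none, f v ≤ q := by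
  have hcard : (Finset.univ.filter fun v => κ v = none).card ≤ 1 :=
    Finset.card_le_one.mpr fun v hv w hw =>
      hD.query_unique v w (Finset.mem_filter.mp hv).2 (Finset.mem_filter.mp hw).2
  have h1 := Finset.sum_le_card_nsmul (Finset.univ.filter fun v => κ v = none) f q
    fun v hv => h v (Finset.mem_filter.mp hv).2
  refine h1.trans ?_
  rw [nsmul_eq_mul]
  have : ((Finset.univ.filter fun v => κ v = none).card : ℝ) ≤ 1 := by exact_mod_cast hcard
  nlinarith

/-- The relative number of disagreements in a group, on which the query variable depends. -/
def queryInfluence (κ : ι → Option Bool) (C : ℝ) (j : Bool) (z : (ι → Bool) × (ι → Bool)) : ℝ :=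
  C * ((dis κ j z.1 z.2 : ℝ) / (1 + min (cnt κ j z.1 : ℝ) (cnt κ j z.2)))

theorem queryInfluence_nonneg (hC : 0 ≤ C) (j : Bool) (z : (ι → Bool) × (ι → Bool)) :
    0 ≤ queryInfluence κ C j z := by
  unfold queryInfluence; positivity

theorem abs_prob_sub_le_queryInfluence (hD : IsVotingDynamics κ p p₀ C)
    {v : ι} (hv : κ v = none) (z : (ι → Bool) × (ι → Bool)) :
    |p z.1 v - p z.2 v| ≤ ∑ j, queryInfluence κ C j z := by
  have h1 := hD.query_overlap z.1 z.2 v hv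
  have h2 := Real.add_one_le_exp (-(C * ∑ j, (dis κ j z.1 z.2 : ℝ) /
    (1 + min (cnt κ j z.1 : ℝ) (cnt κ j z.2))))
  rw [Finset.mul_sum] at h1 h2
  unfold queryInfluence
  linarith

theorem potential_of_agreeQ {z : (ι → Bool) × (ι → Bool)} (h : AgreeQ κ z.1 z.2) :
    potential κ γ r W z = 1 - merit κ r z + ∑ j, livePenalty κ W j z := if_pos h

theorem potential_of_not_agreeQ {z : (ι → Bool) × (ι → Bool)} (h : ¬AgreeQ κ z.1 z.2) :
    potential κ γ r W z = 1 - γ + ∑ j, (W j z.1 + W j z.2) := if_neg h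

theorem merit_le_one (hr : ∀ j, 0 < r j) (z : (ι → Bool) × (ι → Bool)) : merit κ r z ≤ 1 := by
  rw [merit, Real.exp_le_one_iff, neg_nonpos]
  exact Finset.sum_nonneg fun i _ => mul_nonneg (hr i).le (Nat.cast_nonneg _)

theorem potential_nonneg (hr : ∀ j, 0 < r j) (hW : ∀ i x, 0 ≤ W i x) (hγ : γ ≤ 1 / 2)
    (z : (ι → Bool) × (ι → Bool)) : 0 ≤ potential κ γ r W z := by
  by_cases hQ : AgreeQ κ z.1 z.2
  · rw [potential_of_agreeQ hQ]
    have h1 : merit κ r z ≤ 1 := merit_le_one hr z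
    have h2 : 0 ≤ ∑ j, livePenalty κ W j z :=
      Finset.sum_nonneg fun j _ => livePenalty_nonneg (hW j) z
    linarith
  · rw [potential_of_not_agreeQ hQ]
    have h2 : 0 ≤ ∑ j, (W j z.1 + W j z.2) :=
      Finset.sum_nonneg fun j _ => add_nonneg (hW j _) (hW j _)
    linarith

/-- The drift of the potential caused by updates in one group, while the query variable agrees. -/
theorem sum_group_siteCouple_potential_le_of_agreeQ (hD : IsVotingDynamics κ p p₀ C)
    (hp₀ : 0 < p₀) (hr : ∀ j, 0 < r j) (hγL : 2 * γ = Real.exp (-(2 * L)))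
    (hG : ∀ j, GroupControl κ p p₀ C γ L R j (r j) (W j)) {z : (ι → Bool) × (ι → Bool)}
    (hQ : AgreeQ κ z.1 z.2) (hz : potential κ γ r W z < 1) (j : Bool) :
    ∑ v with κ v = some j, (siteCouple p v (fun w => min 1 (potential κ γ r W w)) z -
      potential κ γ r W z) ≤ -(merit κ r z * queryInfluence κ C j z) -
        p₀ / 4 * (merit κ r z * (r j * dis κ j z.1 z.2) + livePenalty κ W j z) := by
  have hW : ∀ i x, 0 ≤ W i x := fun i => (hG i).penalty_nonneg
  have hm : 2 * γ ≤ merit κ r z :=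
    hγL ▸ merit_ge (fun i => (hr i).le) (fun i => (hG i).rate_mul_size_le) z
  have hm0 : 0 < merit κ r z := Real.exp_pos _
  have hm1 : ∀ v, κ v = some j → siteCouple p v (merit κ r) z =
      merit κ r z * (Real.exp (r j * if z.1 v ≠ z.2 v then 1 else 0) *
        (1 - |p z.1 v - p z.2 v| + |p z.1 v - p z.2 v| * Real.exp (-r j))) := fun v hv => by
    rw [siteCouple_eq_of_agree_disagree (merit_update hv r z)]
    ring
  -- the three contributions of the update of one site
  have hstep : ∀ v, κ v = some j →
      siteCouple p v (fun w => min 1 (potential κ γ r W w)) z - potential κ γ r W z ≤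
      -(merit κ r z * (Real.exp (r j * if z.1 v ≠ z.2 v then 1 else 0) *
        (1 - |p z.1 v - p z.2 v| + |p z.1 v - p z.2 v| * Real.exp (-r j)) - 1)) +
      (siteCouple p v (livePenalty κ W j) z - livePenalty κ W j z) := by
    intro v hv
    have hvn : κ v ≠ none := by rw [hv]; simp
    have h1 : siteCouple p v (fun w => min 1 (potential κ γ r W w)) z ≤
        siteCouple p v (fun w => ((1 - merit κ r w) + livePenalty κ W j w) +
          livePenalty κ W (!j) z) z := by
      refine siteCouple_mono hD.isProb v z fun b c => ?_
      refine (min_le_right _ _).trans (le_of_eq ?_)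
      have hQ' : AgreeQ κ (Function.update z.1 v b, Function.update z.2 v c).1
        (Function.update z.1 v b, Function.update z.2 v c).2 :=
        (agreeQ_update_iff_of_ne hvn _ _ b c).mpr hQ
      have hne : κ v ≠ some !j := by rw [hv]; cases j <;> simp
      rw [potential_of_agreeQ hQ', sum_bool_eq j, livePenalty_update_of_ne hne
        ((hG _).penalty_update v hne)]
      ring
    rw [siteCouple_add, siteCouple_add, siteCouple_sub, siteCouple_const, siteCouple_const,
      hm1 v hv] at h1
    rw [potential_of_agreeQ hQ, sum_bool_eq j]
    linarith
  refine (Finset.sum_le_sum fun v hv => hstep v (Finset.mem_filter.mp hv).2).trans ?_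
  rw [Finset.sum_add_distrib, Finset.sum_neg_distrib, ← Finset.mul_sum]
  by_cases h0 : dis κ j z.1 z.2 = 0
  · have hx : ∀ v, κ v = some j → z.1 v = z.2 v := fun v hv => by
      by_contra hne
      exact (Finset.card_pos.mpr ⟨v, Finset.mem_filter.mpr ⟨Finset.mem_univ v, hv, hne⟩⟩).ne' h0
    rw [Finset.sum_eq_zero, Finset.sum_eq_zero]
    · simp [queryInfluence, livePenalty, h0]
    · intro v hv
      have hv := (Finset.mem_filter.mp hv).2
      rw [siteCouple_livePenalty_of_dis_eq_zero hD hv hQ h0, livePenalty, if_pos h0, sub_zero]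
    · intro v hv
      have hv := (Finset.mem_filter.mp hv).2
      rw [hD.site_eq z.1 z.2 v j hv hQ h0, hx v hv]
      simp
  · have hWz : W j z.1 + W j z.2 < 1 := by
      rw [potential_of_agreeQ hQ] at hz
      have h1 : livePenalty κ W j z = W j z.1 + W j z.2 := if_neg h0
      have h2 : 0 ≤ livePenalty κ W (!j) z := livePenalty_nonneg (hW _) z
      have h3 : merit κ r z ≤ 1 := merit_le_one hr z
      rw [sum_bool_eq j] at hz
      linarith
    have hgain := mul_le_mul_of_nonneg_left ((hG j).gain z.1 z.2 hQ h0 hWz) hm0.le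
    obtain ⟨s, hs1, -, hs⟩ := (hG j).penalty_drift
    have hpen : ∑ v with κ v = some j, (siteCouple p v (livePenalty κ W j) z -
        livePenalty κ W j z) ≤ -(p₀ / 4) * livePenalty κ W j z + 2 * s := by
      have h1 : livePenalty κ W j z = W j z.1 + W j z.2 := if_neg h0
      calc _ ≤ ∑ v with κ v = some j, ((siteUpdate p v (W j) z.1 - W j z.1) +
              (siteUpdate p v (W j) z.2 - W j z.2)) := Finset.sum_le_sum fun v _ => by
            have := siteCouple_livePenalty_le (κ := κ) hD.isProb (hW j) v z
            linarith
        _ ≤ _ := by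
            rw [Finset.sum_add_distrib, sum_group_siteUpdate_sub (hG j).penalty_update,
              sum_group_siteUpdate_sub (hG j).penalty_update]
            rw [h1]
            linarith [hs z.1, hs z.2]
    -- the source of the penalty is dominated by the gain of a single disagreement
    have hdis : (1 : ℝ) ≤ dis κ j z.1 z.2 := by exact_mod_cast Nat.one_le_iff_ne_zero.mpr h0
    have h4 : 2 * s ≤ p₀ / 4 * (merit κ r z * (r j * dis κ j z.1 z.2)) := by
      have h5 : 2 * γ * (r j * 1) ≤ merit κ r z * (r j * dis κ j z.1 z.2) :=
        mul_le_mul hm (mul_le_mul_of_nonneg_left hdis (hr j).le) (by linarith [hr j]) hm0.le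
      have h6 := mul_le_mul_of_nonneg_left h5 hp₀.le
      nlinarith
    have h7 : queryInfluence κ C j z =
        C * ((dis κ j z.1 z.2 : ℝ) / (1 + min (cnt κ j z.1 : ℝ) (cnt κ j z.2))) := rfl
    rw [← h7] at hgain
    rw [mul_add] at hgain
    linarith

/-- The drift of the potential while the query variable agrees. An update of the query variable
creates a disagreement there with probability at most the influence of the groups, which is paid
for by the gain of the groups. -/
theorem coupled_potential_le_of_agreeQ [Nonempty ι] (hD : IsVotingDynamics κ p p₀ C)
    (hp₀ : 0 < p₀) (hC : 0 ≤ C) (hr : ∀ j, 0 < r j) (hγL : 2 * γ = Real.exp (-(2 * L)))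
    (hγ : γ ≤ 1 / 2) (hG : ∀ j, GroupControl κ p p₀ C γ L R j (r j) (W j))
    {z : (ι → Bool) × (ι → Bool)} (hQ : AgreeQ κ z.1 z.2) (hz : potential κ γ r W z < 1) :
    coupled p (fun w => min 1 (potential κ γ r W w)) z ≤
      potential κ γ r W z + -(γ * p₀ / 2 * potential κ γ r W z) / Fintype.card ι := by
  apply coupled_apply_le
  have hW : ∀ i x, 0 ≤ W i x := fun i => (hG i).penalty_nonneg
  have hm : 2 * γ ≤ merit κ r z :=
    hγL ▸ merit_ge (fun i => (hr i).le) (fun i => (hG i).rate_mul_size_le) z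
  have hm0 : 0 < merit κ r z := Real.exp_pos _
  have hγ0 : 0 < γ := by have := Real.exp_pos (-(2 * L)); linarith
  have hI : 0 ≤ ∑ j, queryInfluence κ C j z :=
    Finset.sum_nonneg fun j _ => queryInfluence_nonneg hC j z
  have hlive : 0 ≤ ∑ j, livePenalty κ W j z :=
    Finset.sum_nonneg fun j _ => livePenalty_nonneg (hW j) z
  rw [sum_eq_sum_groups (κ := κ)]
  -- since the potential is capped at `1`, a disagreement at the query variable costs at most the
  -- merit
  have hq : ∑ v with κ v = none, (siteCouple p v (fun w => min 1 (potential κ γ r W w)) z -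
      potential κ γ r W z) ≤ merit κ r z * ∑ j, queryInfluence κ C j z := by
    refine sum_none_le hD (mul_nonneg hm0.le hI) fun v hv => ?_
    have h1 : siteCouple p v (fun w => min 1 (potential κ γ r W w)) z ≤
        (1 - |p z.1 v - p z.2 v|) * potential κ γ r W z + |p z.1 v - p z.2 v| * 1 := by
      rw [← siteCouple_eq_of_agree_disagree (v := v) (z := z)
        (F := fun w => if w.1 v = w.2 v then potential κ γ r W z else 1)
        (fun b c => by simp)]
      refine siteCouple_mono hD.isProb v z fun b c => ?_
      simp only [Function.update_self]
      split_ifs with hbc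
      · subst hbc
        refine (min_le_right _ _).trans (le_of_eq ?_)
        have hne : ∀ i, κ v ≠ some i := fun i => by rw [hv]; simp
        have hQ' : AgreeQ κ (Function.update z.1 v b, Function.update z.2 v b).1
            (Function.update z.1 v b, Function.update z.2 v b).2 := fun w hw => by
          rw [hD.query_unique w v hw hv]; simp
        rw [potential_of_agreeQ hQ', potential_of_agreeQ hQ, merit_update_of_none hv]
        congr 1
        exact Finset.sum_congr rfl fun i _ =>
          livePenalty_update_of_ne (hne i) ((hG i).penalty_update v (hne i)) z b b
      · exact min_le_left _ _
    have h2 := abs_prob_sub_le_queryInfluence hD hv z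
    have h3 : 1 - potential κ γ r W z ≤ merit κ r z := by
      rw [potential_of_agreeQ hQ]; linarith
    have h4 : |p z.1 v - p z.2 v| * (1 - potential κ γ r W z) ≤
        |p z.1 v - p z.2 v| * merit κ r z := mul_le_mul_of_nonneg_left h3 (abs_nonneg _)
    have h5 : |p z.1 v - p z.2 v| * merit κ r z ≤
        (∑ j, queryInfluence κ C j z) * merit κ r z := mul_le_mul_of_nonneg_right h2 hm0.le
    linarith
  have hg := Finset.sum_le_sum fun j (_ : j ∈ Finset.univ) =>
    sum_group_siteCouple_potential_le_of_agreeQ hD hp₀ hr hγL hG hQ hz j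
  rw [Finset.sum_sub_distrib, Finset.sum_neg_distrib, ← Finset.mul_sum, ← Finset.mul_sum,
    Finset.sum_add_distrib, ← Finset.mul_sum] at hg
  have hs : 1 - merit κ r z ≤ ∑ j, r j * dis κ j z.1 z.2 := by
    have := Real.add_one_le_exp (-∑ j, r j * (dis κ j z.1 z.2 : ℝ))
    rw [merit]
    linarith
  have hs0 : 0 ≤ ∑ j, r j * (dis κ j z.1 z.2 : ℝ) :=
    Finset.sum_nonneg fun j _ => mul_nonneg (hr j).le (Nat.cast_nonneg _)
  have h6 : 2 * γ * (1 - merit κ r z) ≤ merit κ r z * ∑ j, r j * (dis κ j z.1 z.2 : ℝ) :=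
    (mul_le_mul_of_nonneg_left hs (by linarith)).trans (mul_le_mul_of_nonneg_right hm hs0)
  have h7 : 2 * γ * ∑ j, livePenalty κ W j z ≤ ∑ j, livePenalty κ W j z := by nlinarith
  have h8 := mul_le_mul_of_nonneg_left (add_le_add h6 h7) hp₀.le
  have h9 : potential κ γ r W z = 1 - merit κ r z + ∑ j, livePenalty κ W j z :=
    potential_of_agreeQ hQ
  rw [h9] at hq hg ⊢
  linarith

/-- The drift of the potential while the query variable disagrees. An update of the query variable
makes it agree with probability at least `Real.exp (-(2 * R))`, and then the potential drops by `γ`,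
because the merit is at least `2 * γ`. -/
theorem coupled_potential_le_of_not_agreeQ [Nonempty ι] (hD : IsVotingDynamics κ p p₀ C)
    (hp₀ : 0 < p₀) (hr : ∀ j, 0 < r j) (hγL : 2 * γ = Real.exp (-(2 * L)))
    (hG : ∀ j, GroupControl κ p p₀ C γ L R j (r j) (W j))
    {z : (ι → Bool) × (ι → Bool)} (hQ : ¬AgreeQ κ z.1 z.2) (hz : potential κ γ r W z < 1) :
    coupled p (fun w => min 1 (potential κ γ r W w)) z ≤
      potential κ γ r W z +
        -(Real.exp (-(2 * R)) * γ / 2 * potential κ γ r W z) / Fintype.card ι := by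
  apply coupled_apply_le
  have hW : ∀ i x, 0 ≤ W i x := fun i => (hG i).penalty_nonneg
  have hγ0 : 0 < γ := by have := Real.exp_pos (-(2 * L)); linarith
  have hρ := Real.exp_pos (-(2 * R))
  have hpot := potential_of_not_agreeQ (γ := γ) (r := r) (W := W) hQ
  have hL0 : γ ≤ 1 / 2 := by
    have hL : 0 ≤ L := le_trans (mul_nonneg (hr true).le (Nat.cast_nonneg _))
      (hG true).rate_mul_size_le
    have : Real.exp (-(2 * L)) ≤ 1 := Real.exp_le_one_iff.mpr (by linarith)
    linarith
  have hWz : ∀ j, W j z.1 + W j z.2 < 1 := fun j => by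
    rw [hpot, sum_bool_eq j] at hz
    linarith [hW (!j) z.1, hW (!j) z.2]
  obtain ⟨v₀, hv₀, hne⟩ : ∃ v, κ v = none ∧ z.1 v ≠ z.2 v := by
    unfold AgreeQ at hQ; push Not at hQ; exact hQ
  rw [sum_eq_sum_groups (κ := κ)]
  -- an update of the query variable makes the two configurations agree there with probability
  -- at least `exp (-(2 * R))`
  have hq : ∑ v with κ v = none, (siteCouple p v (fun w => min 1 (potential κ γ r W w)) z -
      potential κ γ r W z) ≤ -(Real.exp (-(2 * R)) * γ) := by
    have hs : (Finset.univ.filter fun v => κ v = none) = {v₀} := by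
      ext w
      simp only [Finset.mem_filter, Finset.mem_univ, true_and, Finset.mem_singleton]
      exact ⟨fun hw => hD.query_unique w v₀ hw hv₀, fun h => h ▸ hv₀⟩
    rw [hs, Finset.sum_singleton]
    have hns : ∀ i, κ v₀ ≠ some i := fun i => by rw [hv₀]; simp
    have h1 : siteCouple p v₀ (fun w => min 1 (potential κ γ r W w)) z ≤
        (1 - |p z.1 v₀ - p z.2 v₀|) * (potential κ γ r W z - γ) +
          |p z.1 v₀ - p z.2 v₀| * potential κ γ r W z := by
      rw [← siteCouple_eq_of_agree_disagree (v := v₀) (z := z)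
        (F := fun w => if w.1 v₀ = w.2 v₀ then potential κ γ r W z - γ else potential κ γ r W z)
        (fun b c => by simp)]
      refine siteCouple_mono hD.isProb v₀ z fun b c => ?_
      simp only [Function.update_self]
      have hWu : ∀ i x b, W i (Function.update x v₀ b) = W i x := fun i =>
        (hG i).penalty_update v₀ (hns i)
      refine (min_le_right _ _).trans ?_
      split_ifs with hbc
      · subst hbc
        have hQ' : AgreeQ κ (Function.update z.1 v₀ b, Function.update z.2 v₀ b).1
            (Function.update z.1 v₀ b, Function.update z.2 v₀ b).2 := fun w hw => by
          rw [hD.query_unique w v₀ hw hv₀]; simp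
        rw [potential_of_agreeQ hQ', merit_update_of_none hv₀, hpot]
        have h2 : 2 * γ ≤ merit κ r z :=
          hγL ▸ merit_ge (fun i => (hr i).le) (fun i => (hG i).rate_mul_size_le) z
        have h3 : ∑ j, livePenalty κ W j (Function.update z.1 v₀ b, Function.update z.2 v₀ b) ≤
            ∑ j, (W j z.1 + W j z.2) := Finset.sum_le_sum fun i _ => by
          rw [livePenalty_update_of_ne (hns i) (hWu i)]
          exact livePenalty_le (hW i) z
        linarith
      · have hQ' : ¬AgreeQ κ (Function.update z.1 v₀ b, Function.update z.2 v₀ c).1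
            (Function.update z.1 v₀ b, Function.update z.2 v₀ c).2 := fun h => by
          have := h v₀ hv₀
          simp at this
          exact hbc this
        rw [potential_of_not_agreeQ hQ', hpot]
        simp only [hWu]
        exact le_rfl
    have h2 : Real.exp (-(2 * R)) ≤ 1 - |p z.1 v₀ - p z.2 v₀| := by
      refine le_trans (Real.exp_le_exp.mpr ?_) (hD.query_overlap z.1 z.2 v₀ hv₀)
      rw [Finset.mul_sum, Fintype.sum_bool]
      linarith [(hG true).overlap z.1 z.2 (hWz true), (hG false).overlap z.1 z.2 (hWz false)]
    have h3 := mul_le_mul_of_nonneg_right h2 hγ0.le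
    linarith
  -- updates in the groups increase the potential only by the source of the penalty
  have hg : ∀ j, ∑ v with κ v = some j, (siteCouple p v
      (fun w => min 1 (potential κ γ r W w)) z - potential κ γ r W z) ≤
      Real.exp (-(2 * R)) * γ / 4 := by
    intro j
    obtain ⟨s, -, hs2, hs⟩ := (hG j).penalty_drift
    calc _ ≤ ∑ v with κ v = some j, ((siteUpdate p v (W j) z.1 - W j z.1) +
            (siteUpdate p v (W j) z.2 - W j z.2)) := Finset.sum_le_sum fun v hv => by
          have hv := (Finset.mem_filter.mp hv).2
          have hvn : κ v ≠ none := by rw [hv]; simp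
          have hvj : κ v ≠ some !j := by rw [hv]; cases j <;> simp
          have h1 : siteCouple p v (fun w => min 1 (potential κ γ r W w)) z ≤
              siteCouple p v (fun w => (W j w.1 + W j w.2) +
                (1 - γ + (W (!j) z.1 + W (!j) z.2))) z := by
            refine siteCouple_mono hD.isProb v z fun b c => ?_
            refine (min_le_right _ _).trans (le_of_eq ?_)
            have hQ' : ¬AgreeQ κ (Function.update z.1 v b, Function.update z.2 v c).1
                (Function.update z.1 v b, Function.update z.2 v c).2 := fun h =>
              hQ ((agreeQ_update_iff_of_ne hvn _ _ b c).mp h)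
            rw [potential_of_not_agreeQ hQ', sum_bool_eq j]
            simp only [(hG (!j)).penalty_update v hvj]
            ring
          rw [siteCouple_add, siteCouple_add, siteCouple_const, siteCouple_fst,
            siteCouple_snd] at h1
          rw [hpot, sum_bool_eq j]
          linarith
      _ ≤ 2 * s := by
          rw [Finset.sum_add_distrib, sum_group_siteUpdate_sub (hG j).penalty_update,
            sum_group_siteUpdate_sub (hG j).penalty_update]
          have h1 := mul_nonneg hp₀.le (hW j z.1)
          have h2 := mul_nonneg hp₀.le (hW j z.2)
          linarith [hs z.1, hs z.2]
      _ ≤ _ := by linarith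
  rw [Fintype.sum_bool]
  have h4 : Real.exp (-(2 * R)) * γ * potential κ γ r W z ≤ Real.exp (-(2 * R)) * γ * 1 :=
    mul_le_mul_of_nonneg_left hz.le (by positivity)
  linarith [hg true, hg false]

/-- Wherever it is below `1`, the potential contracts by a factor `1 - c / N`. -/
theorem coupled_potential_le [Nonempty ι] (hD : IsVotingDynamics κ p p₀ C)
    (hp₀ : 0 < p₀) (hp₀' : p₀ ≤ 1 / 2) (hC : 0 ≤ C) (hr : ∀ j, 0 < r j) (hR : 0 ≤ R)
    (hγL : 2 * γ = Real.exp (-(2 * L))) (hγ : γ ≤ 1 / 2)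
    (hG : ∀ j, GroupControl κ p p₀ C γ L R j (r j) (W j))
    {z : (ι → Bool) × (ι → Bool)} (hz : potential κ γ r W z < 1) :
    coupled p (fun w => min 1 (potential κ γ r W w)) z ≤
      (1 - Real.exp (-(2 * R)) * γ * p₀ / 2 / Fintype.card ι) * potential κ γ r W z := by
  have hN : (0 : ℝ) < Fintype.card ι := by exact_mod_cast Fintype.card_pos
  have hγ0 : 0 < γ := by have := Real.exp_pos (-(2 * L)); linarith
  have hρ0 := Real.exp_pos (-(2 * R))
  have hρ1 : Real.exp (-(2 * R)) ≤ 1 := Real.exp_le_one_iff.mpr (by linarith)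
  have hpos : 0 ≤ potential κ γ r W z :=
    potential_nonneg hr (fun i => (hG i).penalty_nonneg) hγ z
  set Φ := potential κ γ r W z with hΦ
  have key : ∀ a, Real.exp (-(2 * R)) * γ * p₀ / 2 ≤ a →
      Φ + -(a * Φ) / Fintype.card ι ≤
        (1 - Real.exp (-(2 * R)) * γ * p₀ / 2 / Fintype.card ι) * Φ := fun a ha => by
    have h1 := mul_le_mul_of_nonneg_right ha hpos
    have h2 : Real.exp (-(2 * R)) * γ * p₀ / 2 * Φ / Fintype.card ι ≤ a * Φ / Fintype.card ι :=
      div_le_div_of_nonneg_right h1 hN.le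
    have h3 : (1 - Real.exp (-(2 * R)) * γ * p₀ / 2 / Fintype.card ι) * Φ =
      Φ - Real.exp (-(2 * R)) * γ * p₀ / 2 * Φ / Fintype.card ι := by ring
    rw [h3, neg_div]
    linarith
  have hγp : 0 < γ * p₀ := mul_pos hγ0 hp₀
  by_cases hQ : AgreeQ κ z.1 z.2
  · refine (coupled_potential_le_of_agreeQ hD hp₀ hC hr hγL hγ hG hQ hz).trans (key _ ?_)
    nlinarith
  · refine (coupled_potential_le_of_not_agreeQ hD hp₀ hr hγL hG hQ hz).trans (key _ ?_)
    have := mul_pos hρ0 hγ0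
    nlinarith

/-- Distinct configurations have a potential of at least `1 / (1 + N)`. -/
theorem one_le_potential_mul [Nonempty ι] (hr : ∀ j, 0 < r j)
    (hγ : γ ≤ 1 / 2) (hG : ∀ j, GroupControl κ p p₀ C γ L R j (r j) (W j))
    {z : (ι → Bool) × (ι → Bool)} (hz : z.1 ≠ z.2) :
    1 ≤ min 1 (potential κ γ r W z) * (1 + Fintype.card ι) := by
  have hN : (1 : ℝ) ≤ Fintype.card ι := by exact_mod_cast Fintype.card_pos
  have hW : ∀ i x, 0 ≤ W i x := fun i => (hG i).penalty_nonneg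
  rw [← div_le_iff₀ (by linarith)]
  refine le_min (by rw [div_le_one (by linarith)]; linarith) ?_
  by_cases hQ : AgreeQ κ z.1 z.2
  · rw [potential_of_agreeQ hQ]
    obtain ⟨v, hv⟩ := Function.ne_iff.mp hz
    obtain ⟨j, hj⟩ := Option.ne_none_iff_exists'.mp fun h => hv (hQ v h)
    have hd : (1 : ℝ) ≤ dis κ j z.1 z.2 := by
      exact_mod_cast (Finset.card_pos.mpr
        ⟨v, Finset.mem_filter.mpr ⟨Finset.mem_univ v, hj, hv⟩⟩ : 0 < dis κ j z.1 z.2)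
    have h2 : 0 ≤ ∑ j, livePenalty κ W j z :=
      Finset.sum_nonneg fun j _ => livePenalty_nonneg (hW j) z
    have h3 : (Fintype.card ι : ℝ)⁻¹ ≤ ∑ i, r i * dis κ i z.1 z.2 := by
      rw [sum_bool_eq j]
      have e1 : r j * 1 ≤ r j * dis κ j z.1 z.2 := mul_le_mul_of_nonneg_left hd (hr j).le
      have e2 : 0 ≤ r (!j) * dis κ (!j) z.1 z.2 := mul_nonneg (hr _).le (Nat.cast_nonneg _)
      have e3 : (Fintype.card ι : ℝ)⁻¹ ≤ r j := by
        rw [inv_le_iff_one_le_mul₀ (by linarith)]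
        exact (hG j).one_le_rate
      linarith
    have h4 : merit κ r z ≤ Fintype.card ι / (1 + Fintype.card ι) := by
      have e1 : merit κ r z ≤ Real.exp (-(Fintype.card ι : ℝ)⁻¹) :=
        Real.exp_le_exp.mpr (by linarith)
      have e2 := Real.add_one_le_exp (Fintype.card ι : ℝ)⁻¹
      rw [Real.exp_neg] at e1
      refine e1.trans ((inv_anti₀ (by positivity) e2).trans (le_of_eq ?_))
      field_simp
    have h5 : (1 : ℝ) / (1 + Fintype.card ι) = 1 - Fintype.card ι / (1 + Fintype.card ι) := by
      field_simp; ring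
    linarith
  · rw [potential_of_not_agreeQ hQ]
    have h2 : 0 ≤ ∑ j, (W j z.1 + W j z.2) :=
      Finset.sum_nonneg fun j _ => add_nonneg (hW j _) (hW j _)
    have h3 : (1 : ℝ) / (1 + Fintype.card ι) ≤ 1 / 2 := by gcongr; linarith
    linarith

/-- The coupled dynamics fails to coalesce with probability at most about the potential. -/
theorem coupled_pow_ne_le [Nonempty ι] (hD : IsVotingDynamics κ p p₀ C)
    (hp₀ : 0 < p₀) (hp₀' : p₀ ≤ 1 / 2) (hC : 0 ≤ C) (hr : ∀ j, 0 < r j) (hR : 0 ≤ R)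
    (hγL : 2 * γ = Real.exp (-(2 * L))) (hγ : γ ≤ 1 / 2)
    (hG : ∀ j, GroupControl κ p p₀ C γ L R j (r j) (W j)) (t : ℕ)
    (z : (ι → Bool) × (ι → Bool)) :
    (coupled p ^ t) (fun w => if w.1 = w.2 then 0 else 1) z ≤
      min 1 (potential κ γ r W z) * (1 + Fintype.card ι *
        (1 - Real.exp (-(2 * R)) * γ * p₀ / 2 / Fintype.card ι) ^ t) := by
  have hN : (1 : ℝ) ≤ Fintype.card ι := by exact_mod_cast Fintype.card_pos
  have hγ0 : 0 < γ := by have := Real.exp_pos (-(2 * L)); linarith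
  have hρ0 := Real.exp_pos (-(2 * R))
  have hρ1 : Real.exp (-(2 * R)) ≤ 1 := Real.exp_le_one_iff.mpr (by linarith)
  set q := 1 - Real.exp (-(2 * R)) * γ * p₀ / 2 / Fintype.card ι with hq
  have hq0 : 0 ≤ q := by
    rw [hq, sub_nonneg, div_le_one (by linarith)]
    have h1 : Real.exp (-(2 * R)) * (γ * p₀) ≤ 1 * (γ * p₀) :=
      mul_le_mul_of_nonneg_right hρ1 (by positivity)
    nlinarith
  have hq1 : q ≤ 1 := by
    have : 0 ≤ Real.exp (-(2 * R)) * γ * p₀ / 2 / Fintype.card ι := by positivity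
    linarith
  have hbase : ∀ w : (ι → Bool) × (ι → Bool), (if w.1 = w.2 then (0 : ℝ) else 1) ≤ 1 :=
    fun w => by split_ifs <;> norm_num
  induction t generalizing z with
  | zero =>
    rw [pow_zero, pow_zero, mul_one, Module.End.one_apply]
    split_ifs with h
    · exact mul_nonneg (le_min zero_le_one (potential_nonneg hr (fun i => (hG i).penalty_nonneg)
        hγ z)) (by linarith)
    · exact one_le_potential_mul hr hγ hG h
  | succ t ih =>
    rcases le_or_gt 1 (potential κ γ r W z) with h | h
    · rw [min_eq_left h, one_mul]
      have h1 := ((coupled_isMarkov hD.isProb).pow (t + 1)).mono hbase z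
      rw [((coupled_isMarkov hD.isProb).pow (t + 1)).one] at h1
      have : 0 ≤ (Fintype.card ι : ℝ) * q ^ (t + 1) := by positivity
      linarith
    · rw [min_eq_right h.le, pow_succ', Module.End.mul_apply]
      have h1 := (coupled_isMarkov hD.isProb).mono
        (f := (coupled p ^ t) (fun w => if w.1 = w.2 then 0 else 1))
        (g := fun w => (1 + Fintype.card ι * q ^ t) * min 1 (potential κ γ r W w) + 0)
        (fun w => by rw [add_zero, mul_comm]; exact ih w) z
      rw [(coupled_isMarkov hD.isProb).mul_add_const, add_zero] at h1
      have h2 := coupled_potential_le hD hp₀ hp₀' hC hr hR hγL hγ hG h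
      rw [← hq] at h2
      have h3 : 0 ≤ (Fintype.card ι : ℝ) * q ^ t := by positivity
      have h5 : 0 ≤ potential κ γ r W z :=
        potential_nonneg hr (fun i => (hG i).penalty_nonneg) hγ z
      calc _ ≤ (1 + Fintype.card ι * q ^ t) * (q * potential κ γ r W z) :=
            h1.trans (mul_le_mul_of_nonneg_left h2 (by linarith))
        _ = potential κ γ r W z * (q + Fintype.card ι * q ^ (t + 1)) := by ring
        _ ≤ potential κ γ r W z * (1 + Fintype.card ι * q ^ (t + 1)) :=
            mul_le_mul_of_nonneg_left (by linarith) h5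

/-- After a burn-in, the potential is bounded away from `1` on average; hence the oscillation
contracts. -/
theorem osc_contraction_of_groupControl [Nonempty ι] (hD : IsVotingDynamics κ p p₀ C)
    (hp₀ : 0 < p₀) (hp₀' : p₀ ≤ 1 / 2) (hC : 0 ≤ C) (hr : ∀ j, 0 < r j) (hR : 0 ≤ R)
    (hγL : 2 * γ = Real.exp (-(2 * L))) (hγ : γ ≤ 1 / 2)
    (hG : ∀ j, GroupControl κ p p₀ C γ L R j (r j) (W j)) {n t : ℕ} (hn : Fintype.card ι ≤ n)
    (ht : (n : ℝ) * Real.exp (-(Real.exp (-(2 * R)) * γ * p₀ / 2 * t / n)) ≤ γ / 4)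
    (f : (ι → Bool) → ℝ) (hf : OscLE f 1) :
    OscLE ((glauber p ^ (n + t)) f) (1 - γ / 4) := by
  have hN : (1 : ℝ) ≤ Fintype.card ι := by exact_mod_cast Fintype.card_pos
  have hnN : (Fintype.card ι : ℝ) ≤ n := by exact_mod_cast hn
  have hγ0 : 0 < γ := by have := Real.exp_pos (-(2 * L)); linarith
  have hW : ∀ i x, 0 ≤ W i x := fun i => (hG i).penalty_nonneg
  set c := Real.exp (-(2 * R)) * γ * p₀ / 2 with hc
  have hc0 : 0 < c := by positivity
  have hT := coupled_isMarkov hD.isProb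
  intro x y
  refine (glauber_pow_sub_le hD.isProb hf (n + t) x y).trans ?_
  have hsmall : (Fintype.card ι : ℝ) * (1 - c / Fintype.card ι) ^ t ≤ γ / 4 := by
    have hρ1 : Real.exp (-(2 * R)) ≤ 1 := Real.exp_le_one_iff.mpr (by linarith)
    have hc1 : c ≤ 1 := by
      have h1 : Real.exp (-(2 * R)) * (γ * p₀) ≤ 1 * (γ * p₀) :=
        mul_le_mul_of_nonneg_right hρ1 (by positivity)
      nlinarith
    have h0 : 0 ≤ 1 - c / Fintype.card ι := by
      rw [sub_nonneg, div_le_one (by linarith)]; linarith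
    have h1 : 1 - c / Fintype.card ι ≤ Real.exp (-(c / n)) := by
      have e1 := Real.add_one_le_exp (-(c / n))
      have e2 : c / n ≤ c / Fintype.card ι := div_le_div_of_nonneg_left hc0.le (by linarith) hnN
      linarith
    calc (Fintype.card ι : ℝ) * (1 - c / Fintype.card ι) ^ t ≤ n * Real.exp (-(c / n)) ^ t := by
          gcongr
      _ = n * Real.exp (-(c * t / n)) := by
          rw [← Real.exp_nat_mul]; congr 2; ring
      _ ≤ γ / 4 := ht
  rw [pow_add, Module.End.mul_apply]
  have h1 := (hT.pow n).mono (fun z => coupled_pow_ne_le hD hp₀ hp₀' hC hr hR hγL hγ hG t z)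
    (x, y)
  set F : (ι → Bool) × (ι → Bool) → ℝ := ((fun z => W true z.1) + fun z => W true z.2) +
    ((fun z => W false z.1) + fun z => W false z.2) with hF
  -- whether or not the query variable agrees, the potential is at most `1 - γ` plus the penalties
  have h2 : ∀ z : (ι → Bool) × (ι → Bool), min 1 (potential κ γ r W z) * (1 + Fintype.card ι *
      (1 - c / Fintype.card ι) ^ t) ≤ (1 + γ / 4) * F z + (1 + γ / 4) * (1 - γ) := by
    intro z
    have hFz : F z = ∑ j, (W j z.1 + W j z.2) := by rw [Fintype.sum_bool]; rfl
    have h3 : min 1 (potential κ γ r W z) ≤ 1 - γ + F z := by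
      refine (min_le_right _ _).trans ?_
      rw [hFz]
      by_cases hQ : AgreeQ κ z.1 z.2
      · rw [potential_of_agreeQ hQ]
        have e1 : 2 * γ ≤ merit κ r z :=
          hγL ▸ merit_ge (fun i => (hr i).le) (fun i => (hG i).rate_mul_size_le) z
        have e2 : ∑ j, livePenalty κ W j z ≤ ∑ j, (W j z.1 + W j z.2) :=
          Finset.sum_le_sum fun i _ => livePenalty_le (hW i) z
        linarith
      · rw [potential_of_not_agreeQ hQ]
    have h4 : 0 ≤ min 1 (potential κ γ r W z) :=
      le_min zero_le_one (potential_nonneg hr hW hγ z)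
    have h5 : min 1 (potential κ γ r W z) * (1 + Fintype.card ι *
        (1 - c / Fintype.card ι) ^ t) ≤ min 1 (potential κ γ r W z) * (1 + γ / 4) :=
      mul_le_mul_of_nonneg_left (by linarith) h4
    have h6 := mul_le_mul_of_nonneg_right h3 (by linarith : (0 : ℝ) ≤ 1 + γ / 4)
    linarith
  refine h1.trans (((hT.pow n).mono h2 (x, y)).trans ?_)
  have h7 : (coupled p ^ n) F (x, y) ≤ γ / 2 := by
    rw [hF, map_add, map_add, map_add, coupled_pow_fst, coupled_pow_snd, coupled_pow_fst,
      coupled_pow_snd]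
    simp only [Pi.add_apply]
    linarith [(hG true).burn_in n hn x, (hG true).burn_in n hn y, (hG false).burn_in n hn x,
      (hG false).burn_in n hn y]
  rw [(hT.pow n).mul_add_const]
  nlinarith

end Coalescence

/-! ### Small and large groups -/

section Groups

variable {ι : Type} [Fintype ι] [DecidableEq ι] {κ : ι → Option Bool}
  {p : (ι → Bool) → ι → ℝ} {p₀ C γ L R : ℝ}

theorem abs_prob_sub_le (hD : IsVotingDynamics κ p p₀ C) {v : ι} (hv : κ v ≠ none)
    (x y : ι → Bool) : |p x v - p y v| ≤ 1 - 2 * p₀ := by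
  rw [abs_sub_le_iff]
  have h1 := hD.le_prob x v hv
  have h2 := hD.prob_le x v hv
  have h3 := hD.le_prob y v hv
  have h4 := hD.prob_le y v hv
  constructor <;> linarith

theorem sum_group_ite_ne (j : Bool) (x y : ι → Bool) (a : ℝ) :
    ∑ v with κ v = some j, (if x v ≠ y v then a else 0) = a * dis κ j x y := by
  rw [← Finset.sum_filter, Finset.filter_filter, Finset.sum_const, nsmul_eq_mul, mul_comm, dis]

/-- In a group of bounded size no penalty is needed: a steep rate makes up for every possible
growth of the disagreements. -/
theorem groupControl_of_size_le [Nonempty ι] (hD : IsVotingDynamics κ p p₀ C) (hp₀ : 0 < p₀)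
    (hp₀' : p₀ ≤ 1 / 2) (hC : 0 ≤ C) (hγ : 0 < γ) {j : Bool} {S : ℕ} (hS : size κ j ≤ S)
    (hL : Real.log (3 + (S + C) / p₀) * S ≤ L) (hR : C * S ≤ R) :
    GroupControl κ p p₀ C γ L R j (Real.log (3 + (S + C) / p₀)) (fun _ => 0) := by
  have hN : (1 : ℝ) ≤ Fintype.card ι := by exact_mod_cast Fintype.card_pos
  have hSR : (size κ j : ℝ) ≤ S := by exact_mod_cast hS
  set M := 3 + (S + C) / p₀ with hM
  have hfrac : 0 ≤ (S + C) / p₀ := by positivity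
  have hM3 : 3 ≤ M := by linarith
  have hlog1 : 1 ≤ Real.log M := by
    rw [Real.le_log_iff_exp_le (by linarith)]
    have := Real.exp_one_lt_d9
    linarith
  have hlogM : Real.log M ≤ M - 1 := Real.log_le_sub_one_of_pos (by linarith)
  have hMp : S + C ≤ (M - 1) * p₀ := by
    have : (S + C) / p₀ * p₀ = S + C := div_mul_cancel₀ _ hp₀.ne'
    nlinarith
  have hfr : ∀ x y, (dis κ j x y : ℝ) / (1 + min (cnt κ j x : ℝ) (cnt κ j y)) ≤ dis κ j x y :=
    fun x y => div_le_self (Nat.cast_nonneg _) (by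
      have : (0 : ℝ) ≤ min (cnt κ j x : ℝ) (cnt κ j y) :=
        le_min (Nat.cast_nonneg _) (Nat.cast_nonneg _)
      linarith)
  refine ⟨?_, ?_, fun _ => le_rfl, fun _ _ _ _ => rfl, ⟨0, ?_, ?_, ?_⟩, ?_, ?_, ?_⟩
  · nlinarith
  · exact (mul_le_mul_of_nonneg_left hSR (by linarith)).trans hL
  · rw [mul_zero]; exact mul_nonneg (mul_nonneg hγ.le hp₀.le) (by linarith)
  · rw [mul_zero]; positivity
  · intro x; simp [siteUpdate]
  · intro x y _
    refine le_trans (mul_le_mul_of_nonneg_left ((hfr x y).trans ?_) hC) hR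
    exact le_trans (by exact_mod_cast dis_le_size j x y) hSR
  · intro x y _ hd _
    have hd1 : (1 : ℝ) ≤ dis κ j x y := by exact_mod_cast Nat.one_le_iff_ne_zero.mpr hd
    -- an agreeing site costs at most `1`, a disagreeing site gains a multiple of `M = exp r`
    have hterm : ∀ v, κ v = some j → (if x v ≠ y v then (M - 1) * (2 * p₀) else 0) - 1 ≤
        Real.exp (Real.log M * if x v ≠ y v then 1 else 0) *
          (1 - |p x v - p y v| + |p x v - p y v| * Real.exp (-Real.log M)) - 1 := by
      intro v hv
      have h1 := abs_prob_sub_le hD (v := v) (by rw [hv]; simp) x y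
      have h2 : 0 ≤ |p x v - p y v| := abs_nonneg _
      rw [Real.exp_neg, Real.exp_log (by linarith)]
      have h3 : 0 < M⁻¹ := inv_pos.mpr (by linarith)
      split_ifs
      · rw [mul_one, Real.exp_log (by linarith)]
        have h4 : M * M⁻¹ = 1 := mul_inv_cancel₀ (by linarith)
        have h5 : M * (1 - |p x v - p y v| + |p x v - p y v| * M⁻¹) =
            1 + (M - 1) * (1 - |p x v - p y v|) := by linear_combination |p x v - p y v| * h4
        rw [h5]
        have h6 : (M - 1) * (2 * p₀) ≤ (M - 1) * (1 - |p x v - p y v|) :=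
          mul_le_mul_of_nonneg_left (by linarith) (by linarith)
        linarith
      · rw [mul_zero, Real.exp_zero, one_mul]
        have h4 := mul_nonneg h2 h3.le
        linarith
    refine le_trans ?_ (Finset.sum_le_sum fun v hv => hterm v (Finset.mem_filter.mp hv).2)
    rw [Finset.sum_sub_distrib, sum_group_ite_ne, Finset.sum_const, nsmul_eq_mul, mul_one]
    have h7 : ((Finset.univ.filter fun v => κ v = some j).card : ℝ) ≤ S := hSR
    have h8 : C * ((dis κ j x y : ℝ) / (1 + min (cnt κ j x : ℝ) (cnt κ j y))) ≤
        C * dis κ j x y := mul_le_mul_of_nonneg_left (hfr x y) hC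
    have h9 : p₀ / 2 * (Real.log M * dis κ j x y) ≤ p₀ / 2 * ((M - 1) * dis κ j x y) := by
      gcongr
    have h10 := mul_le_mul_of_nonneg_right hMp (by linarith : (0 : ℝ) ≤ dis κ j x y)
    have h11 : (S : ℝ) * 1 ≤ S * dis κ j x y := mul_le_mul_of_nonneg_left hd1 (Nat.cast_nonneg _)
    have h12 : 0 ≤ C * (dis κ j x y : ℝ) := by positivity
    linarith
  · intro k _ x
    have h : (fun _ : ι → Bool => (0 : ℝ)) = 0 := rfl
    rw [h, map_zero]
    simp only [Pi.zero_apply]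
    positivity

/-- In a large group, the number of true sites is of the order of the group except with a
probability that the deficit controls; elsewhere the disagreements decrease on average. -/
theorem groupControl_of_le_size [Nonempty ι] (hD : IsVotingDynamics κ p p₀ C) (hp₀ : 0 < p₀)
    (hp₀' : p₀ ≤ 1 / 2) (hC : 1 ≤ C) {j : Bool} (hn : 0 < size κ j)
    (h1 : 2 * C / (p₀ / 32) ^ 2 ≤ size κ j)
    (h2 : 12 * (size κ j : ℝ) ^ 2 * Real.exp (-(p₀ / 32 * size κ j)) ≤ γ * p₀ * (128 * C / p₀))
    (h3 : 24 * size κ j * Real.exp (-(p₀ / 32 * size κ j)) ≤ Real.exp (-(2 * R)) * γ)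
    (h4 : (1 + 12 / p₀) * Real.exp (-(p₀ / 32 * size κ j)) ≤ γ / 8)
    (hL : 128 * C / p₀ ≤ L) (hR : C / (p₀ / 32) ≤ R) :
    GroupControl κ p p₀ C γ L R j (128 * C / p₀ / size κ j) (deficit κ (p₀ / 32) j) := by
  have hjp : ∀ x v, κ v = some j → p₀ ≤ p x v := fun x v hv => hD.le_prob x v (by rw [hv]; simp)
  have hnR : (0 : ℝ) < size κ j := by exact_mod_cast hn
  have hn1 : (1 : ℝ) ≤ size κ j := by exact_mod_cast hn
  have hnN : (size κ j : ℝ) ≤ Fintype.card ι := by exact_mod_cast size_le_card j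
  set n : ℝ := (size κ j : ℝ) with hndef
  set c := p₀ / 32 with hc
  have hc0 : 0 < c := by positivity
  have hK : 128 * C / p₀ = 4 * C / c := by rw [hc]; field_simp; norm_num
  have hV0 : ∀ x, 0 < deficit κ c j x := fun x => deficit_pos c j x
  have hcnt : ∀ x y, deficit κ c j x + deficit κ c j y < 1 →
      c * n ≤ min (cnt κ j x : ℝ) (cnt κ j y) := fun x y h =>
    le_min (lt_cnt_of_deficit_lt_one (by linarith [hV0 y])).le
      (lt_cnt_of_deficit_lt_one (by linarith [hV0 x])).le
  have hinf : ∀ x y, deficit κ c j x + deficit κ c j y < 1 →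
      C * ((dis κ j x y : ℝ) / (1 + min (cnt κ j x : ℝ) (cnt κ j y))) ≤
        C * (dis κ j x y / (c * n)) := fun x y h => by
    refine mul_le_mul_of_nonneg_left ?_ (by linarith)
    refine div_le_div_of_nonneg_left (Nat.cast_nonneg _) (by positivity) ?_
    linarith [hcnt x y h]
  refine ⟨?_, ?_, fun x => (hV0 x).le, fun v hv x b => deficit_update_of_ne hv c x b,
    ⟨3 * n * Real.exp (-(c * n)), ?_, ?_, ?_⟩, ?_, ?_, ?_⟩
  · rw [div_mul_eq_mul_div, le_div_iff₀ hnR]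
    have : 1 ≤ 128 * C / p₀ := by rw [le_div_iff₀ hp₀]; linarith
    nlinarith
  · rwa [div_mul_cancel₀ _ hnR.ne']
  · rw [← mul_div_assoc, le_div_iff₀ hnR]
    linarith
  · linarith
  · intro x
    have h5 := sum_siteUpdate_deficit_sub_le hp₀ hp₀' hD.isProb hjp x
    refine h5.trans ?_
    have h6 : p₀ / 4 * deficit κ c j x ≤ p₀ / 4 * n * deficit κ c j x := by
      refine mul_le_mul_of_nonneg_right ?_ (hV0 x).le
      nlinarith
    linarith
  · intro x y h
    refine (hinf x y h).trans (le_trans ?_ hR)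
    rw [div_eq_mul_inv C]
    refine mul_le_mul_of_nonneg_left ?_ (by linarith)
    have h5 : (dis κ j x y : ℝ) ≤ n := by
      rw [hndef]; exact_mod_cast dis_le_size j x y
    rw [div_le_iff₀ (by positivity)]
    have : c⁻¹ * (c * n) = n := by field_simp
    linarith
  · intro x y hQ hd h
    set r := 128 * C / p₀ / n with hr
    have hr0 : 0 < r := by positivity
    -- to first order in `r`, a disagreement gains `r`, and each site loses its discrepancy
    have hterm : ∀ v, κ v = some j → (if x v ≠ y v then r else 0) - r * |p x v - p y v| ≤
        Real.exp (r * if x v ≠ y v then 1 else 0) *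
          (1 - |p x v - p y v| + |p x v - p y v| * Real.exp (-r)) - 1 := by
      intro v hv
      have e1 := abs_prob_sub_le hD (v := v) (by rw [hv]; simp) x y
      have e2 : 0 ≤ |p x v - p y v| := abs_nonneg _
      split_ifs
      · rw [mul_one]
        have e3 := Real.add_one_le_exp r
        have e4 : Real.exp r * Real.exp (-r) = 1 := by rw [← Real.exp_add]; simp
        have e5 : Real.exp r * (1 - |p x v - p y v| + |p x v - p y v| * Real.exp (-r)) =
            Real.exp r * (1 - |p x v - p y v|) + |p x v - p y v| := by
          linear_combination |p x v - p y v| * e4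
        have e6 : (r + 1) * (1 - |p x v - p y v|) ≤ Real.exp r * (1 - |p x v - p y v|) :=
          mul_le_mul_of_nonneg_right e3 (by linarith)
        rw [e5]
        linarith
      · rw [mul_zero, Real.exp_zero, one_mul]
        have e3 := Real.add_one_le_exp (-r)
        have e4 := mul_le_mul_of_nonneg_left e3 e2
        linarith
    refine le_trans ?_ (Finset.sum_le_sum fun v hv => hterm v (Finset.mem_filter.mp hv).2)
    rw [Finset.sum_sub_distrib, sum_group_ite_ne, ← Finset.mul_sum]
    have hcn := hcnt x y h
    -- the total influence of the disagreements within the group is at most one half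
    have hone : ∀ v, κ v = some j → |p x v - p y v| ≤ dis κ j x y / (2 * n) := by
      intro v hv
      have e1 := hD.site_lipschitz x y v j hv hQ
      have e2 : (c * n) * (c * n) ≤ cnt κ j x * cnt κ j y :=
        mul_le_mul (hcn.trans (min_le_left _ _)) (hcn.trans (min_le_right _ _))
          (by positivity) (Nat.cast_nonneg _)
      have e3 := (mul_le_mul_of_nonneg_left e2 (abs_nonneg (p x v - p y v))).trans e1
      rw [div_le_iff₀ (by positivity)] at h1
      have e4 : 2 * C * |p x v - p y v| * n ≤ C * dis κ j x y := by
        have e5 := mul_le_mul_of_nonneg_right h1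
          (mul_nonneg (abs_nonneg (p x v - p y v)) hnR.le)
        nlinarith
      rw [le_div_iff₀ (by positivity)]
      nlinarith
    have hsum : ∑ v with κ v = some j, |p x v - p y v| ≤ dis κ j x y / 2 := by
      refine (Finset.sum_le_card_nsmul _ _ _ fun v hv =>
        hone v (Finset.mem_filter.mp hv).2).trans (le_of_eq ?_)
      rw [nsmul_eq_mul]
      have : ((Finset.univ.filter fun v => κ v = some j).card : ℝ) = n := rfl
      rw [this]
      field_simp
    have e1 := mul_le_mul_of_nonneg_left hsum hr0.le
    have e2 : C * (dis κ j x y / (c * n)) = r / 4 * dis κ j x y := by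
      rw [hr, hK]; field_simp
    have e3 := hinf x y h
    have e4 : 0 ≤ r * (dis κ j x y : ℝ) := by positivity
    have e5 := mul_le_mul_of_nonneg_right hp₀' e4
    linarith
  · intro k hk x
    exact (glauber_pow_deficit_le_of_card_le hp₀ hp₀' hD.isProb hjp hn hk x).trans h4

end Groups

/-! ### Rapid mixing -/

theorem eventually_sq_mul_exp_neg_le {b η : ℝ} (hb : 0 < b) (hη : 0 < η) :
    ∀ᶠ n : ℕ in atTop, (n : ℝ) ^ 2 * Real.exp (-(b * n)) ≤ η := by
  have h1 : Tendsto (fun n : ℕ => b * (n : ℝ)) atTop atTop :=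
    tendsto_natCast_atTop_atTop.const_mul_atTop hb
  have h2 := (Real.tendsto_pow_mul_exp_neg_atTop_nhds_zero 2).comp h1
  have hb2 : 0 < b ^ 2 * η := by positivity
  filter_upwards [h2.eventually (gt_mem_nhds hb2)] with n hn
  simp only [Function.comp_apply, mul_pow] at hn
  have hb3 : 0 < b ^ 2 := by positivity
  nlinarith

/-- Contraction for all dynamics in which no group has a size strictly between `S` and `l`. -/
theorem exists_osc_contraction_of_gap {p₀ C : ℝ} (hp₀ : 0 < p₀) (hp₀' : p₀ ≤ 1 / 2) (hC : 1 ≤ C)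
    (S : ℕ) : ∃ (l : ℕ) (c γ : ℝ), 0 < c ∧ 0 < γ ∧ γ ≤ 1 ∧
      ∀ (ι : Type) [Fintype ι] [DecidableEq ι] [Nonempty ι] (κ : ι → Option Bool)
        (p : (ι → Bool) → ι → ℝ), IsVotingDynamics κ p p₀ C →
        (∀ j, size κ j ≤ S ∨ l ≤ size κ j) →
        ∀ n t : ℕ, Fintype.card ι ≤ n → (n : ℝ) * Real.exp (-(c * t / n)) ≤ γ →
          ∀ f : (ι → Bool) → ℝ, OscLE f 1 → OscLE ((glauber p ^ (n + t)) f) (1 - γ) := by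
  set K := 128 * C / p₀ with hK
  set M := 3 + (S + C) / p₀ with hM
  have hfrac : 0 ≤ (S + C) / p₀ := by positivity
  have hlogM : 0 < Real.log M := Real.log_pos (by linarith)
  have hK0 : 0 < K := by positivity
  set L := K + Real.log M * S with hL
  set R := C / (p₀ / 32) + C * S with hR
  set γ := Real.exp (-(2 * L)) / 2 with hγdef
  have hLS : 0 ≤ Real.log M * S := mul_nonneg hlogM.le (Nat.cast_nonneg _)
  have hR0 : 0 ≤ R := by positivity
  have hRC : 0 ≤ C / (p₀ / 32) := by positivity
  have hCS : 0 ≤ C * S := by positivity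
  have hγ0 : 0 < γ := by positivity
  have hγ1 : γ ≤ 1 / 2 := by
    have : Real.exp (-(2 * L)) ≤ 1 := Real.exp_le_one_iff.mpr (by linarith)
    linarith
  have hη : 0 < min (γ * p₀ * K / 12) (min (Real.exp (-(2 * R)) * γ / 24)
      (γ / 8 / (1 + 12 / p₀))) := by
    refine lt_min ?_ (lt_min ?_ ?_) <;> positivity
  -- all requirements on the size of a large group hold from some `l` on, which depends on `S`
  obtain ⟨l, hl⟩ := eventually_atTop.mp
    ((eventually_sq_mul_exp_neg_le (by positivity : 0 < p₀ / 32) hη).and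
      ((eventually_gt_atTop 0).and (tendsto_natCast_atTop_atTop.eventually
        (eventually_ge_atTop (2 * C / (p₀ / 32) ^ 2)))))
  refine ⟨l, Real.exp (-(2 * R)) * γ * p₀ / 2, γ / 4, by positivity, by positivity,
    by linarith, ?_⟩
  intro ι _ _ _ κ p hD hS n t hn ht f hf
  have hG : ∀ j, ∃ (r : ℝ) (W : (ι → Bool) → ℝ), 0 < r ∧ GroupControl κ p p₀ C γ L R j r W := by
    intro j
    rcases hS j with h | h
    · exact ⟨_, _, hlogM, groupControl_of_size_le hD hp₀ hp₀' (by linarith) hγ0 h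
        (by linarith) (by linarith)⟩
    · obtain ⟨h1, h2, h3⟩ := hl _ h
      have hnR : (0 : ℝ) < size κ j := by exact_mod_cast h2
      have hn1 : (1 : ℝ) ≤ size κ j := by exact_mod_cast h2
      refine ⟨K / size κ j, deficit κ (p₀ / 32) j, by positivity,
        groupControl_of_le_size hD hp₀ hp₀' hC h2 h3 ?_ ?_ ?_ (by linarith) (by linarith)⟩
      · have := h1.trans (min_le_left _ _)
        rw [le_div_iff₀ (by norm_num)] at this
        linarith
      · have e1 := h1.trans ((min_le_right _ _).trans (min_le_left _ _))
        rw [le_div_iff₀ (by norm_num)] at e1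
        have e2 : (size κ j : ℝ) * Real.exp (-(p₀ / 32 * size κ j)) ≤
            (size κ j : ℝ) ^ 2 * Real.exp (-(p₀ / 32 * size κ j)) := by
          refine mul_le_mul_of_nonneg_right ?_ (Real.exp_pos _).le
          nlinarith
        linarith
      · have e1 := h1.trans ((min_le_right _ _).trans (min_le_right _ _))
        rw [le_div_iff₀ (by positivity)] at e1
        have e2 : 1 * Real.exp (-(p₀ / 32 * size κ j)) ≤
            (size κ j : ℝ) ^ 2 * Real.exp (-(p₀ / 32 * size κ j)) := by
          refine mul_le_mul_of_nonneg_right ?_ (Real.exp_pos _).le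
          nlinarith
        have e3 : (0 : ℝ) < 1 + 12 / p₀ := by positivity
        have e4 := mul_le_mul_of_nonneg_right e2 e3.le
        linarith
  choose r W hr hG using hG
  exact osc_contraction_of_groupControl hD hp₀ hp₀' (by linarith) hr hR0
    (by rw [hγdef]; ring) hγ1 hG hn ht f hf

/-- Contraction for all dynamics: the threshold for large groups may depend on the bound for small
groups, and three such choices cover all pairs of sizes. -/
theorem exists_osc_contraction {p₀ C : ℝ} (hp₀ : 0 < p₀) (hp₀' : p₀ ≤ 1 / 2) (hC : 1 ≤ C) :
    ∃ c γ : ℝ, 0 < c ∧ 0 < γ ∧ γ < 1 ∧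
      ∀ (ι : Type) [Fintype ι] [DecidableEq ι] [Nonempty ι] (κ : ι → Option Bool)
        (p : (ι → Bool) → ι → ℝ), IsVotingDynamics κ p p₀ C →
        ∀ n t : ℕ, Fintype.card ι ≤ n → (n : ℝ) * Real.exp (-(c * t / n)) ≤ γ →
          ∀ f : (ι → Bool) → ℝ, OscLE f 1 → OscLE ((glauber p ^ (n + t)) f) (1 - γ) := by
  obtain ⟨l₀, c₀, γ₀, hc₀, hγ₀, -, h₀⟩ := exists_osc_contraction_of_gap hp₀ hp₀' hC 0
  obtain ⟨l₁, c₁, γ₁, hc₁, hγ₁, -, h₁⟩ := exists_osc_contraction_of_gap hp₀ hp₀' hC l₀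
  obtain ⟨l₂, c₂, γ₂, hc₂, hγ₂, -, h₂⟩ := exists_osc_contraction_of_gap hp₀ hp₀' hC (max l₀ l₁)
  refine ⟨min c₀ (min c₁ c₂), min (min γ₀ (min γ₁ γ₂)) (1 / 2),
    lt_min hc₀ (lt_min hc₁ hc₂), lt_min (lt_min hγ₀ (lt_min hγ₁ hγ₂)) (by norm_num),
    (min_le_right _ _).trans_lt (by norm_num), ?_⟩
  intro ι _ _ _ κ p hD n t hn ht f hf
  set c := min c₀ (min c₁ c₂)
  set γ := min (min γ₀ (min γ₁ γ₂)) (1 / 2)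
  have key : ∀ c' γ', c ≤ c' → γ ≤ γ' →
      ((n : ℝ) * Real.exp (-(c' * t / n)) ≤ γ' → OscLE ((glauber p ^ (n + t)) f) (1 - γ')) →
      OscLE ((glauber p ^ (n + t)) f) (1 - γ) := by
    intro c' γ' hcc hγγ h x y
    refine (h ?_ x y).trans (by linarith)
    refine le_trans (le_trans ?_ ht) hγγ
    gcongr
  by_cases H₀ : ∀ j, size κ j ≤ 0 ∨ l₀ ≤ size κ j
  · exact key c₀ γ₀ (min_le_left _ _) ((min_le_left _ _).trans (min_le_left _ _))
      fun h => h₀ ι κ p hD H₀ n t hn h f hf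
  by_cases H₁ : ∀ j, size κ j ≤ l₀ ∨ l₁ ≤ size κ j
  · exact key c₁ γ₁ ((min_le_right _ _).trans (min_le_left _ _))
      ((min_le_left _ _).trans ((min_le_right _ _).trans (min_le_left _ _)))
      fun h => h₁ ι κ p hD H₁ n t hn h f hf
  -- one group has a size strictly between `0` and `l₀`, the other one between `l₀` and `l₁`
  · have H₂ : ∀ j, size κ j ≤ max l₀ l₁ ∨ l₂ ≤ size κ j := by
      push Not at H₀ H₁
      obtain ⟨i, hi⟩ := H₀
      obtain ⟨k, hk⟩ := H₁
      intro j
      have hik : i ≠ k := by rintro rfl; omega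
      left
      cases i <;> cases k <;> cases j <;> simp at hik <;> omega
    exact key c₂ γ₂ ((min_le_right _ _).trans (min_le_right _ _))
      ((min_le_left _ _).trans ((min_le_right _ _).trans (min_le_right _ _)))
      fun h => h₂ ι κ p hD H₂ n t hn h f hf

theorem VotingProgram.WeightsBoundedBy.mono {P : VotingProgram} {B B' : ℝ}
    (h : P.WeightsBoundedBy B) (hB : B ≤ B') : P.WeightsBoundedBy B' :=
  ⟨h.1.trans hB, h.2.1.trans hB, fun v => (h.2.2 v).trans hB⟩

theorem VotingProgram.one_le_numVars (P : VotingProgram) : 1 ≤ P.numVars := by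
  unfold VotingProgram.numVars; omega

/-- Gibbs sampling with logical or ratio semantics mixes in `O(n log n)` steps. -/
theorem exists_mixing_time_of_logical_or_ratio {s : Semantics}
    (hs : s = .logical ∨ s = .ratio) (B : ℝ) : ∃ τ : ℕ → ℝ,
      τ =O[atTop] (fun n : ℕ => (n : ℝ) * Real.log (n : ℝ)) ∧
      ∀ P : VotingProgram, P.WeightsBoundedBy B → ∀ (μ : PMF P.World) (ε : ℝ), 0 < ε →
        ∀ k : ℕ, τ P.numVars * Real.log (1 + 1 / ε) ≤ (k : ℝ) →
          tvDist (VotingProgram.law s μ k) (P.stationary s) ≤ ε := by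
  set B' := max B 1 with hB'
  have hB1 : 1 ≤ B' := le_max_right _ _
  have hp₀' : Real.sigmoid (-(2 * B')) ≤ 1 / 2 := by
    have := Real.sigmoid_le (by linarith : -(2 * B') ≤ 0)
    rw [Real.sigmoid_zero] at this
    linarith
  obtain ⟨c, γ, hc, hγ, hγ1, H⟩ := exists_osc_contraction (Real.sigmoid_pos (-(2 * B'))) hp₀'
    (by linarith : 1 ≤ 2 * B')
  -- this makes `n * exp (-(c * t n / n))` at most `γ`
  let t : ℕ → ℕ := fun n => ⌈(n : ℝ) / c * Real.log (n / γ)⌉₊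
  refine ⟨fun n => 3 * ((n + t n : ℕ) : ℝ) / γ, ?_, ?_⟩
  · refine IsBigO.of_bound (3 / γ * (2 + 1 / c * (1 + |Real.log γ|))) ?_
    filter_upwards [eventually_ge_atTop 3] with n hn
    have hn3 : (3 : ℝ) ≤ n := by exact_mod_cast hn
    have hlog : 1 ≤ Real.log n := by
      rw [Real.le_log_iff_exp_le (by linarith)]
      have := Real.exp_one_lt_d9
      linarith
    have ht : (t n : ℝ) ≤ (n : ℝ) / c * (Real.log n * (1 + |Real.log γ|)) + 1 := by
      have h0 : 0 ≤ (n : ℝ) / c * (Real.log n * (1 + |Real.log γ|)) := by positivity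
      have h1 : (n : ℝ) / c * Real.log (n / γ) ≤
          (n : ℝ) / c * (Real.log n * (1 + |Real.log γ|)) := by
        refine mul_le_mul_of_nonneg_left ?_ (by positivity)
        rw [Real.log_div (by linarith) hγ.ne']
        have h2 := neg_le_abs (Real.log γ)
        nlinarith [abs_nonneg (Real.log γ)]
      exact (Nat.ceil_mono h1 |> Nat.cast_le.mpr).trans (Nat.ceil_lt_add_one h0).le
    have hnl : (n : ℝ) ≤ n * Real.log n := by nlinarith
    rw [Real.norm_of_nonneg (by positivity), Real.norm_of_nonneg (by positivity)]
    push_cast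
    have h3 : (n : ℝ) + t n ≤ (2 + 1 / c * (1 + |Real.log γ|)) * (n * Real.log n) := by
      have h4 : (n : ℝ) / c * (Real.log n * (1 + |Real.log γ|)) =
        1 / c * (1 + |Real.log γ|) * (n * Real.log n) := by ring
      linarith
    calc 3 * ((n : ℝ) + t n) / γ = 3 / γ * (n + t n) := by ring
      _ ≤ 3 / γ * ((2 + 1 / c * (1 + |Real.log γ|)) * (n * Real.log n)) :=
          mul_le_mul_of_nonneg_left h3 (by positivity)
      _ = _ := by ring
  · intro P hP μ ε hε k hk
    have hn1 : (1 : ℝ) ≤ P.numVars := by exact_mod_cast P.one_le_numVars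
    refine VotingProgram.tvDist_law_le (m := P.numVars + t P.numVars) (δ := γ)
      (by have := P.one_le_numVars; omega) hγ hγ1 (fun hne f hf => ?_) μ hε hk
    refine H P.FreeVar VotingProgram.group _
      (VotingProgram.isVotingDynamics hs (hP.mono (le_max_left _ _))) _ _
      (VotingProgram.card_freeVar_le P) ?_ f hf
    have h1 : Real.log (P.numVars / γ) ≤ c * t P.numVars / P.numVars := by
      rw [le_div_iff₀ (by linarith)]
      have h2 : (P.numVars : ℝ) / c * Real.log (P.numVars / γ) ≤ t P.numVars := Nat.le_ceil _
      have h3 := mul_le_mul_of_nonneg_left h2 hc.le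
      have h4 : c * ((P.numVars : ℝ) / c * Real.log (P.numVars / γ)) =
        Real.log (P.numVars / γ) * P.numVars := by field_simp
      linarith
    have h5 : Real.exp (-(c * t P.numVars / P.numVars)) ≤ ((P.numVars : ℝ) / γ)⁻¹ := by
      rw [← Real.exp_log (by positivity : 0 < (P.numVars : ℝ) / γ), ← Real.exp_neg]
      exact Real.exp_le_exp.mpr (neg_le_neg h1)
    calc (P.numVars : ℝ) * Real.exp (-(c * t P.numVars / P.numVars))
        ≤ P.numVars * ((P.numVars : ℝ) / γ)⁻¹ := by gcongr
      _ = γ := by field_simp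

/-! ### A statistic that remembers the initial configuration -/

section Deviation

variable {ι : Type} [Fintype ι] [DecidableEq ι] {κ : ι → Option Bool}
  {p : (ι → Bool) → ι → ℝ} {p₀ A : ℝ} {s : ι → ℝ} {j : Bool}

variable (κ) in
/-- The number of true sites in the group `j`, centered by the probabilities `s`. -/
def deviation (s : ι → ℝ) (j : Bool) (x : ι → Bool) : ℝ :=
  ∑ v, if κ v = some j then (if x v then 1 else 0) - s v else 0

variable (κ) in
/-- The total difference between the actual conditional probabilities and the probabilities `s`. -/
def bias (p : (ι → Bool) → ι → ℝ) (s : ι → ℝ) (j : Bool) (x : ι → Bool) : ℝ :=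
  ∑ v, if κ v = some j then p x v - s v else 0

theorem deviation_update_of_ne {v : ι} (h : κ v ≠ some j) (x : ι → Bool) (b : Bool) :
    deviation κ s j (Function.update x v b) = deviation κ s j x := by
  have := sum_update_add (fun w b => if κ w = some j then (if b = true then (1 : ℝ) else 0) - s w
    else 0) x v b
  simp only [h, if_false, add_zero] at this
  exact this

theorem deviation_update {v : ι} (h : κ v = some j) (x : ι → Bool) (b : Bool) :
    deviation κ s j (Function.update x v b) =
      deviation κ s j x - (if x v then 1 else 0) + if b then 1 else 0 := by
  have := sum_update_add (fun w b => if κ w = some j then (if b = true then (1 : ℝ) else 0) - s w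
    else 0) x v b
  simp only [h, if_true] at this
  unfold deviation
  linarith

/-- The second moment of the deviation around a mean that decays by `1 - 1 / N` in each step
satisfies an affine recursion. -/
theorem glauber_sq_deviation_sub_le [Nonempty ι] (hp : IsProb p) (m : ℝ) (x : ι → Bool) :
    glauber p (fun y => (deviation κ s j y - (1 - 1 / Fintype.card ι) * m) ^ 2) x ≤
      (1 - 1 / Fintype.card ι) * (deviation κ s j x - m) ^ 2 +
        (bias κ p s j x ^ 2 / Fintype.card ι + 1) := by
  have hN : (1 : ℝ) ≤ Fintype.card ι := by exact_mod_cast Fintype.card_pos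
  set N : ℝ := (Fintype.card ι : ℝ) with hNdef
  set d := deviation κ s j x with hd
  set u := d - (1 - 1 / N) * m with hu
  -- each update changes the deviation by at most `1`
  have hstep : ∀ v, siteUpdate p v (fun y => (deviation κ s j y - (1 - 1 / N) * m) ^ 2) x -
      u ^ 2 ≤ 2 * u * ((if κ v = some j then p x v - s v else 0) -
        if κ v = some j then (if x v then 1 else 0) - s v else 0) + 1 := by
    intro v
    by_cases h : κ v = some j
    · simp only [siteUpdate, deviation_update h, h, if_true, Bool.false_eq_true, if_false]
      obtain ⟨h0, h1⟩ := hp x v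
      rw [← hd]
      split_ifs <;> nlinarith
    · simp only [siteUpdate, deviation_update_of_ne h, h, if_false]
      rw [← hd]
      linarith
  have hsum : ∑ v, (siteUpdate p v (fun y => (deviation κ s j y - (1 - 1 / N) * m) ^ 2) x -
      u ^ 2) ≤ 2 * u * (bias κ p s j x - d) + N := by
    refine (Finset.sum_le_sum fun v _ => hstep v).trans (le_of_eq ?_)
    rw [Finset.sum_add_distrib, ← Finset.mul_sum, Finset.sum_sub_distrib, Finset.sum_const,
      Finset.card_univ, nsmul_eq_mul, mul_one]
    rfl
  refine (glauber_apply_le hsum).trans ?_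
  rw [← hNdef]
  set e := bias κ p s j x
  set w := d - m with hw
  have h1 : u ^ 2 + (2 * u * (e - d) + N) / N =
      (w + (e - w) / N) ^ 2 - ((m - (e - w)) / N) ^ 2 + 1 := by
    rw [hu, hw]
    field_simp
    ring
  have h2 : (w + (e - w) / N) ^ 2 + (1 / N) * (1 - 1 / N) * (w - e) ^ 2 =
      (1 - 1 / N) * w ^ 2 + e ^ 2 / N := by
    field_simp
    ring
  have h3 : 0 ≤ (1 / N) * (1 - 1 / N) * (w - e) ^ 2 := by
    have : 1 / N ≤ 1 := by rw [div_le_one (by linarith)]; exact hN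
    have h4 : 0 ≤ 1 - 1 / N := by linarith
    positivity
  rw [h1]
  nlinarith [sq_nonneg ((m - (e - w)) / N)]

/-- If many sites of the group are true, each conditional probability is within a constant over the
size of the group from `s`, and the bias is bounded; otherwise the deficit is at least `1` and makes
up for the trivial bound. -/
theorem sq_bias_le (hp₀ : 0 < p₀) (hp : IsProb p) (hs : ∀ v, 0 ≤ s v ∧ s v ≤ 1)
    (hn : 0 < size κ j)
    (h : ∀ x v, κ v = some j → |p x v - s v| * cnt κ j x ≤ A) (x : ι → Bool) :
    bias κ p s j x ^ 2 ≤ (size κ j : ℝ) ^ 2 * deficit κ (p₀ / 32) j x +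
      (A / (p₀ / 32)) ^ 2 := by
  have hnR : (0 : ℝ) < size κ j := by exact_mod_cast hn
  have hbound : ∀ q : ℝ, (∀ v, κ v = some j → |p x v - s v| ≤ q) →
      |bias κ p s j x| ≤ size κ j * q := by
    intro q hq
    rw [bias, ← Finset.sum_filter]
    refine (Finset.abs_sum_le_sum_abs _ _).trans ?_
    refine (Finset.sum_le_card_nsmul _ _ q fun v hv => hq v (Finset.mem_filter.mp hv).2).trans
      (le_of_eq ?_)
    rw [nsmul_eq_mul]
    rfl
  have hV := deficit_pos (κ := κ) (p₀ / 32) j x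
  rcases lt_or_ge (deficit κ (p₀ / 32) j x) 1 with h1 | h1
  · have hc := lt_cnt_of_deficit_lt_one h1
    have h2 := hbound (A / (p₀ / 32 * size κ j)) fun v hv => by
      rw [le_div_iff₀ (by positivity)]
      exact (mul_le_mul_of_nonneg_left hc.le (abs_nonneg _)).trans (h x v hv)
    have h3 : (size κ j : ℝ) * (A / (p₀ / 32 * size κ j)) = A / (p₀ / 32) := by field_simp
    rw [h3] at h2
    have h4 : bias κ p s j x ^ 2 ≤ (A / (p₀ / 32)) ^ 2 := by
      rw [← sq_abs]
      exact pow_le_pow_left₀ (abs_nonneg _) h2 2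
    have : 0 ≤ (size κ j : ℝ) ^ 2 * deficit κ (p₀ / 32) j x := by positivity
    linarith
  · have h2 := hbound 1 fun v _ => by
      rw [abs_sub_le_iff]
      have e1 := hp x v
      have e2 := hs v
      constructor <;> linarith
    rw [mul_one] at h2
    have h3 : bias κ p s j x ^ 2 ≤ (size κ j : ℝ) ^ 2 := by
      rw [← sq_abs]
      exact pow_le_pow_left₀ (abs_nonneg _) h2 2
    have h4 : (size κ j : ℝ) ^ 2 * 1 ≤ (size κ j : ℝ) ^ 2 * deficit κ (p₀ / 32) j x :=
      mul_le_mul_of_nonneg_left h1 (by positivity)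
    have := sq_nonneg (A / (p₀ / 32))
    linarith

/-- The starting point of the lower bound: all sites are true. -/
def allTrue (ι : Type) : ι → Bool := fun _ => true

theorem cnt_allTrue : cnt κ j (allTrue ι) = size κ j := by
  simp [cnt, size, allTrue]

/-- Data for the lower bound on the mixing time: in the group `j`, the conditional probabilities
are close to the fixed probabilities `s` when many sites of the group are true, and the group is
large. -/
structure IsNearlyProduct (κ : ι → Option Bool) (p : (ι → Bool) → ι → ℝ) (p₀ A : ℝ) (s : ι → ℝ)
    (j : Bool) : Prop where
  isProb : IsProb p
  le_prob : ∀ x v, κ v = some j → p₀ ≤ p x v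
  prob_mem : ∀ v, 0 ≤ s v ∧ s v ≤ 1 - p₀
  near : ∀ x v, κ v = some j → |p x v - s v| * cnt κ j x ≤ A
  size_pos : 0 < size κ j
  large : (size κ j : ℝ) ^ 2 * Real.exp (-(p₀ / 32 * size κ j)) ≤ 1

namespace IsNearlyProduct

variable [Nonempty ι]

/-- From the all-true configuration the bias stays bounded in mean square. -/
theorem glauber_pow_sq_bias_le (h : IsNearlyProduct κ p p₀ A s j) (hp₀ : 0 < p₀)
    (hp₀' : p₀ ≤ 1 / 2) (k : ℕ) :
    (glauber p ^ k) (fun y => bias κ p s j y ^ 2) (allTrue ι) ≤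
      (A / (p₀ / 32)) ^ 2 + (1 + 12 / p₀) := by
  have hN : (0 : ℝ) < Fintype.card ι := by exact_mod_cast Fintype.card_pos
  have hnR : (0 : ℝ) < size κ j := by exact_mod_cast h.size_pos
  have hnN : (size κ j : ℝ) ≤ Fintype.card ι := by exact_mod_cast size_le_card j
  have h1 := ((glauber_isMarkov h.isProb).pow k).mono (sq_bias_le (κ := κ) (j := j) hp₀ h.isProb
    (fun v => ⟨(h.prob_mem v).1, by linarith [(h.prob_mem v).2]⟩) h.size_pos h.near)
    (allTrue ι)
  rw [((glauber_isMarkov h.isProb).pow k).mul_add_const] at h1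
  have h2 := glauber_pow_deficit_le hp₀ hp₀' h.isProb h.le_prob h.size_pos k (allTrue ι)
  have h3 : deficit κ (p₀ / 32) j (allTrue ι) ≤ Real.exp (-(p₀ / 32 * size κ j)) := by
    rw [deficit, cnt_allTrue]
    apply Real.exp_le_exp.mpr
    nlinarith
  have h4 : (1 - p₀ / 4 * size κ j / Fintype.card ι) ^ k ≤ 1 := by
    have e1 : p₀ / 4 * size κ j / Fintype.card ι ≤ 1 := by rw [div_le_one hN]; nlinarith
    have e2 : 0 ≤ p₀ / 4 * size κ j / Fintype.card ι := by positivity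
    exact pow_le_one₀ (by linarith) (by linarith)
  have h5 : (glauber p ^ k) (deficit κ (p₀ / 32) j) (allTrue ι) ≤
      (1 + 12 / p₀) * Real.exp (-(p₀ / 32 * size κ j)) := by
    have e3 := mul_le_mul_of_nonneg_right h4 (deficit_pos (κ := κ) (p₀ / 32) j (allTrue ι)).le
    linarith
  have h6 := mul_le_mul_of_nonneg_left h5 (sq_nonneg (size κ j : ℝ))
  have h7 := mul_le_mul_of_nonneg_left h.large (by positivity : 0 ≤ 1 + 12 / p₀)
  have h8 : (glauber p ^ k) (deficit κ (p₀ / 32) j) (allTrue ι) =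
    (glauber p ^ k) (fun y => deficit κ (p₀ / 32) j y) (allTrue ι) := rfl
  linarith

/-- The bias is bounded in mean square under a stationary distribution. -/
theorem expect_sq_bias_le (h : IsNearlyProduct κ p p₀ A s j) (hp₀ : 0 < p₀)
    (hp₀' : p₀ ≤ 1 / 2) {π : PMF (ι → Bool)}
    (hπ : ∀ (k : ℕ) (f : (ι → Bool) → ℝ), expect π ((glauber p ^ k) f) = expect π f) :
    expect π (fun y => bias κ p s j y ^ 2) ≤ (A / (p₀ / 32)) ^ 2 + (1 + 12 / p₀) := by
  have h1 := expect_mono π (sq_bias_le (κ := κ) (j := j) hp₀ h.isProb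
    (fun v => ⟨(h.prob_mem v).1, by linarith [(h.prob_mem v).2]⟩) h.size_pos h.near)
  rw [expect_mul_add_const] at h1
  have h5 : expect π (fun y => deficit κ (p₀ / 32) j y) ≤
      (1 + 12 / p₀) * Real.exp (-(p₀ / 32 * size κ j)) := by
    rw [← hπ (Fintype.card ι), ← expect_const π ((1 + 12 / p₀) * _)]
    exact expect_mono π fun y =>
      glauber_pow_deficit_le_of_card_le hp₀ hp₀' h.isProb h.le_prob h.size_pos le_rfl y
  have h6 := mul_le_mul_of_nonneg_left h5 (sq_nonneg (size κ j : ℝ))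
  have h7 := mul_le_mul_of_nonneg_left h.large (by positivity : 0 ≤ 1 + 12 / p₀)
  linarith

/-- From the all-true configuration the deviation stays within the order of the square root of the
number of sites around a mean that decays by `1 - 1 / N` in each step. -/
theorem glauber_pow_sq_deviation_sub_le (h : IsNearlyProduct κ p p₀ A s j) (hp₀ : 0 < p₀)
    (hp₀' : p₀ ≤ 1 / 2) (k : ℕ) :
    (glauber p ^ k) (fun y => (deviation κ s j y -
      (1 - 1 / Fintype.card ι) ^ k * deviation κ s j (allTrue ι)) ^ 2) (allTrue ι) ≤
      (A / (p₀ / 32)) ^ 2 + (1 + 12 / p₀) + Fintype.card ι := by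
  have hN : (1 : ℝ) ≤ Fintype.card ι := by exact_mod_cast Fintype.card_pos
  have hT := glauber_isMarkov h.isProb
  have hq : (0 : ℝ) ≤ 1 - 1 / Fintype.card ι := by
    rw [sub_nonneg, div_le_one (by linarith)]; exact hN
  set D := (A / (p₀ / 32)) ^ 2 + (1 + 12 / p₀) with hD
  have hD0 : 0 ≤ D := by positivity
  induction k with
  | zero => simp; positivity
  | succ k ih =>
    rw [pow_succ (glauber p), Module.End.mul_apply]
    have h1 := (hT.pow k).mono (fun x => glauber_sq_deviation_sub_le (κ := κ) (s := s) (j := j)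
      h.isProb ((1 - 1 / Fintype.card ι) ^ k * deviation κ s j (allTrue ι)) x) (allTrue ι)
    have e : (fun x => (1 - 1 / (Fintype.card ι : ℝ)) * (deviation κ s j x -
        (1 - 1 / Fintype.card ι) ^ k * deviation κ s j (allTrue ι)) ^ 2 +
        (bias κ p s j x ^ 2 / Fintype.card ι + 1)) =
        (1 - 1 / (Fintype.card ι : ℝ)) • (fun x => (deviation κ s j x -
        (1 - 1 / Fintype.card ι) ^ k * deviation κ s j (allTrue ι)) ^ 2) +
        fun x => ((Fintype.card ι : ℝ)⁻¹ * bias κ p s j x ^ 2 + 1) := by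
      ext x
      simp only [Pi.add_apply, Pi.smul_apply, smul_eq_mul]
      ring
    rw [e, map_add, map_smul, Pi.add_apply, Pi.smul_apply, smul_eq_mul,
      (hT.pow k).mul_add_const, ← mul_assoc, ← pow_succ'] at h1
    have h2 := h.glauber_pow_sq_bias_le hp₀ hp₀' k
    rw [← hD] at h2
    have h3 := mul_le_mul_of_nonneg_left ih hq
    have h4 := mul_le_mul_of_nonneg_left h2 (by positivity : (0 : ℝ) ≤ (Fintype.card ι : ℝ)⁻¹)
    refine h1.trans ((add_le_add h3 (add_le_add h4 le_rfl)).trans (le_of_eq ?_))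
    field_simp
    ring

/-- Under a stationary distribution the deviation is of the order of the square root of the number
of sites. -/
theorem expect_sq_deviation_le (h : IsNearlyProduct κ p p₀ A s j) (hp₀ : 0 < p₀)
    (hp₀' : p₀ ≤ 1 / 2) {π : PMF (ι → Bool)}
    (hπ : ∀ (k : ℕ) (f : (ι → Bool) → ℝ), expect π ((glauber p ^ k) f) = expect π f) :
    expect π (fun y => deviation κ s j y ^ 2) ≤
      (A / (p₀ / 32)) ^ 2 + (1 + 12 / p₀) + Fintype.card ι := by
  have hN : (1 : ℝ) ≤ Fintype.card ι := by exact_mod_cast Fintype.card_pos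
  have h1 := expect_mono π (fun x => glauber_sq_deviation_sub_le (κ := κ) (s := s) (j := j)
    h.isProb 0 x)
  simp only [mul_zero, sub_zero] at h1
  have h2 := hπ 1 (fun y => deviation κ s j y ^ 2)
  rw [pow_one] at h2
  have e : (fun x => bias κ p s j x ^ 2 / (Fintype.card ι : ℝ) + 1) =
      fun x => (Fintype.card ι : ℝ)⁻¹ * bias κ p s j x ^ 2 + 1 := by
    ext x; ring
  have e' : expect π (fun x => (1 - 1 / (Fintype.card ι : ℝ)) * deviation κ s j x ^ 2) =
      (1 - 1 / (Fintype.card ι : ℝ)) * expect π (fun x => deviation κ s j x ^ 2) := by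
    have := expect_mul_add_const π (1 - 1 / (Fintype.card ι : ℝ)) 0
      (fun x => deviation κ s j x ^ 2)
    simpa only [add_zero] using this
  rw [expect_add, e, expect_mul_add_const, e'] at h1
  have h3 := h.expect_sq_bias_le hp₀ hp₀' hπ
  have h4 := h2.symm.le.trans h1
  set X := expect π fun y => deviation κ s j y ^ 2
  have h5 : (1 / (Fintype.card ι : ℝ)) * X ≤
      (Fintype.card ι : ℝ)⁻¹ * expect π (fun x => bias κ p s j x ^ 2) + 1 := by linarith
  have h6 := mul_le_mul_of_nonneg_left h5 (by linarith : (0 : ℝ) ≤ Fintype.card ι)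
  have h7 : (Fintype.card ι : ℝ) * (1 / (Fintype.card ι : ℝ) * X) = X := by field_simp
  have h8 : (Fintype.card ι : ℝ) * ((Fintype.card ι : ℝ)⁻¹ *
      expect π (fun x => bias κ p s j x ^ 2) + 1) =
      expect π (fun x => bias κ p s j x ^ 2) + Fintype.card ι := by field_simp
  linarith

end IsNearlyProduct

end Deviation

/-- Chebyshev's inequality for a statistic that distinguishes two distributions. -/
theorem le_tvDist_of_second_moments {Ω : Type} [Fintype Ω] {μ ν : PMF Ω} {D : Ω → ℝ} {m V : ℝ}
    (hm : 0 < m) (hμ : expect μ (fun x => (D x - m) ^ 2) ≤ V)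
    (hν : expect ν (fun x => D x ^ 2) ≤ V) : 1 - 8 * V / m ^ 2 ≤ tvDist μ ν := by
  have hm2 : 0 < m ^ 2 := by positivity
  set E : Set Ω := {x | m / 2 ≤ D x} with hE
  have h1 : 1 - 4 * V / m ^ 2 ≤ expect μ (E.indicator 1) := by
    have e1 : expect μ (fun x => (-(4 / m ^ 2)) * (D x - m) ^ 2 + 1) ≤
        expect μ (E.indicator 1) := expect_mono μ fun x => by
      by_cases hx : x ∈ E
      · rw [Set.indicator_of_mem hx, Pi.one_apply]
        have : 0 ≤ 4 / m ^ 2 * (D x - m) ^ 2 := by positivity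
        linarith
      · rw [Set.indicator_of_notMem hx]
        have hx' : D x < m / 2 := not_le.mp hx
        have e2 : m ^ 2 / 4 ≤ (D x - m) ^ 2 := by nlinarith
        have e3 : 4 / m ^ 2 * (m ^ 2 / 4) ≤ 4 / m ^ 2 * (D x - m) ^ 2 :=
          mul_le_mul_of_nonneg_left e2 (by positivity)
        have e4 : 4 / m ^ 2 * (m ^ 2 / 4) = 1 := by field_simp
        linarith
    rw [expect_mul_add_const] at e1
    have e5 := mul_le_mul_of_nonneg_left hμ (by positivity : 0 ≤ 4 / m ^ 2)
    have e6 : 4 * V / m ^ 2 = 4 / m ^ 2 * V := by ring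
    linarith
  have h2 : expect ν (E.indicator 1) ≤ 4 * V / m ^ 2 := by
    have e1 : expect ν (E.indicator 1) ≤ expect ν (fun x => 4 / m ^ 2 * D x ^ 2 + 0) :=
      expect_mono ν fun x => by
        by_cases hx : x ∈ E
        · rw [Set.indicator_of_mem hx, Pi.one_apply, add_zero]
          have hx' : m / 2 ≤ D x := hx
          have e2 : m ^ 2 / 4 ≤ D x ^ 2 := by nlinarith
          have e3 : 4 / m ^ 2 * (m ^ 2 / 4) ≤ 4 / m ^ 2 * D x ^ 2 :=
            mul_le_mul_of_nonneg_left e2 (by positivity)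
          have e4 : 4 / m ^ 2 * (m ^ 2 / 4) = 1 := by field_simp
          linarith
        · rw [Set.indicator_of_notMem hx, add_zero]
          positivity
    rw [expect_mul_add_const, add_zero] at e1
    have e5 := mul_le_mul_of_nonneg_left hν (by positivity : 0 ≤ 4 / m ^ 2)
    have e6 : 4 * V / m ^ 2 = 4 / m ^ 2 * V := by ring
    linarith
  have h3 := expect_sub_le_tvDist μ ν E
  have h4 : 8 * V / m ^ 2 = 4 * V / m ^ 2 + 4 * V / m ^ 2 := by ring
  linarith

theorem exp_neg_two_mul_le {x : ℝ} (h0 : 0 ≤ x) (h : x ≤ 1 / 2) : Real.exp (-(2 * x)) ≤ 1 - x := by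
  have h1 := Real.add_one_le_exp (2 * x)
  rw [Real.exp_neg, inv_le_comm₀ (Real.exp_pos _) (by linarith)]
  refine le_trans ?_ h1
  rw [inv_le_iff_one_le_mul₀ (by linarith)]
  nlinarith

namespace VotingProgram

variable {P : VotingProgram}

/-- With logical or ratio semantics, the rules change the log-odds of a variable by at most a
constant over the number of true variables of its group. What remains is its own weight. -/
theorem isNearlyProduct {s : Semantics} (hs : s = .logical ∨ s = .ratio) {B : ℝ}
    (hB : P.WeightsBoundedBy B) {j : Bool} (hn : 0 < size (group (P := P)) j)
    (hlarge : (size (group (P := P)) j : ℝ) ^ 2 *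
      Real.exp (-(Real.sigmoid (-(2 * B)) / 32 * size (group (P := P)) j)) ≤ 1) :
    IsNearlyProduct (group (P := P)) (prob s) (Real.sigmoid (-(2 * B))) B
      (fun v => Real.sigmoid (P.unary v.1)) j where
  isProb := prob_isProb s
  le_prob x v hv := sigmoid_le_prob s x (by rw [hv]; simp) hB
  prob_mem v := by
    refine ⟨Real.sigmoid_nonneg _, ?_⟩
    rw [Real.sigmoid_neg, sub_sub_cancel]
    have h1 := (abs_le.mp (hB.2.2 v.1)).2
    have h2 : 0 ≤ B := (abs_nonneg _).trans hB.1
    exact Real.sigmoid_le (by linarith)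
  near x v hv := by
    have hB0 : 0 ≤ B := (abs_nonneg _).trans hB.1
    set m := P.evidenceCount j + cnt group j (Function.update x v false) with hm
    have h1 : |prob s x v - Real.sigmoid (P.unary v.1)| ≤ B * (1 / (1 + (m : ℝ))) := by
      refine (abs_sigmoid_sub_le _ _).trans ?_
      rw [logit_of_group s x hv, add_sub_cancel_left, abs_mul, abs_mul, abs_sign, mul_one,
        abs_of_nonneg (s.g_increment_mem _).1]
      exact mul_le_mul (abs_ruleWeight_le hB j) (Semantics.g_increment_le hs _)
        (s.g_increment_mem _).1 hB0
    have h2 : (cnt group j x : ℝ) ≤ 1 + m := by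
      have := cnt_update hv x false
      have h' : cnt group j x ≤ 1 + m := by split_ifs at this <;> omega
      exact_mod_cast h'
    calc _ ≤ B * (1 / (1 + (m : ℝ))) * (1 + m) :=
          mul_le_mul h1 h2 (Nat.cast_nonneg _) (by positivity)
      _ = B := by field_simp
  size_pos := hn
  large := hlarge

theorem card_freeVar_of_evidenceFree (h : P.EvidenceFree) :
    Fintype.card P.FreeVar = P.numVars := by
  rw [← card_var]
  exact Fintype.card_congr (Equiv.subtypeUnivEquiv h)

theorem card_freeVar_le_size_add : Fintype.card P.FreeVar ≤
    1 + (size (group (P := P)) true + size (group (P := P)) false) := by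
  have h1 : (Finset.univ.filter fun v : P.FreeVar => group v = none).card ≤ 1 :=
    Finset.card_le_one.mpr fun v hv w hw =>
      Subtype.ext (((group_eq_none_iff v).mp (Finset.mem_filter.mp hv).2).trans
        ((group_eq_none_iff w).mp (Finset.mem_filter.mp hw).2).symm)
  have h2 : (Finset.univ : Finset P.FreeVar) ⊆ (Finset.univ.filter fun v => group v = none) ∪
      ((Finset.univ.filter fun v => group v = some true) ∪
        Finset.univ.filter fun v => group v = some false) := by
    intro v _
    simp only [Finset.mem_union, Finset.mem_filter, Finset.mem_univ, true_and]
    rcases group v with _ | (_ | _) <;> simp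
  have h3 := (Finset.card_le_card h2).trans (Finset.card_union_le _ _)
  have h4 := Finset.card_union_le (Finset.univ.filter fun v : P.FreeVar => group v = some true)
    (Finset.univ.filter fun v => group v = some false)
  rw [Finset.card_univ] at h3
  unfold size
  omega

end VotingProgram

/-- Gibbs sampling with logical or ratio semantics needs `Ω(n log n)` steps. -/
theorem exists_lower_bound_of_logical_or_ratio {s : Semantics}
    (hs : s = .logical ∨ s = .ratio) (B : ℝ) : ∃ c : ℝ, 0 < c ∧
      ∀ ε : ℝ, 0 < ε → ε < 1 → ∀ᶠ n : ℕ in atTop,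
        ∀ P : VotingProgram, P.numVars = n → P.WeightsBoundedBy B → P.EvidenceFree →
          ∃ x : P.World, ∀ k : ℕ, (k : ℝ) < c * ((n : ℝ) * Real.log (n : ℝ)) →
            ε < tvDist (VotingProgram.law s (PMF.pure x) k) (P.stationary s) := by
  refine ⟨1 / 8, by norm_num, fun ε hε hε1 => ?_⟩
  set p₀ := Real.sigmoid (-(2 * max B 0)) with hp₀def
  have hp₀ : 0 < p₀ := Real.sigmoid_pos _
  have hp₀' : p₀ ≤ 1 / 2 := by
    have := Real.sigmoid_le (by linarith [le_max_right B 0] : -(2 * max B 0) ≤ 0)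
    rw [Real.sigmoid_zero] at this
    linarith
  set D := (max B 0 / (p₀ / 32)) ^ 2 + (1 + 12 / p₀) with hD
  obtain ⟨l, hl⟩ := eventually_atTop.mp ((eventually_sq_mul_exp_neg_le
    (by positivity : 0 < p₀ / 32) one_pos).and (eventually_gt_atTop 0))
  have hq : ∀ᶠ n : ℕ in atTop, 144 / p₀ ^ 2 * Real.exp (-(Real.log n / 2)) < 1 - ε := by
    have h1 : Tendsto (fun n : ℕ => Real.log (n : ℝ) / 2) atTop atTop :=
      (Real.tendsto_log_atTop.comp tendsto_natCast_atTop_atTop).atTop_div_const (by norm_num)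
    have h2 := (Real.tendsto_exp_neg_atTop_nhds_zero.comp h1).const_mul (144 / p₀ ^ 2)
    rw [mul_zero] at h2
    exact h2.eventually (gt_mem_nhds (by linarith))
  filter_upwards [eventually_ge_atTop 3, eventually_ge_atTop (2 * l + 1), hq,
    tendsto_natCast_atTop_atTop.eventually (eventually_ge_atTop D)] with n hn3 hnl hqn hnD
  intro P hPn hPB hPE
  have hB0 : P.WeightsBoundedBy (max B 0) := hPB.mono (le_max_left _ _)
  have hcard : Fintype.card P.FreeVar = n := (VotingProgram.card_freeVar_of_evidenceFree hPE).trans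
    hPn
  have hne : Nonempty P.FreeVar := ⟨⟨.query, hPE _⟩⟩
  -- the larger of the two groups
  obtain ⟨j, hj⟩ : ∃ j, n ≤ 1 + 2 * size (VotingProgram.group (P := P)) j := by
    have h := VotingProgram.card_freeVar_le_size_add (P := P)
    rw [hcard] at h
    by_cases h1 : n ≤ 1 + 2 * size (VotingProgram.group (P := P)) true
    · exact ⟨true, h1⟩
    · exact ⟨false, by omega⟩
  obtain ⟨hl1, hl2⟩ := hl (size (VotingProgram.group (P := P)) j) (by omega)
  have hNP := VotingProgram.isNearlyProduct hs hB0 hl2 hl1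
  refine ⟨allTrue _, fun k hk => ?_⟩
  have hn3R : (3 : ℝ) ≤ n := by exact_mod_cast hn3
  set m := (1 - 1 / (Fintype.card P.FreeVar : ℝ)) ^ k * deviation VotingProgram.group
    (fun v : P.FreeVar => Real.sigmoid (P.unary v.1)) j (allTrue _) with hm
  set q := Real.exp (-(Real.log n / 2)) with hqdef
  have hq0 : 0 < q := Real.exp_pos _
  have hqq : q ^ 2 * n = 1 := by
    rw [hqdef, ← Real.exp_nat_mul]
    have : ((2 : ℕ) : ℝ) * -(Real.log n / 2) = -Real.log n := by push_cast; ring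
    rw [this, Real.exp_neg, Real.exp_log (by linarith)]
    field_simp
  have hdev : p₀ * (n / 3) ≤ deviation VotingProgram.group
      (fun v : P.FreeVar => Real.sigmoid (P.unary v.1)) j (allTrue _) := by
    rw [deviation, ← Finset.sum_filter]
    have h1 := Finset.card_nsmul_le_sum
      (Finset.univ.filter fun v : P.FreeVar => VotingProgram.group v = some j)
      (fun v => (if allTrue P.FreeVar v = true then (1 : ℝ) else 0) - Real.sigmoid (P.unary v.1))
      p₀ (fun v _ => by
        have := (hNP.prob_mem v).2
        simp only [allTrue, if_true]
        linarith)
    refine le_trans ?_ h1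
    rw [nsmul_eq_mul, mul_comm]
    refine mul_le_mul_of_nonneg_right ?_ hp₀.le
    have h2 : (n : ℝ) ≤ 1 + 2 * size (VotingProgram.group (P := P)) j := by exact_mod_cast hj
    have h3 : ((Finset.univ.filter fun v : P.FreeVar => VotingProgram.group v = some j).card : ℝ) =
      size (VotingProgram.group (P := P)) j := rfl
    rw [h3]
    linarith
  -- after `n log n / 8` steps the mean is still of order `n ^ (3 / 4)`, against a standard
  -- deviation of order `n ^ (1 / 2)`
  have hdecay : Real.exp (-(Real.log n / 4)) ≤ (1 - 1 / (Fintype.card P.FreeVar : ℝ)) ^ k := by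
    rw [hcard]
    have h1 := exp_neg_two_mul_le (x := 1 / (n : ℝ)) (by positivity) (by
      rw [div_le_div_iff₀ (by linarith) (by norm_num)]; linarith)
    refine le_trans ?_ (pow_le_pow_left₀ (Real.exp_pos _).le h1 k)
    rw [← Real.exp_nat_mul]
    apply Real.exp_le_exp.mpr
    have h2 : (k : ℝ) * (1 / n) ≤ 1 / 8 * Real.log n := by
      rw [mul_one_div, div_le_iff₀ (by linarith)]
      linarith
    linarith
  have hm_ge : Real.exp (-(Real.log n / 4)) * (p₀ * (n / 3)) ≤ m :=
    mul_le_mul hdecay hdev (by positivity) (le_trans (Real.exp_pos _).le hdecay)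
  have hm0 : 0 < m := lt_of_lt_of_le (by positivity) hm_ge
  have hm2 : q * (p₀ * (n / 3)) ^ 2 ≤ m ^ 2 := by
    have h1 := pow_le_pow_left₀ (by positivity) hm_ge 2
    rw [mul_pow, ← Real.exp_nat_mul] at h1
    have h2 : ((2 : ℕ) : ℝ) * -(Real.log n / 4) = -(Real.log n / 2) := by push_cast; ring
    rwa [h2] at h1
  have hV : ∀ f : P.World → ℝ, expect (VotingProgram.law s (PMF.pure (allTrue _)) k) f =
      (glauber (VotingProgram.prob s) ^ k) f (allTrue _) := fun f => by
    rw [VotingProgram.expect_law, expect_pure]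
  have hTV := le_tvDist_of_second_moments
    (μ := VotingProgram.law s (PMF.pure (allTrue P.FreeVar)) k) (ν := P.stationary s)
    (D := deviation VotingProgram.group (fun v : P.FreeVar => Real.sigmoid (P.unary v.1)) j)
    (V := D + n) hm0
    (by
      rw [hV]
      have := hNP.glauber_pow_sq_deviation_sub_le hp₀ hp₀' k
      rw [← hm, hcard] at this
      exact this)
    (by
      have := hNP.expect_sq_deviation_le hp₀ hp₀'
        (VotingProgram.expect_stationary_glauber_pow s)
      rw [hcard] at this
      exact this)
  refine lt_of_lt_of_le ?_ hTV
  have h5 : 8 * (D + n) / m ^ 2 ≤ 144 / p₀ ^ 2 * q := by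
    rw [div_le_iff₀ (by positivity)]
    have h6 := mul_le_mul_of_nonneg_left hm2 (by positivity : 0 ≤ 144 / p₀ ^ 2 * q)
    have h7 : 144 / p₀ ^ 2 * q * (q * (p₀ * (n / 3)) ^ 2) = 16 * n * (q ^ 2 * n) := by
      field_simp
      norm_num
    rw [h7, hqq] at h6
    linarith
  linarith

/-! ### Exponential mixing time of the linear semantics -/

/-- A lower bound for both conditional probabilities at log-odds `t`. -/
theorem exp_neg_div_two_le_sigmoid {c t : ℝ} (h : |t| ≤ c) :
    Real.exp (-c) / 2 ≤ Real.sigmoid t ∧ Real.exp (-c) / 2 ≤ 1 - Real.sigmoid t := by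
  have key : ∀ u : ℝ, -c ≤ u → Real.exp (-c) / 2 ≤ Real.sigmoid u := by
    intro u hu
    refine le_trans ?_ (Real.sigmoid_le hu)
    have h0 : Real.exp (-c) * Real.exp c = 1 := by rw [← Real.exp_add]; simp
    have h1 : Real.exp (-c) ≤ 1 := Real.exp_le_one_iff.mpr (by linarith [abs_nonneg t])
    rw [Real.sigmoid_def, neg_neg, ← one_div, div_le_div_iff₀ two_pos (by positivity)]
    linarith
  rw [← Real.sigmoid_neg]
  exact ⟨key t (abs_le.mp h).1, key (-t) (by linarith [(abs_le.mp h).2])⟩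

namespace VotingProgram

variable {P : VotingProgram}

theorem abs_logit_of_query_le (x : P.World) {v : P.FreeVar} (h : group v = none) {B : ℝ}
    (hB : P.WeightsBoundedBy B) :
    |weight .linear (Function.update x v true) - weight .linear (Function.update x v false)| ≤
      2 * B * P.numVars := by
  have hu : upCount x ≤ P.numUp := (Finset.card_le_univ _).trans_eq (Fintype.card_fin _)
  have hd : downCount x ≤ P.numDown := (Finset.card_le_univ _).trans_eq (Fintype.card_fin _)
  have hB0 : 0 ≤ B := (abs_nonneg _).trans hB.1
  have h1 : |P.ruleUp * (upCount x : ℝ)| ≤ B * P.numUp := by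
    rw [abs_mul, Nat.abs_cast]
    exact mul_le_mul hB.1 (by exact_mod_cast hu) (by positivity) hB0
  have h2 : |P.ruleDown * (downCount x : ℝ)| ≤ B * P.numDown := by
    rw [abs_mul, Nat.abs_cast]
    exact mul_le_mul hB.2.1 (by exact_mod_cast hd) (by positivity) hB0
  have h3 := hB.2.2 v.1
  rw [logit_of_query _ _ h, Fintype.sum_bool, ← upCount_eq, ← downCount_eq]
  simp only [ruleWeight, if_true, Bool.false_eq_true, if_false, Semantics.g]
  simp only [numVars]
  push_cast
  rw [abs_le] at *
  constructor <;> linarith [h1.1, h1.2, h2.1, h2.2, h3.1, h3.2]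

/-- The uniform ergodicity of the linear semantics: the query variable alone has conditional
probabilities that can be exponentially small, so running through all the sites forgets the start
with probability at least `exp (-O(n))`. -/
theorem osc_contraction_of_linear [Nonempty P.FreeVar] {B : ℝ} (hB : P.WeightsBoundedBy B)
    (f : P.World → ℝ) (hf : OscLE f 1) :
    OscLE ((glauber (prob .linear) ^ Fintype.card P.FreeVar) f)
      (1 - Real.exp (-((2 + 4 * B) * P.numVars))) := by
  have hB0 : 0 ≤ B := (abs_nonneg _).trans hB.1
  set e := Real.exp (-(2 * B * P.numVars)) with he
  set a := Real.exp (-(2 * B)) / 2 with ha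
  have he1 : e ≤ 1 := Real.exp_le_one_iff.mpr (by rw [neg_nonpos]; positivity)
  have hn1 : (1 : ℝ) ≤ P.numVars := by exact_mod_cast P.one_le_numVars
  have hbound : ∀ (x : P.World) (v : P.FreeVar),
      a * (if group v = none then e else 1) ≤ prob .linear x v ∧
      a * (if group v = none then e else 1) ≤ 1 - prob .linear x v := by
    intro x v
    split_ifs with h
    · have h1 : a * e ≤ e / 2 := by
        have : Real.exp (-(2 * B)) ≤ 1 := Real.exp_le_one_iff.mpr (by linarith)
        have := Real.exp_pos (-(2 * B * P.numVars))
        rw [ha]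
        nlinarith
      have h2 := exp_neg_div_two_le_sigmoid (abs_logit_of_query_le x h hB)
      exact ⟨h1.trans h2.1, h1.trans h2.2⟩
    · rw [mul_one]
      exact exp_neg_div_two_le_sigmoid (abs_logit_of_group_le .linear x h hB)
  refine glauber_osc_contraction (prob_isProb .linear)
    (lo := fun v => a * if group v = none then e else 1) (fun v => ?_)
    (fun x v => (hbound x v).1) (fun x v => (hbound x v).2) ?_ f hf
  · positivity
  have hN : (Fintype.card P.FreeVar : ℝ) ≤ P.numVars := by exact_mod_cast card_freeVar_le P
  -- at most one of the free variables is the query variable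
  have hprod : e ≤ ∏ v : P.FreeVar, if group v = none then e else 1 := by
    rw [Finset.prod_ite, Finset.prod_const, Finset.prod_const_one, mul_one]
    refine (pow_one e).symm.le.trans (pow_le_pow_of_le_one (Real.exp_pos _).le he1 ?_)
    refine Finset.card_le_one.mpr fun v hv w hw => Subtype.ext ?_
    rw [Finset.mem_filter_univ, group_eq_none_iff] at hv hw
    rw [hv, hw]
  have ha' : Real.exp (-(1 + 2 * B)) ≤ a := by
    rw [ha, neg_add, Real.exp_add, mul_comm, div_eq_mul_inv]
    refine mul_le_mul_of_nonneg_left ?_ (Real.exp_pos _).le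
    rw [Real.exp_neg]
    refine inv_anti₀ two_pos ?_
    have := Real.add_one_le_exp 1
    linarith
  rw [Finset.prod_mul_distrib, Finset.prod_const, Finset.card_univ]
  calc Real.exp (-((2 + 4 * B) * P.numVars))
      ≤ Real.exp (-(Fintype.card P.FreeVar : ℝ)) *
        (Real.exp (-(1 + 2 * B)) ^ Fintype.card P.FreeVar * e) := by
        rw [he, ← Real.exp_nat_mul, ← Real.exp_add, ← Real.exp_add]
        refine Real.exp_le_exp.mpr ?_
        nlinarith
    _ ≤ _ := by gcongr

end VotingProgram

/-- The linear semantics with bounded weights mixes in exponential time. -/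
theorem exists_mixing_time_of_linear (B : ℝ) : ∃ τ : ℕ → ℝ,
    (∃ C : ℝ, ∀ n : ℕ, τ n ≤ (2 : ℝ) ^ (C * (n : ℝ))) ∧
    ∀ P : VotingProgram, P.WeightsBoundedBy B →
      ∀ (μ : PMF P.World) (ε : ℝ), 0 < ε →
        ∀ k : ℕ, τ P.numVars * Real.log (1 + 1 / ε) ≤ (k : ℝ) →
          tvDist (VotingProgram.law .linear μ k) (P.stationary .linear) ≤ ε := by
  refine ⟨fun n => Real.exp ((5 + 4 * B) * n), ⟨(5 + 4 * B) / Real.log 2, fun n => ?_⟩, ?_⟩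
  · have := Real.log_pos one_lt_two
    rw [Real.rpow_def_of_pos two_pos]
    refine (congrArg Real.exp ?_).le
    field_simp
  · intro P hP μ ε hε k hk
    have hB0 : 0 ≤ B := (abs_nonneg _).trans hP.1
    have hn1 : (1 : ℝ) ≤ P.numVars := by exact_mod_cast P.one_le_numVars
    have hm1 : max (Fintype.card P.FreeVar) 1 ≤ P.numVars :=
      max_le (VotingProgram.card_freeVar_le P) P.one_le_numVars
    refine VotingProgram.tvDist_law_le (m := max (Fintype.card P.FreeVar) 1)
      (δ := Real.exp (-((2 + 4 * B) * P.numVars))) (by positivity) (Real.exp_pos _)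
      (Real.exp_lt_one_iff.mpr (by rw [neg_lt_zero]; positivity)) (fun hne f hf => ?_) μ hε
      (le_trans (mul_le_mul_of_nonneg_right ?_ ?_) hk)
    · rw [max_eq_left (Nat.one_le_iff_ne_zero.mpr Fintype.card_ne_zero)]
      exact VotingProgram.osc_contraction_of_linear hP f hf
    · rw [Real.exp_neg, div_inv_eq_mul]
      have h1 : 3 * ((max (Fintype.card P.FreeVar) 1 : ℕ) : ℝ) ≤ Real.exp (3 * P.numVars) := by
        have h2 : ((max (Fintype.card P.FreeVar) 1 : ℕ) : ℝ) ≤ P.numVars := by exact_mod_cast hm1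
        have := Real.add_one_le_exp (3 * (P.numVars : ℝ))
        linarith
      calc _ ≤ Real.exp (3 * P.numVars) * Real.exp ((2 + 4 * B) * P.numVars) := by gcongr
        _ = _ := by rw [← Real.exp_add]; ring_nf
    · exact Real.log_nonneg (by have : 0 ≤ 1 / ε := by positivity
                                linarith)

/-! ### Bottlenecks -/

/-- From a suitable point of `A`, a chain with stationary weights `w` leaves `A` slowly if the
stationary flow from the complement into `A` is small against the weight of `A`. Its flow out of
`A` is the same. -/
theorem IsMarkov.exists_pow_indicator_ge {Ω : Type} [Fintype Ω] {T : (Ω → ℝ) →ₗ[ℝ] (Ω → ℝ)}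
    (hT : IsMarkov T) {w : Ω → ℝ} (hw : ∀ x, 0 < w x)
    (hstat : ∀ f : Ω → ℝ, ∑ x, w x * T f x = ∑ x, w x * f x) {A : Set Ω} (hA : A.Nonempty)
    (K : ℕ) : ∃ x ∈ A, ∀ k ≤ K,
      1 - K * ((∑ x, w x * Aᶜ.indicator (T (A.indicator 1)) x) / ∑ x, w x * A.indicator 1 x) ≤
        (T ^ k) (A.indicator 1) x := by
  classical
  set χ : Ω → ℝ := A.indicator 1 with hχ
  set Z := ∑ x, w x * χ x with hZdef
  set L := ∑ x, w x * Aᶜ.indicator (T χ) x with hL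
  -- the probability of staying in `A` for `k` steps; it decreases in `k`, and its weighted sum
  -- loses at most `L` in each step
  let h : ℕ → Ω → ℝ := fun k => (fun f => A.indicator (T f))^[k] χ
  have hsucc : ∀ k, h (k + 1) = A.indicator (T (h k)) := fun k =>
    Function.iterate_succ_apply' _ _ _
  have hχ0 : ∀ x, 0 ≤ χ x := fun x => Set.indicator_nonneg (fun _ _ => zero_le_one) x
  have hχ1 : ∀ x, χ x ≤ 1 := fun x => Set.indicator_le' (fun _ _ => le_rfl) (by simp) x
  have h0 : ∀ k x, 0 ≤ h k x := by
    intro k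
    induction k with
    | zero => exact hχ0
    | succ k ih =>
      intro x
      rw [hsucc]
      exact Set.indicator_nonneg (fun y _ => hT.nonneg _ ih y) x
  have hanti : ∀ k x, h (k + 1) x ≤ h k x := by
    intro k
    induction k with
    | zero =>
      intro x
      rw [hsucc]
      refine Set.indicator_le_indicator ?_
      have := hT.mono hχ1 x
      rwa [hT.const] at this
    | succ k ih =>
      intro x
      rw [congrFun (hsucc (k + 1)) x, congrFun (hsucc k) x]
      exact Set.indicator_le_indicator (hT.mono ih x)
  have hanti' : ∀ x, Antitone fun k => h k x := fun x => antitone_nat_of_succ_le fun k => hanti k x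
  have hle : ∀ k x, h k x ≤ (T ^ k) χ x := by
    intro k
    induction k with
    | zero => exact fun x => le_rfl
    | succ k ih =>
      intro x
      rw [hsucc, pow_succ', Module.End.mul_apply]
      refine le_trans ?_ (hT.mono ih x)
      exact Set.indicator_le_self' (fun y _ => hT.nonneg _ (h0 k) y) x
  have hmass : ∀ k : ℕ, Z - k * L ≤ ∑ x, w x * h k x := by
    intro k
    induction k with
    | zero => simp [Z, h]
    | succ k ih =>
      have h1 : ∑ x, w x * h (k + 1) x =
          ∑ x, w x * h k x - ∑ x, w x * Aᶜ.indicator (T (h k)) x := by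
        rw [← hstat (h k), ← Finset.sum_sub_distrib, hsucc]
        refine Finset.sum_congr rfl fun x _ => ?_
        have := congrFun (Set.indicator_self_add_compl A (T (h k))) x
        rw [Pi.add_apply] at this
        rw [← this]
        ring
      have h2 : ∑ x, w x * Aᶜ.indicator (T (h k)) x ≤ L := by
        refine Finset.sum_le_sum fun x _ => mul_le_mul_of_nonneg_left ?_ (hw x).le
        exact Set.indicator_le_indicator (hT.mono (fun y => hanti' y (Nat.zero_le k)) x)
      push_cast
      linarith
  -- some point of `A` does at least as well as the weighted average over `A`
  have hA' : (Finset.univ.filter (· ∈ A)).Nonempty := by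
    obtain ⟨x, hx⟩ := hA
    exact ⟨x, by simpa using hx⟩
  have hZ : 0 < Z := by
    obtain ⟨x, hx⟩ := hA
    refine Finset.sum_pos' (fun y _ => mul_nonneg (hw y).le (hχ0 y)) ⟨x, Finset.mem_univ _, ?_⟩
    simpa [hχ, hx] using hw x
  obtain ⟨x, hx, hxK⟩ := Finset.exists_le_of_sum_le (f := fun x => w x * (1 - K * (L / Z)))
    (g := fun x => w x * h K x) hA' (by
      have h1 : ∑ x ∈ Finset.univ.filter (· ∈ A), w x = Z := by
        rw [Finset.sum_filter]
        refine Finset.sum_congr rfl fun x _ => ?_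
        by_cases hx : x ∈ A <;> simp [hχ, hx]
      have h2 : ∑ x ∈ Finset.univ.filter (· ∈ A), w x * h K x = ∑ x, w x * h K x := by
        refine Finset.sum_filter_of_ne fun x _ hne => ?_
        by_contra hx
        have h3 : h K x ≤ χ x := hanti' x (Nat.zero_le K)
        simp only [hχ, Set.indicator_of_notMem hx] at h3
        exact hne (by rw [le_antisymm h3 (h0 K x), mul_zero])
      rw [← Finset.sum_mul, h1, h2]
      refine le_trans (le_of_eq ?_) (hmass K)
      field_simp)
  refine ⟨x, by simpa using hx, fun k hk => ?_⟩
  exact (le_of_mul_le_mul_left hxK (hw x)).trans ((hanti' x hk).trans (hle k x))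

namespace VotingProgram

theorem value_of_evidenceFree {P : VotingProgram} (hP : P.EvidenceFree) (x : P.World)
    (w : Var P.numUp P.numDown) : value x w = x ⟨w, hP w⟩ := dif_pos (hP w)

/-- In a program without evidence the sum of a product over the variables factorizes. -/
theorem sum_prod_value {P : VotingProgram} (hP : P.EvidenceFree)
    (f : Var P.numUp P.numDown → Bool → ℝ) :
    ∑ x : P.World, ∏ w, f w (value x w) =
      (∑ b, f .query b) * (∏ i, ∑ b, f (.up i) b) * ∏ j, ∑ b, f (.down j) b := by
  have h1 : ∑ x : P.World, ∏ w, f w (value x w) =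
      ∑ y : Var P.numUp P.numDown → Bool, ∏ w, f w (y w) := by
    refine Fintype.sum_equiv
      (Equiv.arrowCongr (Equiv.subtypeUnivEquiv hP) (Equiv.refl Bool)) _ _ fun x => ?_
    refine Finset.prod_congr rfl fun w _ => ?_
    rw [value_of_evidenceFree hP]
    rfl
  rw [h1, ← Fintype.piFinset_univ, ← Finset.prod_univ_sum,
    ← (Var.equivSum P.numUp P.numDown).symm.prod_comp, Fintype.prod_sum_type,
    Fintype.prod_sum_type, Fintype.prod_unique]
  rfl

end VotingProgram

/-- A program in which a true query variable favours true "Up" and false "Down" variables, and a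
false query variable the opposite. The extra weight of the "Down" variables gives most of the
stationary weight to the worlds with a false query variable. -/
def bottleneckProgram (a b : ℕ) : VotingProgram where
  numUp := a
  numDown := b
  ruleUp := Real.log 4
  ruleDown := -Real.log 4
  unary v := match v with
    | .down _ => Real.log 2
    | _ => 0
  evidence _ := none

namespace bottleneckProgram

open VotingProgram

variable {a b : ℕ}

theorem evidenceFree : (bottleneckProgram a b).EvidenceFree := fun _ => rfl

instance : Nonempty (bottleneckProgram a b).FreeVar := ⟨⟨.query, rfl⟩⟩

theorem weightsBoundedBy : (bottleneckProgram a b).WeightsBoundedBy 2 := by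
  have h4 : Real.log 4 = 2 * Real.log 2 := by
    rw [show (4 : ℝ) = 2 ^ 2 by norm_num, Real.log_pow]; norm_num
  have h2 := Real.log_pos one_lt_two
  have h2' := Real.log_two_lt_d9
  have h : |Real.log 4| ≤ 2 := by rw [abs_of_nonneg (by linarith)]; linarith
  refine ⟨h, by simpa [bottleneckProgram] using h, fun v => ?_⟩
  cases v
  · simp [bottleneckProgram]
  · simp [bottleneckProgram]
  · change |Real.log 2| ≤ 2
    rw [abs_of_pos h2]
    linarith

/-- The factor that a variable with a given value contributes to the weight of a world, with `u` in
place of `4 ^ σ` for the sign `σ` of the world. -/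
def factor (u : ℝ) : Var a b → Bool → ℝ
  | .query, _ => 1
  | .up _, c => if c then u else 1
  | .down _, c => if c then 2 / u else 1

theorem factor_pos {u : ℝ} (hu : 0 < u) (w : Var a b) (c : Bool) : 0 < factor u w c := by
  cases w <;> cases c <;> simp [factor, hu]

theorem exp_weight (x : (bottleneckProgram a b).World) :
    Real.exp (weight .linear x) =
      ∏ w, factor (if value x .query then 4 else 1 / 4) w (value x w) := by
  have hprod : ∀ u : ℝ, ∏ w, factor u w (value x w) =
      u ^ upCount x * (2 / u) ^ downCount x := by
    intro u
    rw [← (Var.equivSum (bottleneckProgram a b).numUp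
      (bottleneckProgram a b).numDown).symm.prod_comp, Fintype.prod_sum_type, Fintype.prod_sum_type,
      Fintype.prod_unique]
    simp only [upCount, downCount, ← Finset.prod_const, Finset.prod_filter]
    change 1 * _ * _ = _
    rw [one_mul]
    rfl
  have hunary : (∑ v, if value x v then (bottleneckProgram a b).unary v else 0) =
      downCount x * Real.log 2 := by
    have h1 := (Var.equivSum a b).symm.sum_comp
      (fun v => if value x v then (bottleneckProgram a b).unary v else 0)
    rw [Fintype.sum_sum_type, Fintype.sum_sum_type, Fintype.sum_unique] at h1
    refine h1.symm.trans ?_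
    simp only [downCount, ← nsmul_eq_mul, ← Finset.sum_const, Finset.sum_filter]
    have h2 : ∀ v : Var a b, (∀ j, v ≠ .down j) → (bottleneckProgram a b).unary v = 0 := by
      intro v hv
      cases v
      · rfl
      · rfl
      · exact absurd rfl (hv _)
    have h3 : ∀ i : Unit ⊕ Fin a, (bottleneckProgram a b).unary
        ((Var.equivSum a b).symm (.inl i)) = 0 := by
      rintro (_ | _) <;> rfl
    simp only [h3, ite_self, Finset.sum_const_zero, zero_add]
    rfl
  rw [weight, hunary, hprod]
  simp only [sign, Semantics.g]
  change Real.exp (_ + Real.log 4 * _ * _ + -Real.log 4 * _ * _) = _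
  have e2 : Real.exp (Real.log 2) = 2 := Real.exp_log two_pos
  have e4 : Real.exp (Real.log 4) = 4 := Real.exp_log (by norm_num)
  split_ifs with h
  · have e : (2 : ℝ) / 4 = Real.exp (Real.log 2 - Real.log 4) := by rw [Real.exp_sub, e2, e4]
    rw [e]
    nth_rewrite 3 [← e4]
    rw [← Real.exp_nat_mul, ← Real.exp_nat_mul, ← Real.exp_add]
    ring_nf
  · have e : (2 : ℝ) / (1 / 4) = Real.exp (Real.log 2 + Real.log 4) := by
      rw [Real.exp_add, e2, e4]
      norm_num
    have e' : (1 : ℝ) / 4 = Real.exp (-Real.log 4) := by rw [Real.exp_neg, e4, one_div]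
    rw [e, e', ← Real.exp_nat_mul, ← Real.exp_nat_mul, ← Real.exp_add]
    ring_nf

/-- The partition function restricted to the worlds with a given value of the query variable. -/
theorem sum_prod_factor (u : ℝ) (q : Bool) :
    ∑ x : (bottleneckProgram a b).World,
      (if value x .query = q then ∏ w, factor u w (value x w) else 0) =
        (1 + u) ^ a * (1 + 2 / u) ^ b := by
  have h := sum_prod_value (evidenceFree (a := a) (b := b))
    (fun w c => if w = .query ∧ c ≠ q then 0 else factor u w c)
  have h1 : ∀ x : (bottleneckProgram a b).World,
      (if value x .query = q then ∏ w, factor u w (value x w) else 0) =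
        ∏ w, if w = .query ∧ value x w ≠ q then 0 else factor u w (value x w) := by
    intro x
    split_ifs with hx
    · refine Finset.prod_congr rfl fun w _ => ?_
      rw [if_neg]
      rintro ⟨rfl, hw⟩
      exact hw hx
    · symm
      refine Finset.prod_eq_zero (Finset.mem_univ Var.query) ?_
      exact if_pos ⟨rfl, hx⟩
  refine (Finset.sum_congr rfl fun x _ => h1 x).trans (h.trans ?_)
  have hu : (Finset.univ : Finset (Fin (bottleneckProgram a b).numUp)).card = a :=
    Finset.card_fin a
  have hd : (Finset.univ : Finset (Fin (bottleneckProgram a b).numDown)).card = b :=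
    Finset.card_fin b
  cases q <;> simp [factor, hu, hd, add_comm]

/-- The worlds in which the query variable is true. -/
def queryTrue (a b : ℕ) : Set (bottleneckProgram a b).World := {x | value x .query = true}

theorem mem_queryTrue {x : (bottleneckProgram a b).World} :
    x ∈ queryTrue a b ↔ value x .query = true := Iff.rfl

theorem sum_exp_mul_indicator_queryTrue :
    ∑ x, Real.exp (weight .linear x) * (queryTrue a b).indicator 1 x =
      5 ^ a * (3 / 2) ^ b := by
  have h := sum_prod_factor (a := a) (b := b) 4 true
  norm_num at h
  rw [← h]
  refine Finset.sum_congr rfl fun x _ => ?_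
  rw [exp_weight]
  by_cases hx : value x .query = true <;> simp [Set.indicator, mem_queryTrue, hx]

theorem sum_exp_ge : (5 / 4) ^ a * 9 ^ b ≤
    ∑ x : (bottleneckProgram a b).World, Real.exp (weight .linear x) := by
  have h := sum_prod_factor (a := a) (b := b) (1 / 4) false
  norm_num at h
  rw [← h]
  refine Finset.sum_le_sum fun x _ => ?_
  by_cases hx : value x .query = true
  · simpa [hx] using (Real.exp_pos _).le
  · rw [exp_weight]
    simp [hx]

/-- The stationary flow between the worlds with a false and with a true query variable: for a pair
of neighbouring worlds it is at most the geometric mean of their weights, in which the rules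
cancel. -/
theorem flow_le : ∑ x, Real.exp (weight .linear x) * (queryTrue a b)ᶜ.indicator
    (glauber (prob .linear) ((queryTrue a b).indicator 1)) x ≤ 2 ^ a * 3 ^ b := by
  have h := sum_prod_factor (a := a) (b := b) 1 false
  norm_num at h
  rw [← h]
  refine Finset.sum_le_sum fun x _ => ?_
  by_cases hx : value x .query = true
  · simp [mem_queryTrue, hx]
  let q : (bottleneckProgram a b).FreeVar := ⟨.query, rfl⟩
  have hx0 : Function.update x q false = x := by
    rw [Function.update_eq_self_iff, ← value_of_evidenceFree evidenceFree x .query]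
    simpa using hx
  have hsite : ∀ v : (bottleneckProgram a b).FreeVar,
      siteUpdate (prob .linear) v ((queryTrue a b).indicator 1) x ≤
        if v = q then prob .linear x q else 0 := by
    intro v
    split_ifs with hv
    · subst hv
      have h1 := (prob_isProb .linear x q).1
      simp only [siteUpdate, Set.indicator, mem_queryTrue, value_update]
      simp [q]
    · have hv' : Var.query ≠ v.1 := fun hq => hv (Subtype.ext hq.symm)
      simp only [siteUpdate, Set.indicator, mem_queryTrue, value_update]
      simp [hv', hx]
  have hstep : glauber (prob .linear) ((queryTrue a b).indicator 1) x ≤ prob .linear x q := by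
    have hN : (1 : ℝ) ≤ Fintype.card (bottleneckProgram a b).FreeVar := by
      exact_mod_cast Fintype.card_pos
    rw [glauber_apply, inv_mul_le_iff₀ (by linarith)]
    refine (Finset.sum_le_sum fun v _ => hsite v).trans ?_
    rw [Finset.sum_ite_eq' Finset.univ q, if_pos (Finset.mem_univ _)]
    exact le_mul_of_one_le_left (prob_isProb .linear x q).1 hN
  rw [Set.indicator_of_mem (by simpa [mem_queryTrue] using hx),
    if_pos (by simpa using hx : value x .query = false)]
  refine (mul_le_mul_of_nonneg_left hstep (Real.exp_pos _).le).trans ?_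
  rw [prob, hx0, sigmoid_sub]
  have hW0 : Real.exp (weight .linear x) = ∏ w, factor (1 / 4) w (value x w) := by
    rw [exp_weight, if_neg hx]
  have hW1 : Real.exp (weight .linear (Function.update x q true)) =
      ∏ w, factor 4 w (value x w) := by
    rw [exp_weight, value_update, if_pos rfl, if_pos rfl]
    refine Finset.prod_congr rfl fun w _ => ?_
    rw [value_update]
    split_ifs with hw
    · subst hw
      rfl
    · rfl
  have hmul : Real.exp (weight .linear (Function.update x q true)) *
      Real.exp (weight .linear x) = (∏ w, factor 1 w (value x w)) ^ 2 := by
    rw [hW0, hW1, ← Finset.prod_mul_distrib, ← Finset.prod_pow]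
    refine Finset.prod_congr rfl fun w _ => ?_
    cases w <;> simp only [factor] <;> first | split_ifs <;> norm_num | norm_num
  have h0 := Real.exp_pos (weight .linear x)
  have h1 := Real.exp_pos (weight .linear (Function.update x q true))
  have hC : 0 < ∏ w, factor 1 w (value x w) :=
    Finset.prod_pos fun w _ => factor_pos one_pos w _
  generalize Real.exp (weight .linear x) = u at *
  generalize Real.exp (weight .linear (Function.update x q true)) = v at *
  generalize ∏ w, factor 1 w (value x w) = c at *
  have hcle : c ≤ v + u := abs_le_of_sq_le_sq' (by nlinarith) (by positivity) |>.2
  rw [mul_div_assoc', div_le_iff₀ (by positivity)]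
  nlinarith

theorem queryTrue_nonempty : (queryTrue a b).Nonempty :=
  ⟨fun _ => true, value_of_evidenceFree evidenceFree _ _⟩

/-- The worlds with a true query variable are exponentially unlikely. -/
theorem expect_stationary_queryTrue_le (hab : a ≤ b) :
    expect ((bottleneckProgram a b).stationary .linear) ((queryTrue a b).indicator 1) ≤
      (2 / 3) ^ a := by
  rw [expect_stationary, sum_exp_mul_indicator_queryTrue]
  have h := sum_exp_ge (a := a) (b := b)
  have hpos : (0 : ℝ) < (5 / 4) ^ a * 9 ^ b := by positivity
  rw [div_le_iff₀ (hpos.trans_le h)]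
  refine le_trans ?_ (mul_le_mul_of_nonneg_left h (by positivity))
  obtain ⟨d, rfl⟩ := Nat.exists_eq_add_of_le hab
  rw [pow_add, pow_add]
  calc (5 : ℝ) ^ a * ((3 / 2) ^ a * (3 / 2) ^ d) = (15 / 2) ^ a * (3 / 2) ^ d := by
        rw [← mul_assoc, ← mul_pow]; norm_num
    _ ≤ (15 / 2) ^ a * 9 ^ d := by gcongr; norm_num
    _ = _ := by
        rw [← mul_assoc, ← mul_assoc, ← mul_pow, ← mul_pow]; norm_num

/-- From some world the linear chain of the program stays close to certainty among the worlds with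
a true query variable for exponentially many steps, although these worlds have exponentially small
stationary probability. -/
theorem exists_tvDist_ge (hab : a ≤ b) (hba : b ≤ a + 1) (K : ℕ) :
    ∃ x : (bottleneckProgram a b).World, ∀ k ≤ K,
      1 - 2 * K * (4 / 5) ^ a - (2 / 3) ^ a ≤
        tvDist (law .linear (PMF.pure x) k) ((bottleneckProgram a b).stationary .linear) := by
  obtain ⟨x, -, hx⟩ := (glauber_isMarkov (prob_isProb .linear)).exists_pow_indicator_ge
    (w := fun x : (bottleneckProgram a b).World => Real.exp (weight .linear x))
    (fun x => Real.exp_pos _) (sum_exp_mul_glauber .linear) (queryTrue_nonempty (a := a) (b := b)) K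
  refine ⟨x, fun k hk => ?_⟩
  have h1 := hx k hk
  have h2 := expect_sub_le_tvDist (law .linear (PMF.pure x) k)
    ((bottleneckProgram a b).stationary .linear) (queryTrue a b)
  have h3 := expect_stationary_queryTrue_le hab
  rw [expect_law, expect_pure] at h2
  have hflow : (∑ x, Real.exp (weight .linear x) * (queryTrue a b)ᶜ.indicator
      (glauber (prob .linear) ((queryTrue a b).indicator 1)) x) /
      (∑ x, Real.exp (weight .linear x) * (queryTrue a b).indicator 1 x) ≤ 2 * (4 / 5) ^ a := by
    rw [sum_exp_mul_indicator_queryTrue, div_le_iff₀ (by positivity)]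
    refine flow_le.trans ?_
    have h4 : (2 : ℝ) ^ b ≤ 2 * 2 ^ a := by
      rw [← pow_succ']
      exact pow_le_pow_right₀ one_le_two hba
    have h5 : (3 : ℝ) ^ b = 2 ^ b * (3 / 2) ^ b := by rw [← mul_pow]; norm_num
    calc (2 : ℝ) ^ a * 3 ^ b = 2 ^ a * (3 / 2) ^ b * 2 ^ b := by rw [h5]; ring
      _ ≤ 2 ^ a * (3 / 2) ^ b * (2 * 2 ^ a) := by gcongr
      _ = 2 * (2 * 2) ^ a * (3 / 2) ^ b := by rw [mul_pow]; ring
      _ = 2 * (4 / 5 * 5) ^ a * (3 / 2) ^ b := by norm_num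
      _ = _ := by rw [mul_pow]; ring
  have h6 := mul_le_mul_of_nonneg_left hflow (Nat.cast_nonneg (α := ℝ) K)
  linarith

end bottleneckProgram

/-- For the linear semantics there are programs with bounded weights that need exponential time. -/
theorem exists_lower_bound_of_linear : ∃ (B c : ℝ) (P : ℕ → VotingProgram), 0 < c ∧
    (∀ n : ℕ, 1 ≤ n → (P n).numVars = n ∧ (P n).WeightsBoundedBy B ∧ (P n).EvidenceFree) ∧
    ∀ ε : ℝ, 0 < ε → ε < 1 → ∀ᶠ n : ℕ in atTop,
      ∃ x : (P n).World, ∀ k : ℕ, (k : ℝ) < (2 : ℝ) ^ (c * (n : ℝ)) →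
        ε < tvDist (VotingProgram.law .linear (PMF.pure x) k)
          ((P n).stationary .linear) := by
  refine ⟨2, 1 / 10, fun n => bottleneckProgram ((n - 1) / 2) (n - 1 - (n - 1) / 2),
    by norm_num, fun n hn => ⟨?_, bottleneckProgram.weightsBoundedBy,
      bottleneckProgram.evidenceFree⟩, fun ε hε hε1 => ?_⟩
  · simp only [VotingProgram.numVars, bottleneckProgram]
    omega
  · have hhalf : Tendsto (fun n : ℕ => (n - 1) / 2) atTop atTop :=
      tendsto_atTop_atTop.mpr fun m => ⟨2 * m + 1, fun n hn => by omega⟩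
    have hlim : Tendsto (fun a : ℕ => 1 - 6 * (24 / 25 : ℝ) ^ a - (2 / 3 : ℝ) ^ a) atTop
        (nhds 1) := by
      have h1 := tendsto_pow_atTop_nhds_zero_of_lt_one (r := (24 / 25 : ℝ)) (by norm_num)
        (by norm_num)
      have h2 := tendsto_pow_atTop_nhds_zero_of_lt_one (r := (2 / 3 : ℝ)) (by norm_num)
        (by norm_num)
      simpa using ((h1.const_mul 6).const_sub 1).sub h2
    filter_upwards [(hlim.comp hhalf).eventually (lt_mem_nhds hε1), eventually_ge_atTop 1]
      with n hn hn1
    simp only [Function.comp_apply] at hn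
    set a := (n - 1) / 2 with ha
    -- since `2 ≤ (6 / 5) ^ 5`, the number of steps is small against `(5 / 4) ^ a`
    have hK : (2 : ℝ) ^ (1 / 10 * (n : ℝ)) ≤ (6 / 5) ^ (a + 1) := by
      have hna : (n : ℝ) ≤ 2 * a + 2 := by
        have : n ≤ 2 * a + 2 := by omega
        exact_mod_cast this
      calc (2 : ℝ) ^ (1 / 10 * (n : ℝ)) ≤ ((6 / 5 : ℝ) ^ (5 : ℝ)) ^ (1 / 10 * (n : ℝ)) :=
            Real.rpow_le_rpow two_pos.le (by norm_num) (by positivity)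
        _ = (6 / 5 : ℝ) ^ (5 * (1 / 10 * (n : ℝ))) := (Real.rpow_mul (by norm_num) _ _).symm
        _ ≤ (6 / 5 : ℝ) ^ ((a + 1 : ℕ) : ℝ) :=
            Real.rpow_le_rpow_of_exponent_le (by norm_num) (by push_cast; linarith)
        _ = _ := Real.rpow_natCast _ _
    obtain ⟨x, hx⟩ := bottleneckProgram.exists_tvDist_ge (a := a) (b := n - 1 - a) (by omega)
      (by omega) ⌈(2 : ℝ) ^ (1 / 10 * (n : ℝ))⌉₊
    refine ⟨x, fun k hk => lt_of_lt_of_le (lt_of_lt_of_le hn ?_)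
      (hx k (by exact_mod_cast hk.le.trans (Nat.le_ceil _)))⟩
    have h1 := (Nat.ceil_lt_add_one (by positivity : 0 ≤ (2 : ℝ) ^ (1 / 10 * (n : ℝ)))).le
    have h2 : (1 : ℝ) ≤ (6 / 5) ^ a := one_le_pow₀ (by norm_num)
    have h3 : (⌈(2 : ℝ) ^ (1 / 10 * (n : ℝ))⌉₊ : ℝ) ≤ 3 * (6 / 5) ^ a := by
      rw [pow_succ] at hK
      linarith
    have h4 : (24 / 25 : ℝ) ^ a = (6 / 5) ^ a * (4 / 5) ^ a := by rw [← mul_pow]; norm_num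
    have h5 := mul_le_mul_of_nonneg_right h3 (by positivity : (0 : ℝ) ≤ (4 / 5) ^ a)
    rw [h4]
    linarith

end Voting

end

theorem mainTheorem1 :
    -- logical and ratio semantics
    (∀ s : Voting.Semantics, s = .logical ∨ s = .ratio →
      -- convergence after `O(n log n) * log (1 + 1/ε)` steps, from every initial distribution
      (∀ B : ℝ, ∃ τ : ℕ → ℝ,
        τ =O[atTop] (fun n : ℕ => (n : ℝ) * Real.log (n : ℝ)) ∧
        ∀ P : Voting.VotingProgram, P.WeightsBoundedBy B →
          ∀ (μ : PMF P.World) (ε : ℝ), 0 < ε →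
            ∀ k : ℕ, τ P.numVars * Real.log (1 + 1 / ε) ≤ (k : ℝ) →
              Voting.tvDist (Voting.VotingProgram.law s μ k) (P.stationary s) ≤ ε) ∧
      -- `Ω(n log n)` steps are necessary
      (∀ B : ℝ, ∃ c : ℝ, 0 < c ∧
        ∀ ε : ℝ, 0 < ε → ε < 1 → ∀ᶠ n : ℕ in atTop,
          ∀ P : Voting.VotingProgram, P.numVars = n → P.WeightsBoundedBy B → P.EvidenceFree →
            ∃ x : P.World, ∀ k : ℕ, (k : ℝ) < c * ((n : ℝ) * Real.log (n : ℝ)) →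
              ε < Voting.tvDist (Voting.VotingProgram.law s (PMF.pure x) k) (P.stationary s))) ∧
    -- linear semantics: convergence after `2 ^ O(n) * log (1 + 1/ε)` steps
    (∀ B : ℝ, ∃ τ : ℕ → ℝ,
      (∃ C : ℝ, ∀ n : ℕ, τ n ≤ (2 : ℝ) ^ (C * (n : ℝ))) ∧
      ∀ P : Voting.VotingProgram, P.WeightsBoundedBy B →
        ∀ (μ : PMF P.World) (ε : ℝ), 0 < ε →
          ∀ k : ℕ, τ P.numVars * Real.log (1 + 1 / ε) ≤ (k : ℝ) →
            Voting.tvDist (Voting.VotingProgram.law .linear μ k) (P.stationary .linear) ≤ ε) ∧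
    -- linear semantics: instances with bounded weights that need `2 ^ Ω(n)` steps
    (∃ (B c : ℝ) (P : ℕ → Voting.VotingProgram), 0 < c ∧
      (∀ n : ℕ, 1 ≤ n → (P n).numVars = n ∧ (P n).WeightsBoundedBy B ∧ (P n).EvidenceFree) ∧
      ∀ ε : ℝ, 0 < ε → ε < 1 → ∀ᶠ n : ℕ in atTop,
        ∃ x : (P n).World, ∀ k : ℕ, (k : ℝ) < (2 : ℝ) ^ (c * (n : ℝ)) →
          ε < Voting.tvDist (Voting.VotingProgram.law .linear (PMF.pure x) k)
            ((P n).stationary .linear)) := by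
  exact ⟨fun s hs => ⟨Voting.exists_mixing_time_of_logical_or_ratio hs,
      Voting.exists_lower_bound_of_logical_or_ratio hs⟩,
    Voting.exists_mixing_time_of_linear, Voting.exists_lower_bound_of_linear⟩
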